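/- Let $\mathfrak g=\mathfrak{sl}(2,1)$ be the Lie superalgebra of complex $3\times 3$ matrices $(a_{ij})$ with $a_{33}=a_{11}+a_{22}$, where the entries $(i,j)$ with exactly one of $i,j$ equal to $3$ are odd, the others even, and the bracket is the super commutator. Put $x_1=e_{12}$, $x_2=e_{23}$, $x_3=e_{13}$, $x_{-1}=e_{21}$, $x_{-2}=e_{32}$, $x_{-3}=e_{31}$, $h_1=e_{11}-e_{22}$, $h_2=e_{22}+e_{33}$, $\mathfrak n^+=\operatorname{span}\{x_1,x_2,x_3\}$, $\mathfrak h=\operatorname{span}\{h_1,h_2\}$, and let $\omega_1\in\mathfrak h^*$ with $\omega_1(h_1)=1$, $\omega_1(h_2)=0$. Let $A$ be a commutative associative unital $\mathbb C$-algebra with a $\mathbb C$-basis $\mathfrak B$, and choose any linear order on $\mathfrak B$. The map superalgebra $\mathfrak g\otimes A$ has bracket $[z\otimes a,z'\otimes b]=[z,z']\otimes ab$ and universal enveloping algebra $U(\mathfrak g\otimes A)$; $\mathfrak g$ is identified with $\mathfrak g\otimes 1$. For $m\in\mathbb Z_{\ge 0}$ let $\overline W_A(m\omega_1)$ be the left $U(\mathfrak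 g\otimes A)$-module generated by a vector $\bar w_{m\omega_1}$ with defining relations $$(\mathfrak n^+\otimes A)\bar w_{m\omega_1}=0,\quad h\bar w_{m\omega_1}=m\omega_1(h)\bar w_{m\omega_1}\ (h\in\mathfrak h),\quad x_{-1}^{m+1}\bar w_{m\omega_1}=0,\quad (x_{-2}\otimes a)\bar w_{m\omega_1}=0\ (a\in A).$$ Let $V=\mathbb C^3$ be the natural $\mathfrak g$-module with standard basis $v_1,v_2$ (even), $v_3$ (odd). Then $\mathfrak g\otimes A$ acts on $V\otimes A$ by $(z\otimes a)(u\otimes b)=zu\otimes ab$, and on $T^m(V\otimes A)=(V\otimes A)^{\otimes m}$ by $$z(w_1\otimes\dots\otimes w_m)=\sum_{j=1}^m(-1)^{|z|(|w_1|+\dots+|w_{j-1}|)}\,w_1\otimes\dots\otimes zw_j\otimes\dots\otimes w_m$$ for homogeneous $z\in\mathfrak g\otimes A$ and homogeneous $w_i$. The symmetric group $S_m$ acts by $$\sigma^{-1}(w_1\otimes\dots\otimes w_m)=\Big(\prod_{j<k,\ \sigma(j)>\sigma(k)}(-1)^{|w_{\sigma(j)}||w_{\sigma(k)}|}\Big)\,w_{\sigma(1)}\otimes\dots\otimes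 w_{\sigma(m)}$$ for homogeneous $w_i$, and $TS^m(V\otimes A)$ denotes the $\mathbb C$-span of all $\sum_{\sigma\in S_m}\sigma^{-1}(w_1\otimes\dots\otimes w_m)$ with $w_i\in V\otimes A$; it is a $U(\mathfrak g\otimes A)$-submodule of $T^m(V\otimes A)$. For a set $S$ let $\mathcal F(S)$ be the set of finitely supported functions $\chi:S\to\mathbb Z_{\ge 0}$, with $|\chi|=\sum_{s}\chi(s)$ and pointwise order $\le$, and let $\chi_s$ be the characteristic function of $\{s\}$. We regard $\mathcal F(\mathfrak B)\subset\mathcal F(A)$ by extension by zero. For $\psi\in\mathcal F(A)$ put $\pi(\psi)=\prod_{a}a^{\psi(a)}$ and $\mathcal M(\psi)=|\psi|!/\prod_a\psi(a)!$. Define $p_1:\mathcal F(A)^2\to U(\mathfrak g\otimes A)$ recursively by $p_1(0,0)=1$, $$p_1(0,\chi)=-\frac1{|\chi|}\sum_{0\ne\psi\le\chi}\mathcal M(\psi)\,(h_1\otimes\pi(\psi))\,p_1(0,\chi-\psi)\qquad(\chi\neq0),$$ $$p_1(\varphi,\chi)=-\frac1{|\varphi|}\sum_{d\in\operatorname{supp}\varphi}\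 \sum_{\psi\le\chi}\mathcal M(\psi)\,(x_{-1}\otimes d\,\pi(\psi))\,p_1(\varphi-\chi_d,\chi-\psi)\qquad(\varphi\ne0),$$ and for $\xi=(\xi(1),\dots,\xi(n))\in A^n$ put $$p(\varphi_1,\varphi_2,\xi)=p_1(\varphi_2,\varphi_1)\,(x_{-3}\otimes\xi(1))\cdots(x_{-3}\otimes\xi(n)).$$ **Theorem.** For every $m\in\mathbb Z_{\ge0}$ the assignment $\bar w_{m\omega_1}\mapsto(v_1\otimes1)^{\otimes m}$ extends to an isomorphism $\Phi:\overline W_A(m\omega_1)\to TS^m(V\otimes A)$ of $U(\mathfrak g\otimes A)$-modules. Moreover, the elements $p(\varphi_1,\varphi_2,\xi)\,\bar w_{m\omega_1}$, indexed by the triples with $\varphi_1,\varphi_2\in\mathcal F(\mathfrak B)$, $\xi=(\xi(1)<\dots<\xi(n))$ a strictly increasing sequence in $\mathfrak B$, and $|\varphi_1|+|\varphi_2|+n=m$, form a $\mathbb C$-basis of $\overline W_A(m\omega_1)$. -/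

import Mathlib

open scoped TensorProduct

noncomputable section

namespace SuperWeyl

/-! ### Signs and parities -/

/-- The sign `(-1)^e` of a parity `e`, with `0` for even and `1` for odd. -/
def sgn (e : ZMod 2) : ℂ := if e = 0 then 1 else -1

theorem sgn_zero : sgn 0 = 1 := by simp [sgn]

theorem sgn_add (e f : ZMod 2) : sgn (e + f) = sgn e * sgn f := by
  have h : (1 : ZMod 2) + 1 = 0 := by decide
  have key : ∀ a : ZMod 2, a = 0 ∨ a = 1 := by decide
  rcases key e with rfl | rfl <;> rcases key f with rfl | rfl <;> simp [sgn, h]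

theorem sgn_mul_self (e : ZMod 2) : sgn e * sgn e = 1 := by
  unfold sgn; split_ifs <;> norm_num

/-- The parity of the three basis vectors of `V = ℂ^{2|1}`. -/
def par (i : Fin 3) : ZMod 2 := if i = 2 then 1 else 0

/-! ### The Lie superalgebra `sl(2,1)` -/

abbrev Mat := Matrix (Fin 3) (Fin 3) ℂ

/-- The component of parity `e` of a `3 × 3` matrix with diagonal blocks of sizes `2` and `1`. -/
def matPart (e : ZMod 2) : Mat →ₗ[ℂ] Mat where
  toFun X := Matrix.of fun i j => if par i + par j = e then X i j else 0
  map_add' X Y := by ext i j; by_cases h : par i + par j = e <;> simp [h]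
  map_smul' c X := by ext i j; by_cases h : par i + par j = e <;> simp [h]

theorem matPart_apply (e : ZMod 2) (X : Mat) (i j : Fin 3) :
    matPart e X i j = if par i + par j = e then X i j else 0 := rfl

/-- The space underlying `sl(2,1)`: matrices of supertrace zero. -/
def sl21 : Submodule ℂ Mat where
  carrier := {X | X 2 2 = X 0 0 + X 1 1}
  add_mem' {X Y} hX hY := by
    simp only [Set.mem_ofPred_eq, Matrix.add_apply] at *
    rw [hX, hY]; ring
  zero_mem' := by simp
  smul_mem' c X hX := by
    simp only [Set.mem_ofPred_eq, Matrix.smul_apply, smul_eq_mul] at *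
    rw [hX]; ring

theorem mem_sl21 {X : Mat} : X ∈ sl21 ↔ X 2 2 = X 0 0 + X 1 1 := Iff.rfl

theorem matPart_mem (e : ZMod 2) {X : Mat} (hX : X ∈ sl21) : matPart e X ∈ sl21 := by
  rw [mem_sl21] at *
  have h : ∀ i, par i + par i = 0 := by decide
  simp only [matPart_apply, h]
  split_ifs
  · exact hX
  · simp

/-- The component of parity `e` of an element of `sl(2,1)`. -/
def part (e : ZMod 2) : sl21 →ₗ[ℂ] sl21 :=
  (matPart e).restrict fun _ hX => matPart_mem e hX

/-- The super commutator of matrices: `[X, Y] = X Y - (-1)^{e f} Y X` when `X` has parity `e` and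
`Y` has parity `f`, extended bilinearly. -/
def matBracket : Mat →ₗ[ℂ] Mat →ₗ[ℂ] Mat :=
  ∑ e : ZMod 2, ∑ f : ZMod 2,
    ((LinearMap.mul ℂ Mat).compl₁₂ (matPart e) (matPart f)
      - sgn (e * f) • (LinearMap.mul ℂ Mat).flip.compl₁₂ (matPart e) (matPart f))

theorem matBracket_apply (X Y : Mat) : matBracket X Y = ∑ e : ZMod 2, ∑ f : ZMod 2,
    (matPart e X * matPart f Y - sgn (e * f) • (matPart f Y * matPart e X)) := by
  simp [matBracket, LinearMap.sum_apply]

theorem zmod2_sum {N : Type*} [AddCommMonoid N] (f : ZMod 2 → N) : ∑ e : ZMod 2, f e = f 0 + f 1 :=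
  Fin.sum_univ_two f

theorem matBracket_mem (X Y : Mat) : matBracket X Y ∈ sl21 := by
  rw [mem_sl21, matBracket_apply]
  simp [zmod2_sum, sgn, Matrix.mul_apply, Fin.sum_univ_three, matPart_apply, par,
    show (1 : ZMod 2) + 1 = 0 by decide]
  ring

/-- The bracket of the Lie superalgebra `sl(2,1)`. -/
def bracket : sl21 →ₗ[ℂ] sl21 →ₗ[ℂ] sl21 :=
  LinearMap.mk₂ ℂ (fun X Y => ⟨matBracket X Y, matBracket_mem X Y⟩)
    (fun X X' Y => by ext1; simp) (fun c X Y => by ext1; simp)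
    (fun X Y Y' => by ext1; simp) (fun c X Y => by ext1; simp)

theorem coe_bracket (X Y : sl21) : (bracket X Y : Mat) = matBracket X Y := rfl

/-- The matrix units `e_{ij}` with `i ≠ j`, as elements of `sl(2,1)`. -/
def unit (i j : Fin 3) (h : i ≠ j) : sl21 :=
  ⟨Matrix.single i j 1, by
    rw [mem_sl21]; revert h; fin_cases i <;> fin_cases j <;> simp⟩

/-- `x_1 = e_{12}`. -/
def x1 : sl21 := unit 0 1 (by decide)
/-- `x_2 = e_{23}`. -/
def x2 : sl21 := unit 1 2 (by decide)
/-- `x_3 = e_{13}`. -/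
def x3 : sl21 := unit 0 2 (by decide)
/-- `x_{-1} = e_{21}`. -/
def y1 : sl21 := unit 1 0 (by decide)
/-- `x_{-2} = e_{32}`. -/
def y2 : sl21 := unit 2 1 (by decide)
/-- `x_{-3} = e_{31}`. -/
def y3 : sl21 := unit 2 0 (by decide)

/-- `h_1 = e_{11} - e_{22}`. -/
def h1 : sl21 := ⟨Matrix.diagonal ![1, -1, 0], by rw [mem_sl21]; simp⟩
/-- `h_2 = e_{22} + e_{33}`. -/
def h2 : sl21 := ⟨Matrix.diagonal ![0, 1, 1], by rw [mem_sl21]; simp⟩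

/-- The positive nilpotent part `𝔫⁺`. -/
def nPlus : Submodule ℂ sl21 := Submodule.span ℂ {x1, x2, x3}

/-! ### The map superalgebra and its universal enveloping algebra -/

theorem degree_sub_le {S : Type*} (χ ψ : S →₀ ℕ) : (χ - ψ).degree ≤ χ.degree := by
  have h := congrArg Finsupp.degree (tsub_add_cancel_of_le (tsub_le_self : χ - ψ ≤ χ))
  rw [map_add] at h; omega

theorem degree_sub_lt {S : Type*} {χ ψ : S →₀ ℕ} (h : ψ ≤ χ) (h0 : ψ ≠ 0) : (χ - ψ).degree < χ.degree := by
  have h1 := congrArg Finsupp.degree (tsub_add_cancel_of_le h)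
  rw [map_add] at h1
  have h2 : ψ.degree ≠ 0 := fun h' => h0 ((Finsupp.degree_eq_zero_iff ψ).1 h')
  omega

section Algebra

variable (A : Type*) [CommRing A] [Algebra ℂ A]

/-- The space underlying the map superalgebra `sl(2,1) ⊗ A`. -/
abbrev MapAlg := sl21 ⊗[ℂ] A

/-- The projection of `sl(2,1) ⊗ A` to its component of parity `e`. -/
def gpart (e : ZMod 2) : MapAlg A →ₗ[ℂ] MapAlg A := (part e).rTensor A

/-- The component `(sl(2,1) ⊗ A)_e = sl(2,1)_e ⊗ A` of parity `e`. -/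
def gr (e : ZMod 2) : Submodule ℂ (MapAlg A) := LinearMap.range (gpart A e)

/-- The bracket `[z ⊗ a, z' ⊗ b] = [z, z'] ⊗ a b` of the map superalgebra. -/
def mapBracket : MapAlg A →ₗ[ℂ] MapAlg A →ₗ[ℂ] MapAlg A :=
  TensorProduct.map₂ bracket (LinearMap.mul ℂ A)

/-- The defining relations `x y = (-1)^{e f} y x + [x, y]`, for `x` of parity `e` and `y` of
parity `f`, of the universal enveloping algebra. -/
inductive URel : TensorAlgebra ℂ (MapAlg A) → TensorAlgebra ℂ (MapAlg A) → Prop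
  | comm (e f : ZMod 2) (x y : MapAlg A) (hx : x ∈ gr A e) (hy : y ∈ gr A f) :
      URel (TensorAlgebra.ι ℂ x * TensorAlgebra.ι ℂ y)
        (sgn (e * f) • (TensorAlgebra.ι ℂ y * TensorAlgebra.ι ℂ x)
          + TensorAlgebra.ι ℂ (mapBracket A x y))

/-- The universal enveloping algebra `U(sl(2,1) ⊗ A)`. -/
abbrev U := RingQuot (URel A)

/-- The canonical map from `sl(2,1) ⊗ A` to its universal enveloping algebra. -/
def iota : MapAlg A →ₗ[ℂ] U A :=
  (RingQuot.mkAlgHom ℂ (URel A)).toLinearMap ∘ₗ TensorAlgebra.ι ℂ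

variable {A}

/-- The element `z ⊗ a` of the universal enveloping algebra. -/
def el (z : sl21) (a : A) : U A := iota A (z ⊗ₜ[ℂ] a)

/-- `X_{-2}(ξ) = ∏ k, x_{-2} ⊗ ξ(k)`, in this order. -/
def Y2 {n : ℕ} (ξ : Fin n → A) : U A := (List.ofFn fun k => el y2 (ξ k)).prod

/-- `X_{-3}(ξ) = ∏ k, x_{-3} ⊗ ξ(k)`, in this order. -/
def Y3 {n : ℕ} (ξ : Fin n → A) : U A := (List.ofFn fun k => el y3 (ξ k)).prod

/-! ### The quotient of the global Weyl module -/

variable (A)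

/-- The defining relations of the quotient `W̄_A(λ)` of the global Weyl module, for the weight
`λ = k ω₁ + l ω₂`, i.e. `λ(h₁) = k` and `λ(h₂) = l`. -/
inductive IsWeylRelator (k l : ℕ) : U A → Prop
  | pos (x : sl21) (hx : x ∈ nPlus) (a : A) : IsWeylRelator k l (el x a)
  | cartan (c₁ c₂ : ℂ) : IsWeylRelator k l
      (el (c₁ • h1 + c₂ • h2) 1 - algebraMap ℂ (U A) (c₁ * (k : ℂ) + c₂ * (l : ℂ)))
  | neg : IsWeylRelator k l (el y1 1 ^ (k + 1))
  | odd (ξ : Fin (l + 1) → A) : IsWeylRelator k l (Y2 ξ)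

/-- The left ideal generated by the defining relations. -/
def weylIdeal (k l : ℕ) : Submodule (U A) (U A) := Submodule.span (U A) {u | IsWeylRelator A k l u}

/-- The quotient `W̄_A(k ω₁ + l ω₂)` of the global Weyl module. -/
abbrev WeylQuot (k l : ℕ) := U A ⧸ weylIdeal A k l

/-- The generator `w̄` of `W̄_A(k ω₁ + l ω₂)`. -/
def wbar (k l : ℕ) : WeylQuot A k l := Submodule.Quotient.mk 1

/-! ### The natural module and the tensor powers of `V ⊗ A` -/

/-- The space `V ⊗ A`, with `V = ℂ³` the natural module. -/
abbrev VA := (Fin 3 → ℂ) ⊗[ℂ] A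

/-- The action `(z ⊗ a)(w ⊗ b) = z w ⊗ a b` of `sl(2,1) ⊗ A` on `V ⊗ A`. -/
def natAct : MapAlg A →ₗ[ℂ] Module.End ℂ (VA A) :=
  TensorProduct.map₂ (Matrix.toLin'.toLinearMap ∘ₗ sl21.subtype) (LinearMap.mul ℂ A)

/-- The projection of `V` to its component of parity `e`. -/
def vpart (e : ZMod 2) : (Fin 3 → ℂ) →ₗ[ℂ] (Fin 3 → ℂ) :=
  LinearMap.pi fun i => if par i = e then LinearMap.proj i else 0

/-- The projection of `V ⊗ A` to its component of parity `e`. -/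
def proj (e : ZMod 2) : Module.End ℂ (VA A) := (vpart e).rTensor A

/-- The operator `w ↦ (-1)^{e |w|} w` on `V ⊗ A`. -/
def signOp (e : ZMod 2) : Module.End ℂ (VA A) := ∑ f : ZMod 2, sgn (e * f) • proj A f

/-- The tensor power `T^m(V ⊗ A)`. -/
def T (m : ℕ) := PiTensorProduct ℂ (fun _ : Fin m => VA A)

instance (m : ℕ) : AddCommGroup (T A m) :=
  inferInstanceAs (AddCommGroup (PiTensorProduct ℂ (fun _ : Fin m => VA A)))

instance (m : ℕ) : Module ℂ (T A m) :=
  inferInstanceAs (Module ℂ (PiTensorProduct ℂ (fun _ : Fin m => VA A)))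

variable {A}

/-- The tensor `w_1 ⊗ ⋯ ⊗ w_m`. -/
def tens {m : ℕ} : MultilinearMap ℂ (fun _ : Fin m => VA A) (T A m) :=
  PiTensorProduct.tprod ℂ

variable (A)

/-- The map `w_1 ⊗ ⋯ ⊗ w_m ↦ g_1 w_1 ⊗ ⋯ ⊗ g_m w_m`, as a multilinear map in the `g_i`. -/
def tmap (m : ℕ) : MultilinearMap ℂ (fun _ : Fin m => Module.End ℂ (VA A)) (Module.End ℂ (T A m)) :=
  PiTensorProduct.mapMultilinear ℂ (fun _ : Fin m => VA A) (fun _ : Fin m => VA A)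

/-- For `f` of parity `e`, the operator
`w_1 ⊗ ⋯ ⊗ w_m ↦ (-1)^{e (|w_1| + ⋯ + |w_{j-1}|)} w_1 ⊗ ⋯ ⊗ f w_j ⊗ ⋯ ⊗ w_m`. -/
def slot (m : ℕ) (j : Fin m) (e : ZMod 2) :
    Module.End ℂ (VA A) →ₗ[ℂ] Module.End ℂ (T A m) :=
  (tmap A m).toLinearMap (fun i => if i < j then signOp A e else 1) j

/-- The action of `sl(2,1) ⊗ A` on `T^m(V ⊗ A)`: for `z` of parity `e` and homogeneous `w_i`,
`z (w_1 ⊗ ⋯ ⊗ w_m) = ∑ j, (-1)^{e (|w_1| + ⋯ + |w_{j-1}|)} w_1 ⊗ ⋯ ⊗ z w_j ⊗ ⋯ ⊗ w_m`. -/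
def tensAct (m : ℕ) : MapAlg A →ₗ[ℂ] Module.End ℂ (T A m) :=
  ∑ j : Fin m, ∑ e : ZMod 2, slot A m j e ∘ₗ natAct A ∘ₗ gpart A e

/-- The sign `γ(w, σ) = ∏ (-1)^{|w_{σ(j)}| |w_{σ(k)}|}`, over the inversions `j < k`,
`σ(j) > σ(k)` of `σ`, for `w = (w_1, …, w_m)` with `w_i` of parity `ε i`. -/
def gam {m : ℕ} (ε : Fin m → ZMod 2) (σ : Equiv.Perm (Fin m)) : ℂ :=
  ∏ p : Fin m × Fin m, if p.1 < p.2 ∧ σ p.2 < σ p.1 then sgn (ε (σ p.1) * ε (σ p.2)) else 1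

/-- The map `w_1 ⊗ ⋯ ⊗ w_m ↦ w_{σ(1)} ⊗ ⋯ ⊗ w_{σ(m)}`, without signs. -/
def permute {m : ℕ} (σ : Equiv.Perm (Fin m)) : Module.End ℂ (T A m) :=
  (PiTensorProduct.reindex ℂ (fun _ : Fin m => VA A) σ.symm).toLinearMap

/-- The action of `σ⁻¹` on `T^m(V ⊗ A)`:
`σ⁻¹ (w_1 ⊗ ⋯ ⊗ w_m) = γ(w, σ) w_{σ(1)} ⊗ ⋯ ⊗ w_{σ(m)}` for homogeneous `w_i`. -/
def permInv {m : ℕ} (σ : Equiv.Perm (Fin m)) : Module.End ℂ (T A m) :=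
  ∑ ε : Fin m → ZMod 2, gam ε σ • (permute A σ * tmap A m fun i => proj A (ε i))

/-- The space of supersymmetric tensors. -/
def TSspan (m : ℕ) : Submodule ℂ (T A m) :=
  Submodule.span ℂ
    (Set.range fun w : Fin m → VA A => ∑ σ : Equiv.Perm (Fin m), permInv A σ (tens w))

/-! ### Compatibility facts -/

theorem matPart_matPart (e f : ZMod 2) (X : Mat) :
    matPart e (matPart f X) = if e = f then matPart f X else 0 := by
  ext i j
  split_ifs with h
  · subst h; simp only [matPart_apply]; split_ifs <;> rfl
  · simp only [matPart_apply, Matrix.zero_apply]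
    split_ifs with h1 h2
    · exact absurd (h1.symm.trans h2) h
    · rfl
    · rfl

theorem part_part (e f : ZMod 2) (X : sl21) :
    part e (part f X) = if e = f then part f X else 0 := by
  ext1
  have := matPart_matPart e f X
  split_ifs with h
  · rw [if_pos h] at this; exact this
  · rw [if_neg h] at this; exact this

theorem gpart_of_mem {e : ZMod 2} {x : MapAlg A} (hx : x ∈ gr A e) (f : ZMod 2) :
    gpart A f x = if f = e then x else 0 := by
  obtain ⟨x, rfl⟩ := hx
  induction x using TensorProduct.induction_on with
  | zero => simp
  | add x y hx hy => simp only [map_add, hx, hy]; split_ifs <;> simp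
  | tmul X a =>
    simp only [gpart, LinearMap.rTensor_tmul, part_part]
    split_ifs <;> simp

theorem gr_induction {e : ZMod 2} {P : MapAlg A → Prop} {x : MapAlg A} (hx : x ∈ gr A e)
    (h0 : P 0) (hadd : ∀ x y, P x → P y → P (x + y)) (ht : ∀ X a, P (part e X ⊗ₜ a)) : P x := by
  obtain ⟨x, rfl⟩ := hx
  induction x using TensorProduct.induction_on with
  | zero => simpa using h0
  | add x y hx hy => rw [map_add]; exact hadd _ _ hx hy
  | tmul X a => exact ht X a

theorem matBracket_part (e f : ZMod 2) (X Y : Mat) :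
    matBracket (matPart e X) (matPart f Y) =
      matPart e X * matPart f Y - sgn (e * f) • (matPart f Y * matPart e X) := by
  rw [matBracket_apply, Finset.sum_eq_single e, Finset.sum_eq_single f]
  · simp [matPart_matPart]
  · intro b _ hb; simp [matPart_matPart, hb]
  · simp
  · intro b _ hb; simp [matPart_matPart, hb]
  · simp

theorem matPart_mul (e f : ZMod 2) (X Y : Mat) :
    matPart (e + f) (matPart e X * matPart f Y) = matPart e X * matPart f Y := by
  have key : ∀ p q r e f : ZMod 2, p + r = e → r + q = f → p + q = e + f := by decide
  ext i j
  rw [matPart_apply]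
  split_ifs with h
  · rfl
  · symm
    rw [Matrix.mul_apply]
    refine Finset.sum_eq_zero fun k _ => ?_
    simp only [matPart_apply]
    split_ifs with h1 h2
    · exact absurd (key _ _ _ _ _ h1 h2) h
    all_goals simp

theorem part_bracket (e f : ZMod 2) (X Y : sl21) :
    part (e + f) (bracket (part e X) (part f Y)) = bracket (part e X) (part f Y) := by
  ext1
  change matPart (e + f) (matBracket (matPart e X) (matPart f Y)) =
    matBracket (matPart e X) (matPart f Y)
  rw [matBracket_part, map_sub, map_smul, matPart_mul, add_comm e f, matPart_mul]

theorem mapBracket_mem {e f : ZMod 2} {x y : MapAlg A} (hx : x ∈ gr A e) (hy : y ∈ gr A f) :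
    mapBracket A x y ∈ gr A (e + f) := by
  refine gr_induction A (P := fun x => mapBracket A x y ∈ gr A (e + f)) hx (by simp) (fun x x' h h' => ?_) fun X a => ?_
  · rw [map_add, LinearMap.add_apply]; exact add_mem h h'
  refine gr_induction A (P := fun y => mapBracket A (part e X ⊗ₜ a) y ∈ gr A (e + f)) hy (by simp) (fun x x' h h' => ?_) fun Y b => ?_
  · rw [map_add]; exact add_mem h h'
  refine ⟨bracket (part e X) (part f Y) ⊗ₜ (a * b), ?_⟩
  simp [gpart, mapBracket, part_bracket]

theorem natAct_tmul (X : sl21) (a : A) (v : Fin 3 → ℂ) (b : A) :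
    natAct A (X ⊗ₜ a) (v ⊗ₜ b) = ((X : Mat).mulVec v) ⊗ₜ (a * b) := rfl

theorem natAct_bracket {e f : ZMod 2} {x y : MapAlg A} (hx : x ∈ gr A e) (hy : y ∈ gr A f) :
    natAct A x * natAct A y =
      sgn (e * f) • (natAct A y * natAct A x) + natAct A (mapBracket A x y) := by
  refine gr_induction A (P := fun x => natAct A x * natAct A y =
      sgn (e * f) • (natAct A y * natAct A x) + natAct A (mapBracket A x y)) hx (by simp)
    (fun x x' h h' => ?_) fun X a => ?_
  · simp only [map_add, LinearMap.add_apply, h, h', add_mul, mul_add, smul_add]; abel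
  refine gr_induction A (P := fun y => natAct A (part e X ⊗ₜ a) * natAct A y =
      sgn (e * f) • (natAct A y * natAct A (part e X ⊗ₜ a)) +
        natAct A (mapBracket A (part e X ⊗ₜ a) y)) hy (by simp)
    (fun x x' h h' => ?_) fun Y b => ?_
  · simp only [map_add, h, h', add_mul, mul_add, smul_add]; abel
  refine TensorProduct.ext' fun v c => ?_
  have h : mapBracket A (part e X ⊗ₜ a) (part f Y ⊗ₜ b) =
    bracket (part e X) (part f Y) ⊗ₜ (a * b) := rfl
  rw [h, LinearMap.add_apply, LinearMap.smul_apply, Module.End.mul_apply,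
    Module.End.mul_apply, natAct_tmul, natAct_tmul, natAct_tmul, natAct_tmul, natAct_tmul]
  have h2 : ((bracket (part e X) (part f Y) : sl21) : Mat) = (part e X : Mat) * (part f Y : Mat)
    - sgn (e * f) • ((part f Y : Mat) * (part e X : Mat)) := matBracket_part e f X Y
  rw [h2, Matrix.sub_mulVec, Matrix.smul_mulVec, TensorProduct.sub_tmul, TensorProduct.smul_tmul',
    Matrix.mulVec_mulVec, Matrix.mulVec_mulVec, mul_assoc, mul_left_comm a b c, add_sub_cancel]

theorem vpart_apply (e : ZMod 2) (v : Fin 3 → ℂ) (i : Fin 3) :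
    vpart e v i = if par i = e then v i else 0 := by
  simp only [vpart, LinearMap.pi_apply]; split_ifs <;> simp

theorem proj_tmul (e : ZMod 2) (v : Fin 3 → ℂ) (b : A) :
    proj A e (v ⊗ₜ b) = vpart e v ⊗ₜ b := rfl

theorem proj_mul_proj (e f : ZMod 2) : proj A e * proj A f = if e = f then proj A f else 0 := by
  refine TensorProduct.ext' fun v b => ?_
  have : vpart e (vpart f v) = if e = f then vpart f v else 0 := by
    ext i
    split_ifs with h
    · subst h; simp only [vpart_apply]; split_ifs <;> rfl
    · simp only [vpart_apply, Pi.zero_apply]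
      split_ifs with h1 h2
      · exact absurd (h1.symm.trans h2) h
      all_goals rfl
  rw [Module.End.mul_apply, proj_tmul, proj_tmul, this]
  split_ifs <;> simp [proj_tmul]

theorem sum_proj : ∑ e : ZMod 2, proj A e = 1 := by
  refine TensorProduct.ext' fun v b => ?_
  simp only [LinearMap.sum_apply, proj_tmul, Module.End.one_apply]
  rw [← TensorProduct.sum_tmul]
  congr 1
  ext i
  simp [Finset.sum_apply, vpart_apply]

theorem natAct_mul_proj {e : ZMod 2} {x : MapAlg A} (hx : x ∈ gr A e) (f : ZMod 2) :
    natAct A x * proj A f = proj A (e + f) * natAct A x := by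
  refine gr_induction A (P := fun x => natAct A x * proj A f = proj A (e + f) * natAct A x) hx (by simp) (fun x x' h h' => ?_) fun X a => ?_
  · simp only [map_add, add_mul, mul_add, h, h']
  refine TensorProduct.ext' fun v b => ?_
  rw [Module.End.mul_apply, Module.End.mul_apply, proj_tmul, natAct_tmul, natAct_tmul, proj_tmul]
  congr 1
  ext i
  rw [vpart_apply]
  change (∑ j, matPart e X i j * vpart f v j) = if _ then ∑ j, matPart e X i j * v j else 0
  have key : ∀ p q e f : ZMod 2, p + q = e → (q = f ↔ p = e + f) := by decide
  split_ifs with h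
  · refine Finset.sum_congr rfl fun j _ => ?_
    rw [vpart_apply, matPart_apply]
    split_ifs with h1 h2
    · rfl
    · exact absurd ((key _ _ _ _ h1).2 h) h2
    all_goals simp
  · refine Finset.sum_eq_zero fun j _ => ?_
    rw [vpart_apply, matPart_apply]
    split_ifs with h1 h2
    · exact absurd ((key _ _ _ _ h1).1 h2) h
    all_goals simp

theorem signOp_zero : signOp A 0 = 1 := by
  rw [← sum_proj A]
  simp [signOp, sgn_zero]

theorem signOp_mul_proj (e f : ZMod 2) : signOp A e * proj A f = sgn (e * f) • proj A f := by
  rw [signOp, Finset.sum_mul, Finset.sum_eq_single f]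
  · rw [smul_mul_assoc, proj_mul_proj, if_pos rfl]
  · intro b _ hb
    rw [smul_mul_assoc, proj_mul_proj, if_neg hb, smul_zero]
  · simp

theorem end_ext_proj {g g' : Module.End ℂ (VA A)} (h : ∀ f, g * proj A f = g' * proj A f) :
    g = g' := by
  rw [← mul_one g, ← mul_one g', ← sum_proj A, Finset.mul_sum, Finset.mul_sum]
  exact Finset.sum_congr rfl fun f _ => h f

theorem signOp_mul_signOp (e f : ZMod 2) : signOp A e * signOp A f = signOp A (e + f) := by
  refine end_ext_proj A fun g => ?_
  rw [mul_assoc, signOp_mul_proj, signOp_mul_proj, mul_smul_comm, signOp_mul_proj, smul_smul,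
    add_mul, sgn_add, mul_comm]

/-- `g` is an operator of parity `e` on `V ⊗ A`. -/
def HasPar (e : ZMod 2) (g : Module.End ℂ (VA A)) : Prop :=
  ∀ f, g * proj A f = proj A (e + f) * g

theorem HasPar.mul_signOp {e : ZMod 2} {g : Module.End ℂ (VA A)} (hg : HasPar A e g) (f : ZMod 2) :
    g * signOp A f = sgn (e * f) • (signOp A f * g) := by
  refine end_ext_proj A fun k => ?_
  rw [mul_assoc, signOp_mul_proj, mul_smul_comm, smul_mul_assoc, mul_assoc, hg k, ← mul_assoc,
    signOp_mul_proj, smul_mul_assoc, smul_smul]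
  congr 1
  rw [mul_add, sgn_add, ← mul_assoc, mul_comm f e, sgn_mul_self, one_mul]

/-- The family of operators in the definition of `slot`. -/
def slotFun (m : ℕ) (j : Fin m) (e : ZMod 2) (g : Module.End ℂ (VA A)) :
    Fin m → Module.End ℂ (VA A) :=
  Function.update (fun i => if i < j then signOp A e else 1) j g

theorem slot_eq (m : ℕ) (j : Fin m) (e : ZMod 2) (g : Module.End ℂ (VA A)) :
    slot A m j e g = tmap A m (slotFun A m j e g) := rfl

theorem tmap_mul (m : ℕ) (g g' : Fin m → Module.End ℂ (VA A)) :
    tmap A m g * tmap A m g' = tmap A m (g * g') :=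
  (PiTensorProduct.map_mul g g').symm

theorem slot_mul_same (m : ℕ) (j : Fin m) (e f : ZMod 2) (g g' : Module.End ℂ (VA A)) :
    slot A m j e g * slot A m j f g' = slot A m j (e + f) (g * g') := by
  rw [slot_eq, slot_eq, slot_eq, tmap_mul]
  congr 1
  funext i
  rw [Pi.mul_apply]
  unfold slotFun
  by_cases hi : i = j
  · subst hi; simp
  · simp only [Function.update_of_ne hi]
    split_ifs
    · exact signOp_mul_signOp A e f
    · exact one_mul _

theorem slot_mul_lt (m : ℕ) {j k : Fin m} (hjk : j < k) {e f : ZMod 2}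
    {g : Module.End ℂ (VA A)} (hg : HasPar A e g) (g' : Module.End ℂ (VA A)) :
    slot A m j e g * slot A m k f g' = sgn (e * f) • (slot A m k f g' * slot A m j e g) := by
  rw [slot_eq, slot_eq, tmap_mul, tmap_mul]
  have h1 : slotFun A m k f g' * slotFun A m j e g =
      Function.update (slotFun A m k f g' * slotFun A m j e g) j (signOp A f * g) := by
    symm
    rw [Function.update_eq_self_iff, Pi.mul_apply]
    unfold slotFun
    rw [Function.update_of_ne hjk.ne, Function.update_self, if_pos hjk]
  rw [h1, ← MultilinearMap.map_update_smul, ← hg.mul_signOp]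
  congr 1
  funext i
  by_cases hi : i = j
  · subst hi
    rw [Function.update_self, Pi.mul_apply]
    unfold slotFun
    rw [Function.update_self, Function.update_of_ne hjk.ne, if_pos hjk]
  · rw [Function.update_of_ne hi, Pi.mul_apply, Pi.mul_apply]
    unfold slotFun
    rw [Function.update_of_ne hi]
    by_cases hk : i = k
    · subst hk
      rw [Function.update_self, if_neg hjk.not_gt, one_mul, mul_one]
    · rw [Function.update_of_ne hk]
      split_ifs
      · rw [signOp_mul_signOp, signOp_mul_signOp, add_comm]
      all_goals simp

theorem slot_mul_ne (m : ℕ) {j k : Fin m} (hjk : j ≠ k) {e f : ZMod 2}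
    {g g' : Module.End ℂ (VA A)} (hg : HasPar A e g) (hg' : HasPar A f g') :
    slot A m j e g * slot A m k f g' = sgn (e * f) • (slot A m k f g' * slot A m j e g) := by
  rcases lt_or_gt_of_ne hjk with h | h
  · exact slot_mul_lt A m h hg g'
  · rw [slot_mul_lt A m h hg' g, smul_smul, mul_comm f e, sgn_mul_self, one_smul]

theorem natAct_hasPar {e : ZMod 2} {x : MapAlg A} (hx : x ∈ gr A e) : HasPar A e (natAct A x) :=
  natAct_mul_proj A hx

theorem tensAct_of_mem (m : ℕ) {e : ZMod 2} {x : MapAlg A} (hx : x ∈ gr A e) :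
    tensAct A m x = ∑ j : Fin m, slot A m j e (natAct A x) := by
  rw [tensAct, LinearMap.sum_apply]
  refine Finset.sum_congr rfl fun j _ => ?_
  rw [LinearMap.sum_apply, Finset.sum_eq_single e]
  · rw [LinearMap.comp_apply, LinearMap.comp_apply, gpart_of_mem A hx, if_pos rfl]
  · intro f _ hf
    rw [LinearMap.comp_apply, LinearMap.comp_apply, gpart_of_mem A hx, if_neg hf, map_zero,
      map_zero]
  · simp

/-- `T^m(V ⊗ A)` is a representation of the Lie superalgebra `sl(2,1) ⊗ A`. -/
theorem tensAct_bracket (m : ℕ) {e f : ZMod 2} {x y : MapAlg A} (hx : x ∈ gr A e)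
    (hy : y ∈ gr A f) :
    tensAct A m x * tensAct A m y =
      sgn (e * f) • (tensAct A m y * tensAct A m x) + tensAct A m (mapBracket A x y) := by
  rw [tensAct_of_mem A m hx, tensAct_of_mem A m hy, tensAct_of_mem A m (mapBracket_mem A hx hy),
    Finset.sum_mul_sum, Finset.sum_mul_sum, Finset.sum_comm (s := Finset.univ) (t := Finset.univ)
      (f := fun j k => slot A m j f (natAct A y) * slot A m k e (natAct A x)),
    Finset.smul_sum, ← Finset.sum_add_distrib]
  refine Finset.sum_congr rfl fun j _ => ?_
  rw [Finset.smul_sum, ← sub_eq_iff_eq_add', ← Finset.sum_sub_distrib,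
    Finset.sum_eq_single j]
  · rw [slot_mul_same, slot_mul_same, natAct_bracket A hx hy, map_add, map_smul, add_comm f e,
      add_sub_cancel_left]
  · intro k _ hk
    rw [slot_mul_ne A m hk.symm (natAct_hasPar A hx) (natAct_hasPar A hy), sub_self]
  · simp

/-- The action of `U(sl(2,1) ⊗ A)` on `T^m(V ⊗ A)`. -/
def rep (m : ℕ) : U A →ₐ[ℂ] Module.End ℂ (T A m) :=
  RingQuot.liftAlgHom ℂ ⟨TensorAlgebra.lift ℂ (tensAct A m), by
    rintro _ _ ⟨e, f, x, y, hx, hy⟩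
    simp only [map_mul, map_add, map_smul, TensorAlgebra.lift_ι_apply]
    exact tensAct_bracket A m hx hy⟩

theorem rep_iota (m : ℕ) (x : MapAlg A) : rep A m (iota A x) = tensAct A m x := by
  simp [rep, iota]

instance instModuleT (m : ℕ) : Module (U A) (T A m) :=
  Module.compHom (T A m) (rep A m).toRingHom

theorem smul_def (m : ℕ) (u : U A) (t : T A m) : u • t = rep A m u t := rfl

/-! ### The supersymmetric tensors are a submodule -/

theorem tmap_tens (m : ℕ) (g : Fin m → Module.End ℂ (VA A)) (w : Fin m → VA A) :
    tmap A m g (tens w) = tens fun i => g i (w i) :=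
  PiTensorProduct.map_tprod g w

/-- `w_i` is homogeneous of parity `ε i`, for all `i`. -/
def Homog {m : ℕ} (ε : Fin m → ZMod 2) (w : Fin m → VA A) : Prop :=
  ∀ i, proj A (ε i) (w i) = w i

theorem ext_homog {m : ℕ} {g g' : Module.End ℂ (T A m)}
    (h : ∀ ε w, Homog A ε w → g (tens w) = g' (tens w)) : g = g' := by
  refine PiTensorProduct.ext (MultilinearMap.ext fun w => ?_)
  have hw : w = fun i => ∑ e : ZMod 2, proj A e (w i) := by
    funext i
    rw [← LinearMap.sum_apply, sum_proj]; rfl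
  change g (tens w) = g' (tens w)
  rw [hw, MultilinearMap.map_sum, map_sum, map_sum]
  refine Finset.sum_congr rfl fun ε _ => h ε _ fun i => ?_
  rw [← Module.End.mul_apply, proj_mul_proj, if_pos rfl]

theorem permute_tens {m : ℕ} (σ : Equiv.Perm (Fin m)) (w : Fin m → VA A) :
    permute A σ (tens w) = tens fun i => w (σ i) :=
  PiTensorProduct.reindex_tprod _ _

theorem permInv_tens {m : ℕ} (σ : Equiv.Perm (Fin m)) {ε : Fin m → ZMod 2} {w : Fin m → VA A}
    (hw : Homog A ε w) :
    permInv A σ (tens w) = gam ε σ • tens fun i => w (σ i) := by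
  rw [permInv, LinearMap.sum_apply, Finset.sum_eq_single ε]
  · rw [LinearMap.smul_apply, Module.End.mul_apply, tmap_tens,
      show (fun i => proj A (ε i) (w i)) = w from funext hw, permute_tens]
  · intro ε' _ hε
    obtain ⟨i, hi⟩ := Function.ne_iff.1 hε
    rw [LinearMap.smul_apply, Module.End.mul_apply, tmap_tens,
      MultilinearMap.map_coord_zero _ i, map_zero, smul_zero]
    rw [← hw i, ← Module.End.mul_apply, proj_mul_proj, if_neg hi, LinearMap.zero_apply]
  · simp

theorem signOp_apply {e f : ZMod 2} {v : VA A} (hv : proj A f v = v) :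
    signOp A e v = sgn (e * f) • v := by
  rw [← hv, ← Module.End.mul_apply, signOp_mul_proj, LinearMap.smul_apply]

theorem slot_tens {m : ℕ} (j : Fin m) (e : ZMod 2) (g : Module.End ℂ (VA A))
    {ε : Fin m → ZMod 2} {w : Fin m → VA A} (hw : Homog A ε w) :
    slot A m j e g (tens w) =
      (∏ i, if i < j then sgn (e * ε i) else 1) • tens (Function.update w j (g (w j))) := by
  rw [slot_eq, tmap_tens, ← MultilinearMap.map_smul_univ]
  congr 1
  funext i
  unfold slotFun
  by_cases hi : i = j
  · subst hi; simp
  · rw [Function.update_of_ne hi, Function.update_of_ne hi]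
    split_ifs
    · exact signOp_apply A (hw i)
    · simp

theorem Homog.update {m : ℕ} {j : Fin m} {e : ZMod 2} {g : Module.End ℂ (VA A)}
    (hg : HasPar A e g) {ε : Fin m → ZMod 2} {w : Fin m → VA A} (hw : Homog A ε w) :
    Homog A (Function.update ε j (e + ε j)) (Function.update w j (g (w j))) := by
  intro i
  by_cases hi : i = j
  · subst hi
    rw [Function.update_self, Function.update_self, ← Module.End.mul_apply, ← hg,
      Module.End.mul_apply, hw]
  · rw [Function.update_of_ne hi, Function.update_of_ne hi, hw]

theorem Homog.comp {m : ℕ} (σ : Equiv.Perm (Fin m)) {ε : Fin m → ZMod 2} {w : Fin m → VA A}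
    (hw : Homog A ε w) : Homog A (fun i => ε (σ i)) (fun i => w (σ i)) := fun i => hw (σ i)

theorem gam_update {m : ℕ} (σ : Equiv.Perm (Fin m)) (ε : Fin m → ZMod 2) (k : Fin m) (e : ZMod 2) :
    (∏ i, if i < σ k then sgn (e * ε i) else 1) * gam (Function.update ε (σ k) (e + ε (σ k))) σ =
      gam ε σ * ∏ i, if i < k then sgn (e * ε (σ i)) else 1 := by
  have h1 : gam (Function.update ε (σ k) (e + ε (σ k))) σ = gam ε σ *
      ((∏ b, if k < b ∧ σ b < σ k then sgn (e * ε (σ b)) else 1) *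
        ∏ a, if a < k ∧ σ k < σ a then sgn (e * ε (σ a)) else 1) := by
    have h2 : (∏ b, if k < b ∧ σ b < σ k then sgn (e * ε (σ b)) else 1) =
        ∏ p : Fin m × Fin m, if p.1 = k then
          (if k < p.2 ∧ σ p.2 < σ k then sgn (e * ε (σ p.2)) else 1) else 1 := by
      symm
      rw [Fintype.prod_prod_type, Finset.prod_eq_single k]
      · simp
      · intro a _ ha; simp [ha]
      · simp
    have h3 : (∏ a, if a < k ∧ σ k < σ a then sgn (e * ε (σ a)) else 1) =
        ∏ p : Fin m × Fin m, if p.2 = k then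
          (if p.1 < k ∧ σ k < σ p.1 then sgn (e * ε (σ p.1)) else 1) else 1 := by
      symm
      rw [Fintype.prod_prod_type_right, Finset.prod_eq_single k]
      · simp
      · intro a _ ha; simp [ha]
      · simp
    rw [h2, h3, gam, gam, ← Finset.prod_mul_distrib, ← Finset.prod_mul_distrib]
    refine Finset.prod_congr rfl fun p _ => ?_
    obtain ⟨a, b⟩ := p
    dsimp only
    by_cases hinv : a < b ∧ σ b < σ a
    · rw [if_pos hinv, if_pos hinv]
      by_cases ha : a = k
      · subst ha
        have hb : b ≠ a := hinv.1.ne'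
        rw [if_pos rfl, if_pos hinv, if_neg hb, Function.update_self,
          Function.update_of_ne (σ.injective.ne hb), add_mul, sgn_add]
        ring
      · by_cases hb : b = k
        · subst hb
          rw [if_neg ha, if_pos rfl, if_pos hinv, Function.update_self,
            Function.update_of_ne (σ.injective.ne ha), mul_add, sgn_add, mul_comm _ e]
          ring
        · rw [if_neg ha, if_neg hb, Function.update_of_ne (σ.injective.ne ha),
            Function.update_of_ne (σ.injective.ne hb)]
          ring
    · rw [if_neg hinv, if_neg hinv]
      by_cases ha : a = k
      · subst ha
        rw [if_pos rfl, if_neg hinv]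
        by_cases hb : b = a
        · subst hb; simp
        · simp [hb]
      · by_cases hb : b = k
        · subst hb
          rw [if_neg ha, if_pos rfl, if_neg hinv]; simp
        · simp [ha, hb]
  rw [h1, mul_left_comm, ← Equiv.prod_comp σ, ← Finset.prod_mul_distrib, ← Finset.prod_mul_distrib]
  congr 1
  refine Finset.prod_congr rfl fun i _ => ?_
  rcases lt_trichotomy i k with h | h | h
  · rcases lt_or_gt_of_ne (σ.injective.ne h.ne) with h' | h'
    · simp [h, h', h.not_gt, h'.not_gt]
    · simp [h, h', h.not_gt, h'.not_gt]
  · subst h; simp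
  · rcases lt_or_gt_of_ne (σ.injective.ne h.ne) with h' | h'
    · simp [h, h', h.not_gt, h'.not_gt]
    · simp [h, h', h.not_gt, h'.not_gt, sgn_mul_self]

theorem permInv_slot {m : ℕ} (σ : Equiv.Perm (Fin m)) (k : Fin m) {e : ZMod 2}
    {g : Module.End ℂ (VA A)} (hg : HasPar A e g) {ε : Fin m → ZMod 2} {w : Fin m → VA A}
    (hw : Homog A ε w) :
    permInv A σ (slot A m (σ k) e g (tens w)) = slot A m k e g (permInv A σ (tens w)) := by
  rw [slot_tens A _ _ _ hw, map_smul, permInv_tens A σ (Homog.update A hg hw), permInv_tens A σ hw,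
    map_smul, slot_tens A _ _ _ (Homog.comp A σ hw), smul_smul, smul_smul, gam_update]
  congr 2
  funext i
  by_cases hi : i = k
  · subst hi; simp
  · rw [Function.update_of_ne hi, Function.update_of_ne (σ.injective.ne hi)]

theorem permInv_tensAct {m : ℕ} (σ : Equiv.Perm (Fin m)) (x : MapAlg A) :
    permInv A σ * tensAct A m x = tensAct A m x * permInv A σ := by
  refine ext_homog A fun ε w hw => ?_
  rw [Module.End.mul_apply, Module.End.mul_apply]
  simp only [tensAct, LinearMap.sum_apply, map_sum, LinearMap.comp_apply]
  rw [← Equiv.sum_comp σ]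
  exact Finset.sum_congr rfl fun k _ => Finset.sum_congr rfl fun e _ =>
    permInv_slot A σ k (natAct_hasPar A ⟨x, rfl⟩) hw

theorem permInv_rep {m : ℕ} (σ : Equiv.Perm (Fin m)) (u : U A) :
    permInv A σ * rep A m u = rep A m u * permInv A σ := by
  obtain ⟨t, rfl⟩ := RingQuot.mkAlgHom_surjective ℂ (URel A) u
  induction t using TensorAlgebra.induction with
  | algebraMap r => simp only [AlgHom.commutes]; exact (Algebra.commutes r _).symm
  | ι x =>
    change permInv A σ * rep A m (iota A x) = rep A m (iota A x) * permInv A σ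
    rw [rep_iota]; exact permInv_tensAct A σ x
  | mul a b ha hb => rw [map_mul, map_mul, ← mul_assoc, ha, mul_assoc, hb, mul_assoc]
  | add a b ha hb => rw [map_add, map_add, mul_add, add_mul, ha, hb]

/-- The value on `t` of the supersymmetrizer `∑ σ, σ⁻¹`. -/
theorem sym_mem (m : ℕ) (t : T A m) :
    ∑ σ : Equiv.Perm (Fin m), permInv A σ t ∈ TSspan A m := by
  have ht : t ∈ Submodule.span ℂ (Set.range (tens : (Fin m → VA A) → T A m)) := by
    have h : Submodule.span ℂ (Set.range (tens : (Fin m → VA A) → T A m)) = ⊤ :=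
      PiTensorProduct.span_tprod_eq_top
    rw [h]; exact Submodule.mem_top
  induction ht using Submodule.span_induction with
  | mem x hx =>
    obtain ⟨w, rfl⟩ := hx
    exact Submodule.subset_span ⟨w, rfl⟩
  | zero => simp
  | add x y _ _ hx hy => simp only [map_add, Finset.sum_add_distrib]; exact add_mem hx hy
  | smul c x _ hx => simp only [map_smul, ← Finset.smul_sum]; exact Submodule.smul_mem _ c hx

/-- The supersymmetric tensors `TS^m(V ⊗ A)`, as a `U(sl(2,1) ⊗ A)`-submodule of
`T^m(V ⊗ A)`. -/
def TS (m : ℕ) : Submodule (U A) (T A m) where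
  carrier := TSspan A m
  add_mem' := (TSspan A m).add_mem
  zero_mem' := (TSspan A m).zero_mem
  smul_mem' u x hx := by
    change rep A m u x ∈ TSspan A m
    induction hx using Submodule.span_induction with
    | mem x hx =>
      obtain ⟨w, rfl⟩ := hx
      simp only [map_sum, ← Module.End.mul_apply, ← permInv_rep]
      simp only [Module.End.mul_apply]
      exact sym_mem A m _
    | zero => simp
    | add x y _ _ hx hy => rw [map_add]; exact add_mem hx hy
    | smul c x _ hx => rw [map_smul]; exact Submodule.smul_mem _ c hx

/-- The vector `v_1 ⊗ 1 ∈ V ⊗ A`. -/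
def v1 : VA A := Pi.single 0 1 ⊗ₜ 1

theorem v1_pow_mem (m : ℕ) : tens (fun _ : Fin m => v1 A) ∈ TS A m := by
  have hw : Homog A (fun _ : Fin m => 0) (fun _ : Fin m => v1 A) := by
    intro i
    rw [v1, proj_tmul]
    congr 1
    ext j
    rw [vpart_apply]
    fin_cases j <;> simp [par]
  have hg : ∀ σ : Equiv.Perm (Fin m), gam (fun _ : Fin m => 0) σ = 1 := fun σ =>
    Finset.prod_eq_one fun p _ => by simp [sgn]
  have h := sym_mem A m (tens fun _ : Fin m => v1 A)
  simp only [permInv_tens A _ hw, hg, one_smul, Finset.sum_const] at h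
  rw [Finset.card_univ, ← Nat.cast_smul_eq_nsmul ℂ] at h
  exact (Submodule.smul_mem_iff (TSspan A m) (Nat.cast_ne_zero.2 Fintype.card_ne_zero)).1 h

/-- The vector `v = v_1 ⊗ ⋯ ⊗ v_1 ∈ TS^m(V ⊗ A)`. -/
def v (m : ℕ) : TS A m := ⟨tens fun _ : Fin m => v1 A, v1_pow_mem A m⟩

/-! ### The elements `p(φ₁, φ₂, ξ)` -/

variable {A}

/-- `π(ψ) = ∏ a ^ ψ(a)`. -/
def piMul (ψ : A →₀ ℕ) : A := ψ.prod fun a n => a ^ n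

open Classical in
/-- The elements `p_1(φ, χ)` of the universal enveloping algebra. Here finitely supported functions
`A →₀ ℕ` are multisets of elements of `A`, with `|χ| = χ.degree`, and `Finsupp.multinomial` is the
multinomial coefficient `|ψ|! / ∏ ψ(a)!`. -/
def p1 (φ χ : A →₀ ℕ) : U A :=
  if φ = 0 then
    if χ = 0 then 1
    else
      -((χ.degree : ℂ)⁻¹ • ∑ ψ : {ψ // ψ ∈ (Finset.Iic χ).erase 0},
        (Finsupp.multinomial ψ.1 : ℂ) • (el h1 (piMul ψ.1) * p1 0 (χ - ψ.1)))
  else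
    -((φ.degree : ℂ)⁻¹ • ∑ d : {d // d ∈ φ.support}, ∑ ψ : {ψ // ψ ∈ Finset.Iic χ},
      (Finsupp.multinomial ψ.1 : ℂ) •
        (el y1 (d.1 * piMul ψ.1) * p1 (φ - Finsupp.single d.1 1) (χ - ψ.1)))
termination_by φ.degree + χ.degree
decreasing_by
  · have h := Finset.mem_erase.1 ψ.2
    have := degree_sub_lt (Finset.mem_Iic.1 h.2) h.1
    simp only [map_zero]; omega
  · have h := degree_sub_le χ ψ.1
    have := degree_sub_lt (Finsupp.single_le_iff.2
      (Nat.one_le_iff_ne_zero.2 (Finsupp.mem_support_iff.1 d.2))) (by simp)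
    omega

/-- `p(φ₁, φ₂, ξ) = p_1(φ₂, φ₁) X_{-3}(ξ)`. -/
def p (φ₁ φ₂ : A →₀ ℕ) {n : ℕ} (ξ : Fin n → A) : U A := p1 φ₂ φ₁ * Y3 ξ

/-- The triples `(φ₁, φ₂, ξ)` of multisets `φ₁`, `φ₂` on `I` and of strictly increasing sequences
`ξ` in `I` of length `n`, with `|φ₁| + |φ₂| + n = m`. -/
structure Index (I : Type*) [LinearOrder I] (m : ℕ) where
  φ₁ : I →₀ ℕ
  φ₂ : I →₀ ℕ
  n : ℕ
  ξ : Fin n → I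
  strictMono : StrictMono ξ
  size : φ₁.degree + φ₂.degree + n = m

/-- The element `p(φ₁, φ₂, ξ) w̄` of `W̄_A(m ω₁)`, for multisets and sequences of elements of the
basis `b` of `A`. -/
def basisVec {I : Type*} [LinearOrder I] (b : Module.Basis I ℂ A) (m : ℕ) (t : Index I m) :
    WeylQuot A m 0 :=
  p (t.φ₁.mapDomain b) (t.φ₂.mapDomain b) (fun k => b (t.ξ k)) • wbar A m 0

end Algebra

end SuperWeyl

end

open scoped TensorProduct
noncomputable section
namespace SuperWeyl

/-! ### Commutation relations in the universal enveloping algebra -/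

/-! Upper bound. Let `w` satisfy the defining relations. The elements x_1, x_2, x_3, x_{-2} kill
`w`, and so does h_2 ⊗ a = [x_2 ⊗ a, x_{-2} ⊗ 1]. Hence U w is spanned by ordered monomials in
x_{-1} ⊗ d, h_1 ⊗ c, x_{-3} ⊗ x applied to `w`. Monomials of length m + 1 reduce to shorter ones:
start from (x_{-1} ⊗ 1)^{m+1} w = 0 and apply x_1 ⊗ c, x_{-2} ⊗ x, h_2 ⊗ d, which up to shorter
terms convert one factor x_{-1} ⊗ 1 into h_1 ⊗ c, x_{-3} ⊗ x, x_{-1} ⊗ d respectively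
(`IsWeylVector.filt_succ`). So length at most m suffices. By triangularity each monomial may be
replaced by the corresponding p(φ₁, φ₂, ξ) w (`p1_smul_mon`). If 1 is a basis vector of A, the
factors h_1 ⊗ 1 act by scalars and can be dropped (`IsWeylVector.filt_le_span`).

Lower bound. The recursion makes the p_1(φ, χ) a divided-power family: on a tensor product they act
by distributing (φ, χ) over the slots (`rep_p1_tens`). On one copy of V ⊗ A nearly all of them
vanish: on v_1 ⊗ 1 only total degree 0 or 1 survives, on v_3 ⊗ a only degree 0. Therefore p(φ₁, φ₂,
ξ) v_1^{⊗m} is supported on exactly the basis tensors whose letters have content (φ₁, φ₂, ξ), with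
no cancellation (`repr_pvec_ne_zero_iff`). Distinct contents have disjoint supports, which gives
independence (`linearIndependent_pvec`).

Two index families are used. Triples of size at most m avoiding the index of 1, for a basis
containing 1, span the Weyl quotient and stay independent in the tensor power, so the map to tensors
is injective (`toT_injective`). Triples of size exactly m, for an arbitrary basis, span the
supersymmetric tensors: the symmetrization of a basis tensor is zero or a nonzero multiple of the
p-vector of the same content (`TSspan_le`). Together these give the isomorphism, and the second
family pulls back to the basis of the statement. -/

theorem coe_x1 : (x1 : Mat) = !![0, 1, 0; 0, 0, 0; 0, 0, 0] := by
  ext i j; fin_cases i <;> fin_cases j <;> simp [x1, unit]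
theorem coe_x2 : (x2 : Mat) = !![0, 0, 0; 0, 0, 1; 0, 0, 0] := by
  ext i j; fin_cases i <;> fin_cases j <;> simp [x2, unit]
theorem coe_x3 : (x3 : Mat) = !![0, 0, 1; 0, 0, 0; 0, 0, 0] := by
  ext i j; fin_cases i <;> fin_cases j <;> simp [x3, unit]
theorem coe_y1 : (y1 : Mat) = !![0, 0, 0; 1, 0, 0; 0, 0, 0] := by
  ext i j; fin_cases i <;> fin_cases j <;> simp [y1, unit]
theorem coe_y2 : (y2 : Mat) = !![0, 0, 0; 0, 0, 0; 0, 1, 0] := by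
  ext i j; fin_cases i <;> fin_cases j <;> simp [y2, unit]
theorem coe_y3 : (y3 : Mat) = !![0, 0, 0; 0, 0, 0; 1, 0, 0] := by
  ext i j; fin_cases i <;> fin_cases j <;> simp [y3, unit]
theorem coe_h1 : (h1 : Mat) = !![1, 0, 0; 0, -1, 0; 0, 0, 0] := by
  ext i j; fin_cases i <;> fin_cases j <;> simp [h1]
theorem coe_h2 : (h2 : Mat) = !![0, 0, 0; 0, 1, 0; 0, 0, 1] := by
  ext i j; fin_cases i <;> fin_cases j <;> simp [h2]

/-- Reduces stability under all operators z ⊗ a to eight generators; the supertrace condition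
supplies the (3,3) entry. -/
theorem sl21_eq (z : sl21) : z = (z : Mat) 0 1 • x1 + (z : Mat) 1 2 • x2 + (z : Mat) 0 2 • x3 +
    (z : Mat) 1 0 • y1 + (z : Mat) 2 1 • y2 + (z : Mat) 2 0 • y3 + (z : Mat) 0 0 • h1 +
    ((z : Mat) 0 0 + (z : Mat) 1 1) • h2 := by
  obtain ⟨X, hX⟩ := z
  rw [mem_sl21] at hX
  ext i j
  fin_cases i <;> fin_cases j <;>
    simp [coe_x1, coe_x2, coe_x3, coe_y1, coe_y2, coe_y3, coe_h1, coe_h2, hX]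

/-- `z` is homogeneous of parity `e`. -/
def IsPar (e : ZMod 2) (z : sl21) : Prop := part e z = z

theorem isPar_of (e : ZMod 2) (z : sl21) (h : matPart e z = z) : IsPar e z := Subtype.ext h

theorem isPar_x1 : IsPar 0 x1 := by
  refine isPar_of _ _ ?_; rw [coe_x1]; ext i j
  fin_cases i <;> fin_cases j <;> simp [matPart_apply, par]
theorem isPar_x2 : IsPar 1 x2 := by
  refine isPar_of _ _ ?_; rw [coe_x2]; ext i j
  fin_cases i <;> fin_cases j <;> simp [matPart_apply, par]
theorem isPar_x3 : IsPar 1 x3 := by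
  refine isPar_of _ _ ?_; rw [coe_x3]; ext i j
  fin_cases i <;> fin_cases j <;> simp [matPart_apply, par]
theorem isPar_y1 : IsPar 0 y1 := by
  refine isPar_of _ _ ?_; rw [coe_y1]; ext i j
  fin_cases i <;> fin_cases j <;> simp [matPart_apply, par]
theorem isPar_y2 : IsPar 1 y2 := by
  refine isPar_of _ _ ?_; rw [coe_y2]; ext i j
  fin_cases i <;> fin_cases j <;> simp [matPart_apply, par]
theorem isPar_y3 : IsPar 1 y3 := by
  refine isPar_of _ _ ?_; rw [coe_y3]; ext i j
  fin_cases i <;> fin_cases j <;> simp [matPart_apply, par]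
theorem isPar_h1 : IsPar 0 h1 := by
  refine isPar_of _ _ ?_; rw [coe_h1]; ext i j
  fin_cases i <;> fin_cases j <;> simp [matPart_apply, par, show (1 : ZMod 2) + 1 = 0 by decide]
theorem isPar_h2 : IsPar 0 h2 := by
  refine isPar_of _ _ ?_; rw [coe_h2]; ext i j
  fin_cases i <;> fin_cases j <;> simp [matPart_apply, par, show (1 : ZMod 2) + 1 = 0 by decide]

section
variable {A : Type*} [CommRing A] [Algebra ℂ A]

theorem IsPar.tmul_mem {e : ZMod 2} {z : sl21} (h : IsPar e z) (a : A) : z ⊗ₜ[ℂ] a ∈ gr A e :=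
  ⟨z ⊗ₜ a, by rw [gpart, LinearMap.rTensor_tmul, h]⟩

@[simp] theorem el_zero_left (a : A) : el (0 : sl21) a = 0 := by simp [el]
@[simp] theorem el_zero_right (z : sl21) : el z (0 : A) = 0 := by simp [el]
theorem el_add_left (z z' : sl21) (a : A) : el (z + z') a = el z a + el z' a := by
  simp [el, TensorProduct.add_tmul]
theorem el_smul_left (c : ℂ) (z : sl21) (a : A) : el (c • z) a = c • el z a := by
  simp [el, ← TensorProduct.smul_tmul']
theorem el_add_right (z : sl21) (a b : A) : el z (a + b) = el z a + el z b := by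
  simp [el, TensorProduct.tmul_add]
theorem el_smul_right (c : ℂ) (z : sl21) (a : A) : el z (c • a) = c • el z a := by
  simp [el]

theorem iota_mul_iota {e f : ZMod 2} {x y : MapAlg A} (hx : x ∈ gr A e) (hy : y ∈ gr A f) :
    iota A x * iota A y = sgn (e * f) • (iota A y * iota A x) + iota A (mapBracket A x y) := by
  have h := RingQuot.mkAlgHom_rel ℂ (URel.comm e f x y hx hy)
  rw [map_mul, map_add, map_smul, map_mul] at h
  exact h

/-- Homogeneity collapses the bilinear super commutator to a single summand, so every commutation
relation below becomes one identity of 3 × 3 matrices, with `r` the value of the bracket. -/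
theorem el_mul_el {e f : ZMod 2} {z z' r : sl21} (hz : IsPar e z) (hz' : IsPar f z')
    (h : (z : Mat) * z' - sgn (e * f) • ((z' : Mat) * z) = r) (a b : A) :
    el z a * el z' b = sgn (e * f) • (el z' b * el z a) + el r (a * b) := by
  have hr : bracket z z' = r := by
    rw [← hz, ← hz']
    refine Subtype.ext ((matBracket_part e f z z').trans ?_)
    have h1 : matPart e (z : Mat) = z := congrArg Subtype.val hz
    have h2 : matPart f (z' : Mat) = z' := congrArg Subtype.val hz'
    rw [h1, h2, h]
  have := iota_mul_iota (hz.tmul_mem a) (hz'.tmul_mem b)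
  rw [el, el, this]
  rw [← hr]
  rfl

theorem sgn_one : sgn 1 = -1 := by simp [sgn]

/-! ### Commutation table of the generators. -/

theorem el_h2_mul_el_y1 (a b : A) : el h2 a * el y1 b = el y1 b * el h2 a + el y1 (a * b) := by
  rw [el_mul_el (r := y1) isPar_h2 isPar_y1 ?_]
  · simp [sgn_zero]
  · ext i j; fin_cases i <;> fin_cases j <;>
      simp [coe_h2, coe_y1, sgn]

theorem el_h2_mul_el_h1 (a b : A) : el h2 a * el h1 b = el h1 b * el h2 a := by
  rw [el_mul_el (r := (0 : sl21)) isPar_h2 isPar_h1 ?_]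
  · simp [sgn_zero]
  · ext i j; fin_cases i <;> fin_cases j <;>
      simp [coe_h2, coe_h1, sgn]; try norm_num

theorem el_h2_mul_el_y3 (a b : A) : el h2 a * el y3 b = el y3 b * el h2 a + el y3 (a * b) := by
  rw [el_mul_el (r := y3) isPar_h2 isPar_y3 ?_]
  · simp [sgn_zero]
  · ext i j; fin_cases i <;> fin_cases j <;>
      simp [coe_h2, coe_y3, sgn]

theorem el_x1_mul_el_y1 (a b : A) : el x1 a * el y1 b = el y1 b * el x1 a + el h1 (a * b) := by
  rw [el_mul_el (r := h1) isPar_x1 isPar_y1 ?_]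
  · simp [sgn_zero]
  · ext i j; fin_cases i <;> fin_cases j <;>
      simp [coe_x1, coe_y1, coe_h1, sgn]

theorem el_x1_mul_el_h1 (a b : A) : el x1 a * el h1 b = el h1 b * el x1 a + (-2 : ℂ) • el x1 (a * b) := by
  rw [el_mul_el (r := (-2 : ℂ) • x1) isPar_x1 isPar_h1 ?_]
  · simp [sgn_zero, el_smul_left]
  · ext i j; fin_cases i <;> fin_cases j <;>
      simp [coe_x1, coe_h1, sgn]; try norm_num

theorem el_x1_mul_el_y3 (a b : A) : el x1 a * el y3 b = el y3 b * el x1 a + (-1 : ℂ) • el y2 (a * b) := by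
  rw [el_mul_el (r := (-1 : ℂ) • y2) isPar_x1 isPar_y3 ?_]
  · simp [sgn_zero, el_smul_left]
  · ext i j; fin_cases i <;> fin_cases j <;>
      simp [coe_x1, coe_y3, coe_y2, sgn]

theorem el_x2_mul_el_y1 (a b : A) : el x2 a * el y1 b = el y1 b * el x2 a := by
  rw [el_mul_el (r := (0 : sl21)) isPar_x2 isPar_y1 ?_]
  · simp [sgn_zero]
  · ext i j; fin_cases i <;> fin_cases j <;>
      simp [coe_x2, coe_y1, sgn]

theorem el_x2_mul_el_h1 (a b : A) : el x2 a * el h1 b = el h1 b * el x2 a + el x2 (a * b) := by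
  rw [el_mul_el (r := x2) isPar_x2 isPar_h1 ?_]
  · simp [sgn_zero]
  · ext i j; fin_cases i <;> fin_cases j <;>
      simp [coe_x2, coe_h1, sgn]; try norm_num

theorem el_x2_mul_el_y3 (a b : A) : el x2 a * el y3 b = (-1 : ℂ) • (el y3 b * el x2 a) + el y1 (a * b) := by
  rw [el_mul_el (r := y1) isPar_x2 isPar_y3 ?_]
  · simp [sgn_one]
  · ext i j; fin_cases i <;> fin_cases j <;>
      simp [coe_x2, coe_y3, coe_y1, sgn]

theorem el_x3_mul_el_y1 (a b : A) : el x3 a * el y1 b = el y1 b * el x3 a + (-1 : ℂ) • el x2 (a * b) := by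
  rw [el_mul_el (r := (-1 : ℂ) • x2) isPar_x3 isPar_y1 ?_]
  · simp [sgn_zero, el_smul_left]
  · ext i j; fin_cases i <;> fin_cases j <;>
      simp [coe_x3, coe_y1, coe_x2, sgn]

theorem el_x3_mul_el_h1 (a b : A) : el x3 a * el h1 b = el h1 b * el x3 a + (-1 : ℂ) • el x3 (a * b) := by
  rw [el_mul_el (r := (-1 : ℂ) • x3) isPar_x3 isPar_h1 ?_]
  · simp [sgn_zero, el_smul_left]
  · ext i j; fin_cases i <;> fin_cases j <;>
      simp [coe_x3, coe_h1, sgn]; try norm_num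

theorem el_x3_mul_el_y3 (a b : A) : el x3 a * el y3 b = (-1 : ℂ) • (el y3 b * el x3 a) + el h1 (a * b) + el h2 (a * b) := by
  rw [el_mul_el (r := h1 + h2) isPar_x3 isPar_y3 ?_]
  · simp [sgn_one, el_add_left, add_assoc]
  · ext i j; fin_cases i <;> fin_cases j <;>
      simp [coe_x3, coe_y3, coe_h1, coe_h2, sgn]

theorem el_y2_mul_el_y1 (a b : A) : el y2 a * el y1 b = el y1 b * el y2 a + el y3 (a * b) := by
  rw [el_mul_el (r := y3) isPar_y2 isPar_y1 ?_]
  · simp [sgn_zero]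
  · ext i j; fin_cases i <;> fin_cases j <;>
      simp [coe_y2, coe_y1, coe_y3, sgn]

theorem el_y2_mul_el_h1 (a b : A) : el y2 a * el h1 b = el h1 b * el y2 a + (-1 : ℂ) • el y2 (a * b) := by
  rw [el_mul_el (r := (-1 : ℂ) • y2) isPar_y2 isPar_h1 ?_]
  · simp [sgn_zero, el_smul_left]
  · ext i j; fin_cases i <;> fin_cases j <;>
      simp [coe_y2, coe_h1, sgn]; try norm_num

theorem el_y2_mul_el_y3 (a b : A) : el y2 a * el y3 b = (-1 : ℂ) • (el y3 b * el y2 a) := by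
  rw [el_mul_el (r := (0 : sl21)) isPar_y2 isPar_y3 ?_]
  · simp [sgn_one]
  · ext i j; fin_cases i <;> fin_cases j <;>
      simp [coe_y2, coe_y3, sgn]

theorem el_h1_mul_el_y1 (a b : A) : el h1 a * el y1 b = el y1 b * el h1 a + (-2 : ℂ) • el y1 (a * b) := by
  rw [el_mul_el (r := (-2 : ℂ) • y1) isPar_h1 isPar_y1 ?_]
  · simp [sgn_zero, el_smul_left]
  · ext i j; fin_cases i <;> fin_cases j <;>
      simp [coe_h1, coe_y1, sgn]; try norm_num

theorem el_h1_mul_el_h1 (a b : A) : el h1 a * el h1 b = el h1 b * el h1 a := by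
  rw [el_mul_el (r := (0 : sl21)) isPar_h1 isPar_h1 ?_]
  · simp [sgn_zero]
  · ext i j; fin_cases i <;> fin_cases j <;>
      simp [coe_h1, sgn]; try norm_num

theorem el_y3_mul_el_y1 (a b : A) : el y3 a * el y1 b = el y1 b * el y3 a := by
  rw [el_mul_el (r := (0 : sl21)) isPar_y3 isPar_y1 ?_]
  · simp [sgn_zero]
  · ext i j; fin_cases i <;> fin_cases j <;>
      simp [coe_y3, coe_y1, sgn]

theorem el_y3_mul_el_h1 (a b : A) : el y3 a * el h1 b = el h1 b * el y3 a + el y3 (a * b) := by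
  rw [el_mul_el (r := y3) isPar_y3 isPar_h1 ?_]
  · simp [sgn_zero]
  · ext i j; fin_cases i <;> fin_cases j <;>
      simp [coe_y3, coe_h1, sgn]; try norm_num

theorem el_y1_mul_el_y1 (a b : A) : el y1 a * el y1 b = el y1 b * el y1 a := by
  rw [el_mul_el (r := (0 : sl21)) isPar_y1 isPar_y1 ?_]
  · simp [sgn_zero]
  · ext i j; fin_cases i <;> fin_cases j <;>
      simp [coe_y1, sgn]

theorem el_y3_mul_el_y3 (a b : A) : el y3 a * el y3 b = (-1 : ℂ) • (el y3 b * el y3 a) := by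
  rw [el_mul_el (r := (0 : sl21)) isPar_y3 isPar_y3 ?_]
  · simp [sgn_one]
  · ext i j; fin_cases i <;> fin_cases j <;>
      simp [coe_y3, sgn]

theorem el_x2_mul_el_y2 (a b : A) : el x2 a * el y2 b = (-1 : ℂ) • (el y2 b * el x2 a) + el h2 (a * b) := by
  rw [el_mul_el (r := h2) isPar_x2 isPar_y2 ?_]
  · simp [sgn_one]
  · ext i j; fin_cases i <;> fin_cases j <;>
      simp [coe_x2, coe_y2, coe_h2, sgn]

end
end SuperWeyl
end

open scoped TensorProduct
noncomputable section
namespace SuperWeyl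

/-! ### Highest weight vectors and ordered monomials -/

section
set_option linter.unusedSectionVars false
variable {A : Type*} [CommRing A] [Algebra ℂ A]
variable {M : Type*} [AddCommGroup M] [Module ℂ M] [Module (U A) M] [IsScalarTower ℂ (U A) M]

/-- The vector `w` satisfies the relations of the generator of `W̄_A(m ω₁)`. -/
structure IsWeylVector (m : ℕ) (w : M) : Prop where
  x1_smul (a : A) : el x1 a • w = 0
  x2_smul (a : A) : el x2 a • w = 0
  x3_smul (a : A) : el x3 a • w = 0
  y2_smul (a : A) : el y2 a • w = 0
  h1_smul : el h1 (1 : A) • w = (m : ℂ) • w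
  y1_pow : el y1 (1 : A) ^ (m + 1) • w = 0

/-- h_2 ⊗ a is the super commutator of x_2 ⊗ a and x_{-2} ⊗ 1, both of which kill `w`. -/
theorem IsWeylVector.h2_smul {m : ℕ} {w : M} (hw : IsWeylVector (A := A) m w) (a : A) :
    el h2 a • w = 0 := by
  have h := congrArg (· • w) (el_x2_mul_el_y2 a (1 : A))
  simpa [mul_smul, add_smul, hw.y2_smul, hw.x2_smul] using h.symm

/-- The ordered monomial `∏ (x_{-1} ⊗ d) ∏ (h_1 ⊗ c) ∏ (x_{-3} ⊗ x)` applied to `w`. -/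
def mon (w : M) (ds cs xs : List A) : M :=
  (ds.map (el y1)).prod • (cs.map (el h1)).prod • (xs.map (el y3)).prod • w

/-- The span of the ordered monomials of length at most `k`. -/
def filt (A : Type*) [CommRing A] [Algebra ℂ A] [Module (U A) M] (w : M) (k : ℕ) :
    Submodule ℂ M :=
  Submodule.span ℂ
    {x | ∃ ds cs xs : List A, ds.length + cs.length + xs.length ≤ k ∧ mon w ds cs xs = x}

variable {w : M}

theorem mon_mem_filt {ds cs xs : List A} {k : ℕ} (h : ds.length + cs.length + xs.length ≤ k) :
    mon w ds cs xs ∈ filt A w k := Submodule.subset_span ⟨ds, cs, xs, h, rfl⟩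

theorem filt_mono {k l : ℕ} (h : k ≤ l) : filt A w k ≤ filt A w l :=
  Submodule.span_mono fun _ ⟨ds, cs, xs, hl, hx⟩ => ⟨ds, cs, xs, hl.trans h, hx⟩

theorem mon_nil : mon w ([] : List A) [] [] = w := by simp [mon]

theorem self_mem_filt (k : ℕ) : w ∈ filt A w k := by
  have h : mon w ([] : List A) [] [] ∈ filt A w k := mon_mem_filt (by simp)
  rwa [mon_nil] at h

theorem y1_smul_mon (a : A) (ds cs xs : List A) :
    el y1 a • mon w ds cs xs = mon w (a :: ds) cs xs := by simp [mon, mul_smul]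

theorem h1_smul_mon (a : A) (cs xs : List A) :
    el h1 a • mon w [] cs xs = mon w [] (a :: cs) xs := by simp [mon, mul_smul]

theorem y3_smul_mon (a : A) (xs : List A) :
    el y3 a • mon w [] [] xs = mon w [] [] (a :: xs) := by simp [mon, mul_smul]

theorem smul_mem_of_mon {u : U A} {k : ℕ} {N : Submodule ℂ M}
    (h : ∀ ds cs xs : List A, ds.length + cs.length + xs.length ≤ k → u • mon w ds cs xs ∈ N)
    {x : M} (hx : x ∈ filt A w k) : u • x ∈ N := by
  induction hx using Submodule.span_induction with
  | mem x hx => obtain ⟨ds, cs, xs, hl, rfl⟩ := hx; exact h _ _ _ hl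
  | zero => simp
  | add x y _ _ hx hy => rw [smul_add]; exact add_mem hx hy
  | smul c x _ hx => rw [smul_comm]; exact Submodule.smul_mem _ _ hx

theorem y1_smul_filt (a : A) {k : ℕ} {x : M} (hx : x ∈ filt A w k) :
    el y1 a • x ∈ filt A w (k + 1) :=
  smul_mem_of_mon (fun ds cs xs h => by
    rw [y1_smul_mon]; exact mon_mem_filt (by simp; omega)) hx

/-- Moving h_1 past x_{-1} ⊗ d costs a multiple of x_{-1} ⊗ ad, which replaces two factors by one
and so does not lengthen the monomial. -/
theorem h1_smul_filt (a : A) {k : ℕ} {x : M} (hx : x ∈ filt A w k) :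
    el h1 a • x ∈ filt A w (k + 1) := by
  refine smul_mem_of_mon (fun ds cs xs => ?_) hx
  clear hx
  induction ds generalizing k with
  | nil => intro h; rw [h1_smul_mon]; exact mon_mem_filt (by simp at *; omega)
  | cons d ds ih =>
    intro h
    obtain ⟨k, rfl⟩ : ∃ l, k = l + 1 := ⟨k - 1, by simp at h; omega⟩
    rw [← y1_smul_mon, ← mul_smul, el_h1_mul_el_y1, add_smul, mul_smul, smul_assoc, y1_smul_mon]
    refine add_mem (y1_smul_filt _ (ih (by simp at h; omega))) (Submodule.smul_mem _ _ ?_)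
    exact mon_mem_filt (by simp at *; omega)

/-- x_{-3} commutes with the x_{-1} factors, and its commutator with h_1 ⊗ c is again a single
x_{-3} factor. -/
theorem y3_smul_filt (a : A) {k : ℕ} {x : M} (hx : x ∈ filt A w k) :
    el y3 a • x ∈ filt A w (k + 1) := by
  refine smul_mem_of_mon (fun ds cs xs => ?_) hx
  clear hx
  induction ds generalizing k with
  | nil =>
    induction cs generalizing k a with
    | nil => intro h; rw [y3_smul_mon]; exact mon_mem_filt (by simp at *; omega)
    | cons c cs ih =>
      intro h
      obtain ⟨k, rfl⟩ : ∃ l, k = l + 1 := ⟨k - 1, by simp at h; omega⟩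
      have hk : ([] : List A).length + cs.length + xs.length ≤ k := by simp at *; omega
      rw [← h1_smul_mon, ← mul_smul, el_y3_mul_el_h1, add_smul, mul_smul]
      exact add_mem (h1_smul_filt _ (ih _ hk)) (filt_mono (by omega) (ih _ hk))
  | cons d ds ih =>
    intro h
    obtain ⟨k, rfl⟩ : ∃ l, k = l + 1 := ⟨k - 1, by simp at h; omega⟩
    rw [← y1_smul_mon, ← mul_smul, el_y3_mul_el_y1, mul_smul]
    exact y1_smul_filt _ (ih (by simp at h; omega))

theorem filt_zero_le {N : Submodule ℂ M} (hw : w ∈ N) : filt A w 0 ≤ N := by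
  refine Submodule.span_le.2 ?_
  rintro _ ⟨ds, cs, xs, h, rfl⟩
  obtain rfl : ds = [] := by rw [← List.length_eq_zero_iff]; omega
  obtain rfl : cs = [] := by rw [← List.length_eq_zero_iff]; omega
  obtain rfl : xs = [] := by rw [← List.length_eq_zero_iff]; omega
  rwa [mon_nil]

/-- Induction principle for the filtration: a nonempty ordered monomial is its leftmost factor
applied to a shorter ordered monomial. -/
theorem filt_succ_le {k : ℕ} {N : Submodule ℂ M} (hw : w ∈ N)
    (hy1 : ∀ a : A, ∀ x ∈ filt A w k, el y1 a • x ∈ N)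
    (hh1 : ∀ a : A, ∀ x ∈ filt A w k, el h1 a • x ∈ N)
    (hy3 : ∀ a : A, ∀ x ∈ filt A w k, el y3 a • x ∈ N) : filt A w (k + 1) ≤ N := by
  refine Submodule.span_le.2 ?_
  rintro _ ⟨ds, cs, xs, h, rfl⟩
  cases ds with
  | cons d ds =>
    rw [← y1_smul_mon]; exact hy1 _ _ (mon_mem_filt (by simp at h; omega))
  | nil =>
  cases cs with
  | cons c cs =>
    rw [← h1_smul_mon]; exact hh1 _ _ (mon_mem_filt (by simp at *; omega))
  | nil =>
  cases xs with
  | cons x xs =>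
    rw [← y3_smul_mon]; exact hy3 _ _ (mon_mem_filt (by simp at *; omega))
  | nil => rwa [mon_nil]

/-- The preimage of a subspace under an element of the enveloping algebra. -/
def preim (u : U A) (N : Submodule ℂ M) : Submodule ℂ M where
  carrier := {x | u • x ∈ N}
  add_mem' hx hy := by
    simp only [Set.mem_ofPred_eq, smul_add] at *; exact add_mem hx hy
  zero_mem' := by simp
  smul_mem' c x hx := by
    simp only [Set.mem_ofPred_eq] at *; rw [smul_comm]; exact N.smul_mem c hx

theorem mem_preim {u : U A} {N : Submodule ℂ M} {x : M} : x ∈ preim u N ↔ u • x ∈ N := Iff.rfl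

/-- The elements `x_1, x_2, x_3, x_{-2}, h_2` preserve the filtration. -/
theorem smul_filt {m : ℕ} (hw : IsWeylVector (A := A) m w) (k : ℕ) {x : M}
    (hx : x ∈ filt A w k) (a : A) :
    el x1 a • x ∈ filt A w k ∧ el x2 a • x ∈ filt A w k ∧ el x3 a • x ∈ filt A w k ∧
      el y2 a • x ∈ filt A w k ∧ el h2 a • x ∈ filt A w k := by
  simp only [← mem_preim]
  induction k generalizing x a with
  | zero =>
    refine ⟨filt_zero_le ?_ hx, filt_zero_le ?_ hx, filt_zero_le ?_ hx, filt_zero_le ?_ hx,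
      filt_zero_le ?_ hx⟩ <;>
      simp [mem_preim, hw.x1_smul, hw.x2_smul, hw.x3_smul, hw.y2_smul, hw.h2_smul]
  | succ k ih =>
    simp only [mem_preim] at ih
    have up : ∀ {x : M}, x ∈ filt A w k → x ∈ filt A w (k + 1) := fun h =>
      filt_mono (Nat.le_succ k) h
    refine ⟨filt_succ_le ?_ ?_ ?_ ?_ hx, filt_succ_le ?_ ?_ ?_ ?_ hx, filt_succ_le ?_ ?_ ?_ ?_ hx,
      filt_succ_le ?_ ?_ ?_ ?_ hx, filt_succ_le ?_ ?_ ?_ ?_ hx⟩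
    any_goals
      simp [mem_preim, hw.x1_smul, hw.x2_smul, hw.x3_smul, hw.y2_smul, hw.h2_smul]; done
    -- Fifteen goals remain: five operators against three possible leftmost factors. Each commutator
    -- is either one of the five operators, handled by induction, or x_{-1}, h_1, x_{-3}, which may
    -- raise the length by one; the commutator of x_3 and x_{-3} contributes both kinds. All five
    -- operators are treated at once because their commutators involve one another.
    all_goals
      intro b x hx
      have h := fun c => ih hx c
      rw [mem_preim, ← mul_smul]
    · rw [el_x1_mul_el_y1, add_smul, mul_smul]
      exact add_mem (y1_smul_filt _ (h a).1) (h1_smul_filt _ hx)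
    · rw [el_x1_mul_el_h1, add_smul, mul_smul, smul_assoc]
      exact add_mem (h1_smul_filt _ (h a).1) (Submodule.smul_mem _ _ (up (h _).1))
    · rw [el_x1_mul_el_y3, add_smul, mul_smul, smul_assoc]
      exact add_mem (y3_smul_filt _ (h a).1) (Submodule.smul_mem _ _ (up (h _).2.2.2.1))
    · rw [el_x2_mul_el_y1, mul_smul]
      exact y1_smul_filt _ (h a).2.1
    · rw [el_x2_mul_el_h1, add_smul, mul_smul]
      exact add_mem (h1_smul_filt _ (h a).2.1) (up (h _).2.1)
    · rw [el_x2_mul_el_y3, add_smul, smul_assoc, mul_smul]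
      exact add_mem (Submodule.smul_mem _ _ (y3_smul_filt _ (h a).2.1)) (y1_smul_filt _ hx)
    · rw [el_x3_mul_el_y1, add_smul, mul_smul, smul_assoc]
      exact add_mem (y1_smul_filt _ (h a).2.2.1) (Submodule.smul_mem _ _ (up (h _).2.1))
    · rw [el_x3_mul_el_h1, add_smul, mul_smul, smul_assoc]
      exact add_mem (h1_smul_filt _ (h a).2.2.1) (Submodule.smul_mem _ _ (up (h _).2.2.1))
    · rw [el_x3_mul_el_y3, add_smul, add_smul, smul_assoc, mul_smul]
      exact add_mem (add_mem (Submodule.smul_mem _ _ (y3_smul_filt _ (h a).2.2.1))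
        (h1_smul_filt _ hx)) (up (h _).2.2.2.2)
    · rw [el_y2_mul_el_y1, add_smul, mul_smul]
      exact add_mem (y1_smul_filt _ (h a).2.2.2.1) (y3_smul_filt _ hx)
    · rw [el_y2_mul_el_h1, add_smul, mul_smul, smul_assoc]
      exact add_mem (h1_smul_filt _ (h a).2.2.2.1) (Submodule.smul_mem _ _ (up (h _).2.2.2.1))
    · rw [el_y2_mul_el_y3, smul_assoc, mul_smul]
      exact Submodule.smul_mem _ _ (y3_smul_filt _ (h a).2.2.2.1)
    · rw [el_h2_mul_el_y1, add_smul, mul_smul]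
      exact add_mem (y1_smul_filt _ (h a).2.2.2.2) (y1_smul_filt _ hx)
    · rw [el_h2_mul_el_h1, mul_smul]
      exact h1_smul_filt _ (h a).2.2.2.2
    · rw [el_h2_mul_el_y3, add_smul, mul_smul]
      exact add_mem (y3_smul_filt _ (h a).2.2.2.2) (y3_smul_filt _ hx)

/-- A subspace stable under the operators `z ⊗ a` is stable under the enveloping algebra. -/
theorem smul_mem_of_stable {N : Submodule ℂ M} (h : ∀ (z : sl21) (a : A), ∀ x ∈ N, el z a • x ∈ N)
    (u : U A) {x : M} (hx : x ∈ N) : u • x ∈ N := by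
  obtain ⟨t, rfl⟩ := RingQuot.mkAlgHom_surjective ℂ (URel A) u
  induction t using TensorAlgebra.induction generalizing x with
  | algebraMap r =>
    rw [AlgHom.commutes, algebraMap_smul]; exact N.smul_mem _ hx
  | ι y =>
    change iota A y • x ∈ N
    induction y using TensorProduct.induction_on with
    | zero => simp
    | tmul z a => exact h z a x hx
    | add y y' hy hy' => rw [map_add, add_smul]; exact add_mem hy hy'
  | mul a b ha hb => rw [map_mul, mul_smul]; exact ha (hb hx)
  | add a b ha hb => rw [map_add, add_smul]; exact add_mem (ha hx) (hb hx)

end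
end SuperWeyl
end

open scoped TensorProduct
noncomputable section
namespace SuperWeyl

/-! ### The filtration stabilizes at length `m` -/

section
set_option linter.unusedSectionVars false
variable {A : Type*} [CommRing A] [Algebra ℂ A]
variable {M : Type*} [AddCommGroup M] [Module ℂ M] [Module (U A) M] [IsScalarTower ℂ (U A) M]
variable {w : M} {m : ℕ}

theorem mon_append (w : M) (ds ds' cs xs : List A) :
    mon w (ds ++ ds') cs xs = (ds.map (el y1)).prod • mon w ds' cs xs := by simp [mon, mul_smul]

theorem mon_replicate (w : M) (p : ℕ) (a : A) (cs xs : List A) :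
    mon w (List.replicate p a) cs xs = el y1 a ^ p • mon w [] cs xs := by simp [mon]

theorem y1_pow_smul_filt (a : A) (p : ℕ) {k : ℕ} {x : M} (hx : x ∈ filt A w k) :
    el y1 a ^ p • x ∈ filt A w (k + p) := by
  induction p with
  | zero => simpa using hx
  | succ p ih => rw [pow_succ', mul_smul]; exact y1_smul_filt _ ih

/-- The commutator of h_1 ⊗ c with a p-th power has p factors x_{-1} and no extra h_1, so it is one
shorter than either product. -/
theorem h1_smul_y1_pow (c : A) (p : ℕ) {k : ℕ} {x : M} (hx : x ∈ filt A w k) :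
    el h1 c • el y1 (1 : A) ^ p • x - el y1 (1 : A) ^ p • el h1 c • x ∈ filt A w (k + p) := by
  induction p with
  | zero => simp
  | succ p ih =>
    have h : el h1 c • el y1 (1 : A) ^ (p + 1) • x - el y1 (1 : A) ^ (p + 1) • el h1 c • x =
        el y1 (1 : A) • (el h1 c • el y1 (1 : A) ^ p • x - el y1 (1 : A) ^ p • el h1 c • x) +
          (-2 : ℂ) • el y1 c • el y1 (1 : A) ^ p • x := by
      rw [pow_succ', mul_smul, mul_smul, ← mul_smul (el h1 c), el_h1_mul_el_y1, add_smul,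
        mul_smul, smul_assoc, mul_one, smul_sub]
      abel
    rw [h]
    exact add_mem (y1_smul_filt _ ih)
      (Submodule.smul_mem _ _ (y1_smul_filt _ (y1_pow_smul_filt _ _ hx)))

/-- Each of the p + 1 factors x_{-1} ⊗ 1 is in turn converted into h_1 ⊗ c; pushing these to the
right only creates shorter terms. -/
theorem x1_smul_y1_pow (c : A) (p : ℕ) {k : ℕ} {x : M} (hx : x ∈ filt A w k)
    (h0 : el x1 c • x = 0) :
    el x1 c • el y1 (1 : A) ^ (p + 1) • x - ((p + 1 : ℕ) : ℂ) • el y1 (1 : A) ^ p • el h1 c • x ∈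
      filt A w (k + p) := by
  induction p with
  | zero => simp [← mul_smul, el_x1_mul_el_y1, add_smul]; simp [mul_smul, h0]
  | succ p ih =>
    have h : el x1 c • el y1 (1 : A) ^ (p + 1 + 1) • x -
          ((p + 1 + 1 : ℕ) : ℂ) • el y1 (1 : A) ^ (p + 1) • el h1 c • x =
        el y1 (1 : A) • (el x1 c • el y1 (1 : A) ^ (p + 1) • x -
          ((p + 1 : ℕ) : ℂ) • el y1 (1 : A) ^ p • el h1 c • x) +
        (el h1 c • el y1 (1 : A) ^ (p + 1) • x - el y1 (1 : A) ^ (p + 1) • el h1 c • x) := by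
      rw [pow_succ' _ (p + 1), mul_smul, ← mul_smul (el x1 c), el_x1_mul_el_y1, add_smul,
        mul_smul, mul_one, smul_sub, smul_comm (el y1 (1 : A)) ((p + 1 : ℕ) : ℂ),
        ← mul_smul (el y1 (1 : A)) (el y1 (1 : A) ^ p), ← pow_succ', Nat.cast_succ (p + 1),
        add_smul, one_smul]
      abel
    rw [h]
    exact add_mem (y1_smul_filt _ ih) (h1_smul_y1_pow _ _ hx)

/-- Here the conversion of one factor into x_{-3} ⊗ c is exact, because x_{-3} commutes with x_{-1}.
-/
theorem y2_smul_y1_pow (c : A) (p : ℕ) {x : M} (h0 : el y2 c • x = 0) :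
    el y2 c • el y1 (1 : A) ^ (p + 1) • x =
      ((p + 1 : ℕ) : ℂ) • el y1 (1 : A) ^ p • el y3 c • x := by
  induction p with
  | zero => simp [← mul_smul, el_y2_mul_el_y1, add_smul]; simp [mul_smul, h0]
  | succ p ih =>
    have h3 : ∀ q : ℕ, el y3 c • el y1 (1 : A) ^ q • x = el y1 (1 : A) ^ q • el y3 c • x := by
      intro q
      rw [← mul_smul, ← mul_smul,
        Commute.eq (Commute.pow_right (el_y3_mul_el_y1 c (1 : A) : Commute _ _) q)]
    rw [pow_succ' _ (p + 1), mul_smul, ← mul_smul (el y2 c), el_y2_mul_el_y1, add_smul,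
        mul_smul, mul_one, ih, h3, smul_comm (el y1 (1 : A)) ((p + 1 : ℕ) : ℂ),
        ← mul_smul (el y1 (1 : A)) (el y1 (1 : A) ^ p), ← pow_succ', Nat.cast_succ (p + 1),
        add_smul _ (1 : ℂ), one_smul]

/-- By the Leibniz rule h_2 ⊗ c relabels one factor x_{-1} ⊗ 1 as x_{-1} ⊗ c; exact because the
x_{-1} factors commute. -/
theorem h2_smul_y1_pow (c : A) (p : ℕ) (x : M) :
    el h2 c • el y1 (1 : A) ^ (p + 1) • x = el y1 (1 : A) ^ (p + 1) • el h2 c • x +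
      ((p + 1 : ℕ) : ℂ) • el y1 c • el y1 (1 : A) ^ p • x := by
  induction p with
  | zero => simp [← mul_smul, el_h2_mul_el_y1, add_smul]
  | succ p ih =>
    rw [pow_succ' _ (p + 1), mul_smul, mul_smul, ← mul_smul (el h2 c), el_h2_mul_el_y1, add_smul,
        mul_smul, mul_one, ih, smul_add, smul_comm (el y1 (1 : A)) ((p + 1 : ℕ) : ℂ),
        ← mul_smul (el y1 (1 : A)) (el y1 c), el_y1_mul_el_y1, mul_smul,
        ← mul_smul (el y1 (1 : A)) (el y1 (1 : A) ^ p), ← pow_succ', Nat.cast_succ (p + 1),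
        add_smul _ (1 : ℂ), one_smul, add_assoc]

theorem IsWeylVector.x1_smul_mon (hw : IsWeylVector (A := A) m w) (a : A) (cs : List A) :
    el x1 a • mon w [] cs [] = 0 := by
  induction cs generalizing a with
  | nil => rw [mon_nil]; exact hw.x1_smul a
  | cons c cs ih =>
    rw [← h1_smul_mon, ← mul_smul, el_x1_mul_el_h1, add_smul, mul_smul, smul_assoc, ih, ih]
    simp

theorem IsWeylVector.y2_smul_mon (hw : IsWeylVector (A := A) m w) (a : A) (cs xs : List A) :
    el y2 a • mon w [] cs xs = 0 := by
  induction cs generalizing a with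
  | nil =>
    induction xs generalizing a with
    | nil => rw [mon_nil]; exact hw.y2_smul a
    | cons x xs ih =>
      rw [← y3_smul_mon, ← mul_smul, el_y2_mul_el_y3, smul_assoc, mul_smul, ih]
      simp
  | cons c cs ih =>
    rw [← h1_smul_mon, ← mul_smul, el_y2_mul_el_h1, add_smul, mul_smul, smul_assoc, ih, ih]
    simp

/-- Putting x_{-3} in its ordered place costs commutators with h_1 that merge two factors into one.
-/
theorem y3_smul_mon_sub (a : A) (cs xs : List A) :
    el y3 a • mon w [] cs xs - mon w [] cs (a :: xs) ∈ filt A w (cs.length + xs.length) := by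
  induction cs with
  | nil => rw [y3_smul_mon]; simp
  | cons c cs ih =>
    have h : el y3 a • mon w [] (c :: cs) xs - mon w [] (c :: cs) (a :: xs) =
        el h1 c • (el y3 a • mon w [] cs xs - mon w [] cs (a :: xs)) +
          el y3 (a * c) • mon w [] cs xs := by
      rw [← h1_smul_mon, ← h1_smul_mon, ← mul_smul, el_y3_mul_el_h1, add_smul, mul_smul, smul_sub]
      abel
    rw [h, List.length_cons, add_right_comm]
    exact add_mem (h1_smul_filt _ ih) (y3_smul_filt _ (mon_mem_filt (by simp)))

/-- Commuting h_2 ⊗ a through the product only relabels one factor, so the number of factors is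
unchanged. The subspace is arbitrary so that the induction can strip a factor and pass to a preimage
of `N`. -/
theorem h2_smul_sub_mem {N : Submodule ℂ M} (a : A) (ds : List A) (x : M)
    (hN : ∀ ds' : List A, ds'.length = ds.length → (ds'.map (el y1)).prod • x ∈ N) :
    el h2 a • (ds.map (el y1)).prod • x - (ds.map (el y1)).prod • el h2 a • x ∈ N := by
  induction ds generalizing N with
  | nil => simp
  | cons d ds ih =>
    have h : el h2 a • ((d :: ds).map (el y1)).prod • x -
          ((d :: ds).map (el y1)).prod • el h2 a • x =
        el y1 d • (el h2 a • (ds.map (el y1)).prod • x - (ds.map (el y1)).prod • el h2 a • x) +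
          (((a * d) :: ds).map (el y1)).prod • x := by
      simp only [List.map_cons, List.prod_cons]
      rw [mul_smul, mul_smul, mul_smul, ← mul_smul (el h2 a), el_h2_mul_el_y1, add_smul, mul_smul,
        smul_sub]
      abel
    rw [h]
    refine add_mem ?_ (hN _ (by simp))
    exact ih (N := preim (el y1 d) N) fun ds' hd => by
      have := hN (d :: ds') (by simpa using hd)
      rwa [List.map_cons, List.prod_cons, mul_smul] at this

/-- h_2 commutes with h_1, kills `w`, and relabels the x_{-3} factors, so only the labels in `xs`
change. -/
theorem IsWeylVector.h2_smul_mon_mem (hw : IsWeylVector (A := A) m w) {N : Submodule ℂ M} (a : A)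
    (cs xs : List A) (hN : ∀ xs' : List A, xs'.length = xs.length → mon w [] cs xs' ∈ N) :
    el h2 a • mon w [] cs xs ∈ N := by
  induction cs generalizing N with
  | nil =>
    induction xs generalizing N with
    | nil => rw [mon_nil, hw.h2_smul]; simp
    | cons x xs ih =>
      rw [← y3_smul_mon, ← mul_smul, el_h2_mul_el_y3, add_smul, mul_smul, y3_smul_mon]
      refine add_mem ?_ (hN _ (by simp))
      exact ih (N := preim (el y3 x) N) fun xs' hx => by
        rw [mem_preim, y3_smul_mon]; exact hN _ (by simpa using hx)
  | cons c cs ih =>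
    rw [← h1_smul_mon, ← mul_smul, el_h2_mul_el_h1, mul_smul]
    exact ih (N := preim (el h1 c) N) fun xs' hx => by
      rw [mem_preim, h1_smul_mon]; exact hN _ hx

/-! ### Reduction of the monomials of length m + 1. -/

theorem mem_of_nat_smul_mem {N : Submodule ℂ M} {p : ℕ} {x : M}
    (h : ((p + 1 : ℕ) : ℂ) • x ∈ N) : x ∈ N :=
  (Submodule.smul_mem_iff N (Nat.cast_ne_zero.2 p.succ_ne_zero)).1 h

/-- Starts from (x_{-1} ⊗ 1)^{m+1} w = 0. Each h_1 ⊗ c is introduced by applying x_1 ⊗ c to the case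
with one more x_{-1} ⊗ 1: the result stays in the filtration, and its leading term is p + 1 times
the monomial sought. -/
theorem IsWeylVector.y1_h1_mem (hw : IsWeylVector (A := A) m w) (cs : List A) (p : ℕ)
    (h : p + cs.length = m + 1) : mon w (List.replicate p 1) cs [] ∈ filt A w m := by
  induction cs generalizing p with
  | nil =>
    obtain rfl : p = m + 1 := by simpa using h
    rw [mon_replicate, mon_nil, hw.y1_pow]; simp
  | cons c cs ih =>
    have h1 := (smul_filt hw m (ih (p + 1) (by simp at h; omega)) c).1
    have h2 := x1_smul_y1_pow c p (mon_mem_filt (w := w) (ds := []) (cs := cs) (xs := []) le_rfl)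
      (hw.x1_smul_mon c cs)
    rw [mon_replicate] at h1 ⊢
    rw [← h1_smul_mon]
    refine mem_of_nat_smul_mem (p := p) ?_
    rw [← sub_sub_self (el x1 c • el y1 (1 : A) ^ (p + 1) • mon w [] cs [])
      (((p + 1 : ℕ) : ℂ) • _)]
    exact sub_mem h1 (filt_mono (by simp at *; omega) h2)

/-- The same exchange with x_{-2} ⊗ x, which trades an x_{-1} ⊗ 1 for an x_{-3} ⊗ x. -/
theorem IsWeylVector.y1_h1_y3_mem (hw : IsWeylVector (A := A) m w) (cs xs : List A) (p : ℕ)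
    (h : p + cs.length + xs.length = m + 1) :
    mon w (List.replicate p 1) cs xs ∈ filt A w m := by
  induction xs generalizing p with
  | nil => exact hw.y1_h1_mem cs p (by simpa using h)
  | cons x xs ih =>
    have h1 := (smul_filt hw m (ih (p + 1) (by simp at h; omega)) x).2.2.2.1
    rw [mon_replicate, y2_smul_y1_pow x p (hw.y2_smul_mon x cs xs)] at h1
    have h2 := y1_pow_smul_filt 1 p (y3_smul_mon_sub (w := w) x cs xs)
    rw [smul_sub] at h2
    rw [mon_replicate, ← sub_sub_self (el y1 (1 : A) ^ p • el y3 x • mon w [] cs xs)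
      (el y1 (1 : A) ^ p • mon w [] cs (x :: xs))]
    exact sub_mem (mem_of_nat_smul_mem h1) (filt_mono (by simp at *; omega) h2)

/-- Here h_2 ⊗ d trades an x_{-1} ⊗ 1 for an x_{-1} ⊗ d. It also relabels the other factors, but
those terms have only q arbitrary x_{-1} labels, whence the induction on q for all labels
simultaneously. -/
theorem IsWeylVector.mon_append_mem (hw : IsWeylVector (A := A) m w) (q : ℕ) (ds cs xs : List A)
    (p : ℕ) (hq : ds.length = q) (h : q + p + cs.length + xs.length = m + 1) :
    mon w (ds ++ List.replicate p 1) cs xs ∈ filt A w m := by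
  induction q generalizing ds cs xs p with
  | zero =>
    obtain rfl := List.length_eq_zero_iff.1 hq
    exact hw.y1_h1_y3_mem cs xs p (by omega)
  | succ q ih =>
    obtain rfl | ⟨ds, d, rfl⟩ := List.eq_nil_or_concat' ds
    · simp at hq
    have hq' : ds.length = q := by simpa using hq
    have g1 := (smul_filt hw m (ih ds cs xs (p + 1) hq' (by omega)) d).2.2.2.2
    rw [mon_append, mon_replicate] at g1
    have g2 := h2_smul_sub_mem (N := filt A w m) d ds
      (el y1 (1 : A) ^ (p + 1) • mon w [] cs xs) fun ds' hd => by
        rw [← mon_replicate, ← mon_append]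
        exact ih ds' cs xs (p + 1) (hd.trans hq') (by omega)
    have h3 := sub_mem g1 g2
    -- The relabellings inside `ds` are now removed; what is left is the term where h_2 reaches the
    -- h_1 and x_{-3} factors (`h4`) and p + 1 times the target.
    rw [sub_sub_self, h2_smul_y1_pow, smul_add] at h3
    have h4 : (ds.map (el y1)).prod • el y1 (1 : A) ^ (p + 1) • el h2 d • mon w [] cs xs ∈
        filt A w m := by
      rw [← mul_smul (List.prod _), ← mem_preim]
      refine hw.h2_smul_mon_mem d cs xs fun xs' hx => ?_
      rw [mem_preim, mul_smul, ← mon_replicate, ← mon_append]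
      exact ih ds cs xs' (p + 1) hq' (by omega)
    have h5 := (Submodule.add_mem_iff_right _ h4).1 h3
    rw [smul_comm] at h5
    have h6 := mem_of_nat_smul_mem h5
    rw [← mon_replicate, y1_smul_mon, ← mon_append] at h6
    rw [List.append_assoc]
    exact h6

theorem IsWeylVector.filt_succ (hw : IsWeylVector (A := A) m w) : filt A w (m + 1) ≤ filt A w m := by
  refine Submodule.span_le.2 ?_
  rintro _ ⟨ds, cs, xs, h, rfl⟩
  rcases Nat.lt_or_ge (ds.length + cs.length + xs.length) (m + 1) with h' | h'
  · exact mon_mem_filt (by omega)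
  · have := hw.mon_append_mem ds.length ds cs xs 0 rfl (by omega)
    simpa using this

/-- Five generators preserve the filtration, and x_{-1}, h_1, x_{-3} raise length m to m + 1, which
reduces back to m. The span is therefore stable under the whole algebra. -/
theorem IsWeylVector.smul_mem_filt (hw : IsWeylVector (A := A) m w) (u : U A) :
    u • w ∈ filt A w m := by
  refine smul_mem_of_stable (fun z a x hx => ?_) u (self_mem_filt m)
  obtain ⟨k1, k2, k3, k4, k5⟩ := smul_filt hw m hx a
  rw [sl21_eq z]
  simp only [el_add_left, el_smul_left, add_smul, smul_assoc]
  have up := hw.filt_succ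
  have s := fun (c : ℂ) {y : M} (hy : y ∈ filt A w m) => Submodule.smul_mem _ c hy
  exact add_mem (add_mem (add_mem (add_mem (add_mem (add_mem (add_mem (s _ k1) (s _ k2)) (s _ k3))
    (s _ (up (y1_smul_filt _ hx)))) (s _ k4)) (s _ (up (y3_smul_filt _ hx))))
    (s _ (up (h1_smul_filt _ hx)))) (add_mem (s _ k5) (s _ k5))

end
end SuperWeyl
end

open scoped TensorProduct
noncomputable section
namespace SuperWeyl

/-! ### The recursion of the elements `p_1(φ, χ)` -/

section
set_option linter.unusedSectionVars false
open Finset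

theorem multinomial_degree_eq_one {α : Type*} (a : α) :
    Finsupp.multinomial (Finsupp.single a 1) = 1 := by
  classical
  rw [Finsupp.multinomial_eq_of_support_subset (s := {a}) Finsupp.support_single_subset,
    Nat.multinomial_singleton]

/-- Pascal's rule: arrangements of a multiset sorted by one distinguished letter. -/
theorem sum_multinomial_tsub {α : Type*} [DecidableEq α] {χ : α →₀ ℕ} (h : χ ≠ 0) :
    ∑ a ∈ χ.support, (χ - Finsupp.single a 1).multinomial = χ.multinomial := by
  have hpos : 0 < ∏ i ∈ χ.support, (χ i).factorial :=
    prod_pos fun i _ => Nat.factorial_pos _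
  have hn : χ.degree = ∑ i ∈ χ.support, χ i := rfl
  obtain ⟨n, hn'⟩ : ∃ n, χ.degree = n + 1 :=
    Nat.exists_eq_succ_of_ne_zero fun h0 => h ((Finsupp.degree_eq_zero_iff χ).1 h0)
  refine Nat.eq_of_mul_eq_mul_left hpos ?_
  rw [Finsupp.multinomial_eq, Nat.multinomial_spec, ← hn, hn', Nat.factorial_succ, ← hn', hn,
    mul_sum, sum_mul]
  refine sum_congr rfl fun a ha => ?_
  have ha1 : 1 ≤ χ a := Nat.one_le_iff_ne_zero.2 (Finsupp.mem_support_iff.1 ha)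
  have hsub : (χ - Finsupp.single a 1).support ⊆ χ.support := Finsupp.support_tsub
  have hd : ∑ i ∈ χ.support, (χ - Finsupp.single a 1 : α →₀ ℕ) i = n := by
    have h1 := congrArg Finsupp.degree
      (tsub_add_cancel_of_le (Finsupp.single_le_iff.2 ha1 : Finsupp.single a 1 ≤ χ))
    rw [map_add, hn', Finsupp.degree_single] at h1
    have h2 : (χ - Finsupp.single a 1).degree = ∑ i ∈ χ.support, (χ - Finsupp.single a 1 : α →₀ ℕ) i :=
      sum_subset hsub fun i _ hi => Finsupp.notMem_support_iff.1 hi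
    omega
  have hp : ∏ i ∈ χ.support, (χ i).factorial =
      χ a * ∏ i ∈ χ.support, ((χ - Finsupp.single a 1 : α →₀ ℕ) i).factorial := by
    rw [← mul_prod_erase _ _ ha, ← mul_prod_erase _ (fun i => ((χ - Finsupp.single a 1 : α →₀ ℕ) i).factorial) ha,
      ← mul_assoc]
    congr 1
    · rw [Finsupp.tsub_apply, Finsupp.single_eq_same, Nat.mul_factorial_pred (by omega)]
    · refine prod_congr rfl fun i hi => ?_
      rw [Finsupp.tsub_apply, Finsupp.single_eq_of_ne (ne_of_mem_erase hi), tsub_zero]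
  rw [hp, Finsupp.multinomial_eq_of_support_subset hsub, mul_assoc, Nat.multinomial_spec, hd]

theorem sum_antidiagonal_eq_sum_Iic {α N : Type*} [DecidableEq α] [AddCommMonoid N]
    (χ : α →₀ ℕ) (f : (α →₀ ℕ) → (α →₀ ℕ) → N) :
    ∑ q ∈ antidiagonal χ, f q.1 q.2 = ∑ ψ ∈ Iic χ, f ψ (χ - ψ) := by
  refine sum_bij' (fun q _ => q.1) (fun ψ _ => (ψ, χ - ψ)) ?_ ?_ ?_ ?_ ?_
  · intro q hq; rw [HasAntidiagonal.mem_antidiagonal] at hq; rw [mem_Iic, ← hq]; exact le_self_add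
  · intro ψ hψ; rw [HasAntidiagonal.mem_antidiagonal]; exact add_tsub_cancel_of_le (mem_Iic.1 hψ)
  · rintro ⟨q, q'⟩ hq; rw [HasAntidiagonal.mem_antidiagonal] at hq; simp [← hq]
  · intro ψ _; rfl
  · rintro ⟨q, q'⟩ hq; rw [HasAntidiagonal.mem_antidiagonal] at hq; simp [← hq]

theorem degree_eq_one_iff {α : Type*} {δ : α →₀ ℕ} :
    δ.degree = 1 ↔ ∃ a, δ = Finsupp.single a 1 := by
  constructor
  · intro h
    have h0 : δ ≠ 0 := by rintro rfl; simp at h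
    obtain ⟨a, ha⟩ := Finsupp.support_nonempty_iff.2 h0
    have h1 : Finsupp.single a 1 ≤ δ :=
      Finsupp.single_le_iff.2 (Nat.one_le_iff_ne_zero.2 (Finsupp.mem_support_iff.1 ha))
    have h2 := congrArg Finsupp.degree (tsub_add_cancel_of_le h1)
    rw [map_add, h, Finsupp.degree_single] at h2
    have h3 : δ - Finsupp.single a 1 = 0 := (Finsupp.degree_eq_zero_iff _).1 (by omega)
    refine ⟨a, ?_⟩
    rw [← tsub_add_cancel_of_le h1, h3, zero_add]
  · rintro ⟨a, rfl⟩; simp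

/-- Turns a sum over the support into part of a convolution, so that both recursions for p_1 take
the same shape. -/
theorem sum_antidiagonal_degree_one {α N : Type*} [DecidableEq α] [AddCommMonoid N]
    (φ : α →₀ ℕ) (f : (α →₀ ℕ) → (α →₀ ℕ) → N) :
    ∑ q ∈ antidiagonal φ, (if q.1.degree = 1 then f q.1 q.2 else 0) =
      ∑ d ∈ φ.support, f (Finsupp.single d 1) (φ - Finsupp.single d 1) := by
  rw [sum_antidiagonal_eq_sum_Iic φ fun ψ χ => if ψ.degree = 1 then f ψ χ else 0, ← sum_filter]
  symm
  refine sum_bij (fun d _ => Finsupp.single d 1) ?_ ?_ ?_ ?_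
  · intro d hd
    rw [mem_filter, mem_Iic]
    exact ⟨Finsupp.single_le_iff.2 (Nat.one_le_iff_ne_zero.2 (Finsupp.mem_support_iff.1 hd)),
      by simp⟩
  · intro a _ b _ h
    exact (Finsupp.single_left_inj one_ne_zero).1 h
  · intro ψ hψ
    rw [mem_filter, mem_Iic] at hψ
    obtain ⟨a, rfl⟩ := degree_eq_one_iff.1 hψ.2
    refine ⟨a, Finsupp.mem_support_iff.2 ?_, rfl⟩
    have := Finsupp.single_le_iff.1 hψ.1
    omega
  · intros; rfl

variable {A : Type*} [CommRing A] [Algebra ℂ A]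

theorem piMul_single (a : A) : piMul (Finsupp.single a 1) = a := by simp [piMul]

theorem piMul_zero : piMul (0 : A →₀ ℕ) = 1 := by simp [piMul]

theorem p1_zero_zero : p1 (0 : A →₀ ℕ) 0 = 1 := by
  rw [p1, if_pos rfl, if_pos rfl]

theorem neg_eq_smul (x : U A) : -x = (-1 : ℂ) • x := (neg_one_smul ℂ x).symm

/-- The coefficient elements in the recursion for `p_1(0, χ)`. -/
def cartanGen (ψ : A →₀ ℕ) : MapAlg A :=
  if ψ.degree = 0 then 0 else (-(ψ.multinomial : ℂ)) • h1 ⊗ₜ piMul ψ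

/-- The coefficient elements in the recursion for `p_1(φ, χ)`. -/
def lowerGen (δ ψ : A →₀ ℕ) : MapAlg A :=
  if δ.degree = 1 then (-(ψ.multinomial : ℂ)) • y1 ⊗ₜ (piMul δ * piMul ψ) else 0

/-- The recursion with its denominator cleared, as a full convolution: the generator at 0 is zero,
so the term ψ = 0 may be included and χ = 0 is no exception. -/
theorem degree_smul_p1_zero [DecidableEq A] (χ : A →₀ ℕ) :
    (χ.degree : ℂ) • p1 0 χ = ∑ q ∈ antidiagonal χ, iota A (cartanGen q.1) * p1 0 q.2 := by
  by_cases h : χ = 0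
  · subst h; simp [cartanGen]
  rw [p1, if_pos rfl, if_neg h, neg_eq_smul, smul_comm _ (-1 : ℂ), smul_smul (χ.degree : ℂ), mul_inv_cancel₀,
    one_smul, sum_antidiagonal_eq_sum_Iic χ fun ψ χ' => iota A (cartanGen ψ) * p1 0 χ',
    ← sum_erase (Iic χ) (a := 0) (f := fun ψ => iota A (cartanGen ψ) * p1 0 (χ - ψ)), smul_sum,
    ← Finset.sum_attach ((Iic χ).erase 0)]
  · rw [← univ_eq_attach]
    have key : ∀ ψ ∈ (Iic χ).erase 0, iota A (cartanGen ψ) * p1 0 (χ - ψ) =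
        (-1 : ℂ) • (ψ.multinomial : ℂ) • (el h1 (piMul ψ) * p1 0 (χ - ψ)) := by
      intro ψ hψ
      rw [cartanGen, if_neg fun h' => (mem_erase.1 hψ).1 ((Finsupp.degree_eq_zero_iff ψ).1 h'),
        map_smul, smul_smul, neg_one_mul, smul_mul_assoc]
      rfl
    have heq : (fun i : {ψ // ψ ∈ (Iic χ).erase 0} =>
        iota A (cartanGen i.1) * p1 0 (χ - i.1)) = fun i => _ := funext fun i => key i.1 i.2
    rw [heq]
    congr!
  · simp [cartanGen]
  · rw [Nat.cast_ne_zero, Ne, Finsupp.degree_eq_zero_iff]; exact h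

/-- The convolution form of the second recursion; both sides vanish when φ = 0. -/
theorem degree_smul_p1 [DecidableEq A] (φ χ : A →₀ ℕ) :
    (φ.degree : ℂ) • p1 φ χ = ∑ q ∈ antidiagonal φ, ∑ r ∈ antidiagonal χ,
      iota A (lowerGen q.1 r.1) * p1 q.2 r.2 := by
  have h1 : ∀ q ∈ antidiagonal φ, ∑ r ∈ antidiagonal χ, iota A (lowerGen q.1 r.1) * p1 q.2 r.2 =
      if q.1.degree = 1 then ∑ ψ ∈ Iic χ,
        (-(ψ.multinomial : ℂ)) • (el y1 (piMul q.1 * piMul ψ) * p1 q.2 (χ - ψ)) else 0 := by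
    intro q _
    split_ifs with hq
    · rw [sum_antidiagonal_eq_sum_Iic χ fun ψ χ' => iota A (lowerGen q.1 ψ) * p1 q.2 χ']
      refine sum_congr rfl fun ψ _ => ?_
      rw [lowerGen, if_pos hq, map_smul, smul_mul_assoc]; rfl
    · refine sum_eq_zero fun r _ => ?_
      rw [lowerGen, if_neg hq, map_zero, zero_mul]
  rw [sum_congr rfl h1, sum_antidiagonal_degree_one φ fun δ φ' => ∑ ψ ∈ Iic χ,
        (-(ψ.multinomial : ℂ)) • (el y1 (piMul δ * piMul ψ) * p1 φ' (χ - ψ))]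
  by_cases h : φ = 0
  · subst h; simp
  rw [p1, if_neg h, neg_eq_smul, smul_comm _ (-1 : ℂ), smul_smul (φ.degree : ℂ), mul_inv_cancel₀,
    one_smul, smul_sum,
    ← Finset.sum_attach φ.support, ← univ_eq_attach]
  · refine sum_congr rfl fun d _ => ?_
    rw [smul_sum, ← Finset.sum_attach (Iic χ), ← univ_eq_attach]
    simp only [smul_smul, neg_one_mul, piMul_single]
    congr!
  · rw [Nat.cast_ne_zero, Ne, Finsupp.degree_eq_zero_iff]; exact h

end
end SuperWeyl
end

open scoped TensorProduct
noncomputable section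
namespace SuperWeyl

/-! ### Leading terms of the elements `p_1(φ, χ)` -/

section
set_option linter.unusedSectionVars false
open Finset

/-- The multiplicity function of a list. -/
def mult {α : Type*} (l : List α) : α →₀ ℕ := (l.map fun a => Finsupp.single a 1).sum

@[simp] theorem mult_nil {α : Type*} : mult ([] : List α) = 0 := rfl
@[simp] theorem mult_cons {α : Type*} (a : α) (l : List α) :
    mult (a :: l) = Finsupp.single a 1 + mult l := rfl

theorem degree_mult {α : Type*} (l : List α) : (mult l).degree = l.length := by
  induction l with
  | nil => simp
  | cons a l ih => rw [mult_cons, map_add, ih, Finsupp.degree_single, List.length_cons, add_comm]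

theorem toMultiset_mult {α : Type*} (l : List α) : Finsupp.toMultiset (mult l) = l := by
  induction l with
  | nil => simp
  | cons a l ih => rw [mult_cons, map_add, ih, Finsupp.toMultiset_single]; simp

theorem mult_perm {α : Type*} {l l' : List α} (h : mult l = mult l') : l.Perm l' :=
  Quotient.exact ((toMultiset_mult l).symm.trans ((congrArg _ h).trans (toMultiset_mult l')))

theorem exists_mult {α : Type*} (φ : α →₀ ℕ) : ∃ l, mult l = φ := by
  classical
  refine ⟨(Finsupp.toMultiset φ).toList, ?_⟩
  rw [← Finsupp.toMultiset_toFinsupp (mult _), toMultiset_mult, Multiset.coe_toList,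
    Finsupp.toMultiset_toFinsupp]

theorem mapDomain_mult {α β : Type*} (f : α → β) (l : List α) :
    (mult l).mapDomain f = mult (l.map f) := by
  induction l with
  | nil => simp
  | cons a l ih => rw [mult_cons, Finsupp.mapDomain_add, ih, Finsupp.mapDomain_single]; rfl

/-- The coefficient of the leading term of `p_1(0, χ)`. -/
def lead {α : Type*} (χ : α →₀ ℕ) : ℂ :=
  (-1) ^ χ.degree * χ.multinomial / (χ.degree.factorial : ℂ)

theorem lead_zero {α : Type*} : lead (0 : α →₀ ℕ) = 1 := by
  simp [lead, Finsupp.multinomial_eq]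

theorem lead_ne_zero {α : Type*} (χ : α →₀ ℕ) : lead χ ≠ 0 := by
  have h : 0 < χ.multinomial := by rw [Finsupp.multinomial_eq]; exact Nat.multinomial_pos _ _
  unfold lead
  refine div_ne_zero (mul_ne_zero (by simp) (Nat.cast_ne_zero.2 h.ne')) ?_
  exact Nat.cast_ne_zero.2 (Nat.factorial_ne_zero _)

/-- The leading coefficients obey the recursion of p_1 truncated to |ψ| = 1, which is Pascal's rule
for multinomials. -/
theorem sum_lead {α : Type*} [DecidableEq α] (χ : α →₀ ℕ) :
    ∑ q ∈ HasAntidiagonal.antidiagonal χ, (if q.1.degree = 1 then -lead q.2 else 0) =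
      (χ.degree : ℂ) * lead χ := by
  rw [sum_antidiagonal_degree_one χ fun _ ψ => -lead ψ]
  by_cases h : χ = 0
  · subst h; simp
  obtain ⟨n, hn⟩ : ∃ n, χ.degree = n + 1 :=
    Nat.exists_eq_succ_of_ne_zero fun h0 => h ((Finsupp.degree_eq_zero_iff χ).1 h0)
  have h1 : ∀ a ∈ χ.support, -lead (χ - Finsupp.single a 1) =
      (-1) ^ (n + 1) / (n.factorial : ℂ) * ((χ - Finsupp.single a 1).multinomial : ℂ) := by
    intro a ha
    have ha1 : Finsupp.single a 1 ≤ χ :=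
      Finsupp.single_le_iff.2 (Nat.one_le_iff_ne_zero.2 (Finsupp.mem_support_iff.1 ha))
    have h2 := congrArg Finsupp.degree (tsub_add_cancel_of_le ha1)
    rw [map_add, hn, Finsupp.degree_single] at h2
    have h3 : (χ - Finsupp.single a 1 : α →₀ ℕ).degree = n := by omega
    rw [lead, h3, pow_succ]
    ring
  rw [sum_congr rfl h1, ← mul_sum, ← Nat.cast_sum, sum_multinomial_tsub h, lead, hn,
    Nat.factorial_succ]
  have : (n.factorial : ℂ) ≠ 0 := Nat.cast_ne_zero.2 (Nat.factorial_ne_zero _)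
  have : ((n : ℂ) + 1) ≠ 0 := Nat.cast_add_one_ne_zero n
  push_cast
  field_simp

variable {A : Type*} [CommRing A] [Algebra ℂ A]
variable {M : Type*} [AddCommGroup M] [Module ℂ M] [Module (U A) M] [IsScalarTower ℂ (U A) M]
variable {w : M} {m : ℕ}

/-- The span of the ordered monomials of length less than `k`. -/
def lower (A : Type*) [CommRing A] [Algebra ℂ A] [Module (U A) M] (w : M) : ℕ → Submodule ℂ M
  | 0 => ⊥
  | k + 1 => filt A w k

theorem lower_le_filt (k : ℕ) : lower A w k ≤ filt A w (k - 1) := by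
  cases k with
  | zero => exact bot_le
  | succ k => exact le_rfl

theorem filt_le_lower {k l : ℕ} (h : k < l) : filt A w k ≤ lower A w l := by
  obtain ⟨l, rfl⟩ : ∃ n, l = n + 1 := ⟨l - 1, by omega⟩
  exact filt_mono (by omega)

theorem h1_smul_lower (a : A) {k : ℕ} {x : M} (hx : x ∈ lower A w k) :
    el h1 a • x ∈ lower A w (k + 1) := by
  cases k with
  | zero => rw [(Submodule.mem_bot ℂ).1 hx]; simp
  | succ k => exact h1_smul_filt a hx

theorem y1_smul_lower (a : A) {k : ℕ} {x : M} (hx : x ∈ lower A w k) :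
    el y1 a • x ∈ lower A w (k + 1) := by
  cases k with
  | zero => rw [(Submodule.mem_bot ℂ).1 hx]; simp
  | succ k => exact y1_smul_filt a hx

theorem mon_perm {ds ds' cs cs' : List A} (hd : ds.Perm ds') (hc : cs.Perm cs') (xs : List A) :
    mon w ds cs xs = mon w ds' cs' xs := by
  have g1 : (ds.map (el y1)).prod = (ds'.map (el y1)).prod :=
    (hd.map _).prod_eq' (List.pairwise_map.2 (List.pairwise_of_forall fun _ _ => el_y1_mul_el_y1 _ _))
  have g2 : (cs.map (el h1)).prod = (cs'.map (el h1)).prod :=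
    (hc.map _).prod_eq' (List.pairwise_map.2 (List.pairwise_of_forall fun _ _ => el_h1_mul_el_h1 _ _))
  rw [mon, mon, g1, g2]

theorem mem_filt_of_sub_mem_lower {x y : M} {k : ℕ} (h : x - y ∈ lower A w k)
    (hy : y ∈ filt A w k) : x ∈ filt A w k := by
  rw [← sub_add_cancel x y]
  exact add_mem (filt_mono (by omega) (lower_le_filt k h)) hy

/-- In the recursion a term with |ψ| ≥ 2 packs several labels into one factor h_1 ⊗ π(ψ) and is
shorter; only |ψ| = 1 reaches full length. -/
theorem p1_zero_smul_mon (n : ℕ) (cs xs : List A) (hn : cs.length = n) :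
    p1 0 (mult cs) • mon w [] [] xs - lead (mult cs) • mon w [] cs xs ∈
      lower A w (cs.length + xs.length) := by
  classical
  induction n using Nat.strong_induction_on generalizing cs with
  | _ n ih =>
  rcases Nat.eq_zero_or_pos n with rfl | hpos
  · obtain rfl := List.length_eq_zero_iff.1 hn
    simp [p1_zero_zero, lead_zero]
  have hdeg : ((mult cs).degree : ℂ) ≠ 0 := by rw [degree_mult]; exact Nat.cast_ne_zero.2 (by omega)
  rw [← Submodule.smul_mem_iff _ hdeg, smul_sub, ← smul_assoc, degree_smul_p1_zero, smul_smul,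
    ← sum_lead, sum_smul, sum_smul, ← sum_sub_distrib]
  refine sum_mem fun q hq => ?_
  rw [HasAntidiagonal.mem_antidiagonal] at hq
  obtain ⟨cs', hcs'⟩ := exists_mult q.2
  have hl : q.1.degree + cs'.length = n := by
    rw [← hn, ← degree_mult, ← degree_mult, ← hq, hcs', map_add]
  rw [mul_smul]
  rcases Nat.lt_trichotomy q.1.degree 1 with h | h | h
  · simp [cartanGen, show q.1.degree = 0 by omega]
  · obtain ⟨a, ha⟩ := degree_eq_one_iff.1 h
    have hp : cs.Perm (a :: cs') := mult_perm (by rw [mult_cons, hcs', ← ha, hq])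
    have g1 := h1_smul_lower a (ih _ (by omega) cs' rfl)
    rw [smul_sub, smul_comm (el h1 a) (lead _), h1_smul_mon, ← mon_perm (List.Perm.refl []) hp, hcs'] at g1
    rw [if_pos h, cartanGen, if_neg (by omega), ha, multinomial_degree_eq_one, piMul_single,
      map_smul, Nat.cast_one, smul_assoc, neg_smul, neg_smul, one_smul, sub_neg_eq_add,
      neg_add_eq_sub, ← neg_sub]
    refine neg_mem ?_
    rw [hn]
    have : cs'.length + xs.length + 1 = n + xs.length := by omega
    rwa [this] at g1
  -- At least two labels have been merged into one factor, so this term is strictly shorter.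
  · rw [if_neg (by omega), zero_smul, sub_zero, cartanGen, if_neg (by omega), map_smul, smul_assoc]
    refine Submodule.smul_mem _ _ ?_
    have g1 := mem_filt_of_sub_mem_lower (ih _ (by omega) cs' rfl)
      (Submodule.smul_mem _ _ (mon_mem_filt (by simp)))
    rw [hcs'] at g1
    exact filt_le_lower (by omega) (h1_smul_filt _ g1)

/-- Triangularity: the p-vector is a nonzero multiple of the ordered monomial with the same labels,
plus shorter monomials. -/
theorem p1_smul_mon (n : ℕ) (ds cs xs : List A) (hn : ds.length = n) :
    p1 (mult ds) (mult cs) • mon w [] [] xs -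
        (lead (mult ds) * lead (mult cs)) • mon w ds cs xs ∈
      lower A w (ds.length + cs.length + xs.length) := by
  classical
  induction n using Nat.strong_induction_on generalizing ds cs with
  | _ n ih =>
  rcases Nat.eq_zero_or_pos n with rfl | hpos
  · obtain rfl := List.length_eq_zero_iff.1 hn
    simpa [lead_zero] using p1_zero_smul_mon _ cs xs rfl
  have hdeg : ((mult ds).degree : ℂ) ≠ 0 := by rw [degree_mult]; exact Nat.cast_ne_zero.2 (by omega)
  rw [← Submodule.smul_mem_iff _ hdeg, smul_sub, ← smul_assoc, degree_smul_p1, smul_smul,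
    ← mul_assoc, ← sum_lead, sum_mul, sum_smul, sum_smul, ← sum_sub_distrib]
  refine sum_mem fun q hq => ?_
  rw [HasAntidiagonal.mem_antidiagonal] at hq
  obtain ⟨ds', hds'⟩ := exists_mult q.2
  have hl : q.1.degree + ds'.length = n := by
    rw [← hn, ← degree_mult, ← degree_mult, ← hq, hds', map_add]
  by_cases h : q.1.degree = 1
  swap
  · simp [h, lowerGen]
  obtain ⟨d, hd⟩ := degree_eq_one_iff.1 h
  have hp : ds.Perm (d :: ds') := mult_perm (by rw [mult_cons, hds', ← hd, hq])
  have hmem : ((0 : A →₀ ℕ), mult cs) ∈ HasAntidiagonal.antidiagonal (mult cs) := by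
    rw [HasAntidiagonal.mem_antidiagonal, zero_add]
  -- The term ψ = 0 carries the leading monomial; every ψ ≠ 0 absorbs labels of χ into the x_{-1}
  -- factor and shortens the monomial.
  rw [← add_sum_erase _ _ hmem, add_smul, add_sub_right_comm]
  refine add_mem ?_ ?_
  · have g1 := y1_smul_lower d (ih _ (by omega) ds' cs rfl)
    rw [smul_sub, smul_comm (el y1 d) (lead _ * lead _), y1_smul_mon, ← mon_perm hp (List.Perm.refl _), hds'] at g1
    rw [if_pos h, lowerGen, if_pos h, hd, piMul_single, piMul_zero, mul_one,
      Finsupp.multinomial_eq]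
    simp only [Finsupp.support_zero, Nat.multinomial_empty, Nat.cast_one]
    rw [map_smul, mul_smul, smul_assoc, neg_smul, neg_mul, neg_smul, one_smul, sub_neg_eq_add,
      neg_add_eq_sub, ← neg_sub]
    refine neg_mem ?_
    rw [hn]
    have : ds'.length + cs.length + xs.length + 1 = n + cs.length + xs.length := by omega
    rwa [this] at g1
  · rw [sum_smul]
    refine sum_mem fun r hr => ?_
    rw [mem_erase, HasAntidiagonal.mem_antidiagonal] at hr
    obtain ⟨cs', hcs'⟩ := exists_mult r.2
    have hl' : r.1.degree + cs'.length = cs.length := by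
      rw [← degree_mult, ← degree_mult, ← hr.2, hcs', map_add]
    have hr0 : r.1.degree ≠ 0 := fun h0 => hr.1 (by
      have h1 := (Finsupp.degree_eq_zero_iff _).1 h0
      have h2 := hr.2
      rw [h1, zero_add] at h2
      exact Prod.ext h1 h2)
    rw [lowerGen, if_pos h, map_smul, mul_smul, smul_assoc]
    refine Submodule.smul_mem _ _ ?_
    have g1 := mem_filt_of_sub_mem_lower (ih _ (by omega) ds' cs' rfl)
      (Submodule.smul_mem _ _ (mon_mem_filt le_rfl))
    rw [hcs', hds'] at g1
    exact filt_le_lower (by omega) (y1_smul_filt _ g1)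

end
end SuperWeyl
end

open scoped TensorProduct
noncomputable section
namespace SuperWeyl

/-! ### Spanning families of the highest weight module -/

section
set_option linter.unusedSectionVars false
variable {A : Type*} [CommRing A] [Algebra ℂ A]
variable {M : Type*} [AddCommGroup M] [Module ℂ M] [Module (U A) M] [IsScalarTower ℂ (U A) M]
variable {w : M} {m : ℕ}

theorem el_y3_mul_self (a : A) : el y3 a * el y3 a = 0 := by
  have h : (2 : ℂ) • (el y3 a * el y3 a) = 0 := by
    have h1 := congrArg (el y3 a * el y3 a + ·) (el_y3_mul_el_y3 a a)
    rw [two_smul, h1, ← neg_eq_smul, add_neg_cancel]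
  exact (smul_eq_zero.1 h).resolve_left two_ne_zero

theorem y3_prod_perm {xs xs' : List A} (h : xs.Perm xs') :
    ∃ c : ℂ, (xs.map (el y3)).prod = c • (xs'.map (el y3)).prod := by
  induction h with
  | nil => exact ⟨1, by simp⟩
  | cons x _ ih =>
    obtain ⟨c, hc⟩ := ih
    exact ⟨c, by rw [List.map_cons, List.prod_cons, hc, List.map_cons, List.prod_cons,
      mul_smul_comm]⟩
  | swap x y l =>
    exact ⟨-1, by simp only [List.map_cons, List.prod_cons, ← mul_assoc];
                  rw [el_y3_mul_el_y3, smul_mul_assoc]⟩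
  | trans _ _ ih ih' =>
    obtain ⟨c, hc⟩ := ih
    obtain ⟨c', hc'⟩ := ih'
    exact ⟨c * c', by rw [hc, hc', mul_smul]⟩

theorem y3_prod_eq_zero [DecidableEq A] {xs : List A} (h : ¬xs.Nodup) :
    (xs.map (el y3)).prod = 0 := by
  induction xs with
  | nil => simp at h
  | cons x xs ih =>
    by_cases hx : x ∈ xs
    · obtain ⟨c, hc⟩ := y3_prod_perm (List.perm_cons_erase hx)
      rw [List.map_cons, List.prod_cons, hc, List.map_cons, List.prod_cons, mul_smul_comm,
        ← mul_assoc, el_y3_mul_self, zero_mul, smul_zero]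
    · rw [List.map_cons, List.prod_cons, ih fun h' => h (List.nodup_cons.2 ⟨hx, h'⟩), mul_zero]

/-- A weight computation: each x_{-3} lowers the eigenvalue of h_1 by one. -/
theorem IsWeylVector.h1_smul_mon_y3 (hw : IsWeylVector (A := A) m w) (xs : List A) :
    el h1 (1 : A) • mon w [] [] xs = ((m : ℂ) - xs.length) • mon w [] [] xs := by
  induction xs with
  | nil => rw [mon_nil, hw.h1_smul]; simp
  | cons x xs ih =>
    have h : el h1 (1 : A) * el y3 x = el y3 x * el h1 1 + (-1 : ℂ) • el y3 x := by
      rw [el_y3_mul_el_h1, mul_one, ← neg_eq_smul, add_neg_cancel_right]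
    rw [← y3_smul_mon, ← mul_smul, h, add_smul, mul_smul, ih, smul_assoc, smul_comm, ← add_smul]
    congr 1
    push_cast [List.length_cons]
    ring

/-- The vector `p(φ₁, φ₂, ξ) w`, where `ξ` is the increasing enumeration of a finite set. -/
def pvec {I : Type*} [LinearOrder I] (b : I → A) (w : M)
    (x : (I →₀ ℕ) × (I →₀ ℕ) × Finset I) : M :=
  p (x.1.mapDomain b) (x.2.1.mapDomain b) (fun k => b (x.2.2.orderEmbOfFin rfl k)) • w

/-- The total degree of a triple `(φ₁, φ₂, ξ)`. -/
def size {I : Type*} (x : (I →₀ ℕ) × (I →₀ ℕ) × Finset I) : ℕ :=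
  x.1.degree + x.2.1.degree + x.2.2.card

theorem Y3_smul {n : ℕ} (ξ : Fin n → A) : Y3 ξ • w = mon w [] [] (List.ofFn ξ) := by
  simp [Y3, mon, List.map_ofFn, Function.comp_def]

theorem ofFn_orderEmbOfFin {I : Type*} [LinearOrder I] (s : Finset I) :
    List.ofFn (s.orderEmbOfFin rfl) = s.sort := by
  rw [List.ofFn_eq_map]; exact s.listMap_orderEmbOfFin_finRange rfl

theorem pvec_eq {I : Type*} [LinearOrder I] (b : I → A) (w : M)
    (x : (I →₀ ℕ) × (I →₀ ℕ) × Finset I) : pvec b w x =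
      p1 (x.2.1.mapDomain b) (x.1.mapDomain b) • mon w [] [] (x.2.2.sort.map b) := by
  rw [pvec, p, mul_smul, Y3_smul, ← ofFn_orderEmbOfFin, List.map_ofFn]
  rfl

theorem el_smul_mem_of_basis {I : Type*} (b : Module.Basis I ℂ A) {N : Submodule ℂ M} {g : sl21}
    {y : M} (h : ∀ i, el g (b i) • y ∈ N) (a : A) : el g a • y ∈ N := by
  induction b.mem_span a using Submodule.span_induction with
  | mem x hx => obtain ⟨i, rfl⟩ := hx; exact h i
  | add x y _ _ hx hy => rw [el_add_right, add_smul]; exact add_mem hx hy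
  | zero => simp
  | smul c x _ hx => rw [el_smul_right, smul_assoc]; exact N.smul_mem c hx

/-- Monomials are multilinear in their labels, so basis labels suffice. Arbitrary subspaces are
needed because each stripped factor replaces `N` by a preimage. -/
theorem mon_mem_of_basis {I : Type*} (b : Module.Basis I ℂ A) {N : Submodule ℂ M} {k : ℕ}
    (h : ∀ ds cs xs : List I, ds.length + cs.length + xs.length ≤ k →
      mon w (ds.map b) (cs.map b) (xs.map b) ∈ N) : filt A w k ≤ N := by
  refine Submodule.span_le.2 ?_
  rintro _ ⟨ds, cs, xs, hl, rfl⟩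
  have hx : ∀ (xs : List A) (N : Submodule ℂ M),
      (∀ xs' : List I, xs'.length = xs.length → mon w [] [] (xs'.map b) ∈ N) →
      mon w [] [] xs ∈ N := by
    intro xs
    induction xs with
    | nil => intro N hN; exact hN [] rfl
    | cons x xs ih =>
      intro N hN
      rw [← y3_smul_mon]
      refine el_smul_mem_of_basis b (fun i => ?_) x
      refine ih (preim (el y3 (b i)) N) fun xs' hl => ?_
      rw [mem_preim, y3_smul_mon]
      exact hN (i :: xs') (by simpa using hl)
  have hc : ∀ (cs xs : List A) (N : Submodule ℂ M),
      (∀ cs' xs' : List I, cs'.length = cs.length → xs'.length = xs.length →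
        mon w [] (cs'.map b) (xs'.map b) ∈ N) → mon w [] cs xs ∈ N := by
    intro cs xs
    induction cs with
    | nil => intro N hN; exact hx xs N fun xs' hl => hN [] xs' rfl hl
    | cons c cs ih =>
      intro N hN
      rw [← h1_smul_mon]
      refine el_smul_mem_of_basis b (fun i => ?_) c
      refine ih (preim (el h1 (b i)) N) fun cs' xs' hl hl' => ?_
      rw [mem_preim, h1_smul_mon]
      exact hN (i :: cs') xs' (by simpa using hl) hl'
  have hd : ∀ (ds cs xs : List A) (N : Submodule ℂ M),
      (∀ ds' cs' xs' : List I, ds'.length = ds.length → cs'.length = cs.length →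
        xs'.length = xs.length → mon w (ds'.map b) (cs'.map b) (xs'.map b) ∈ N) →
      mon w ds cs xs ∈ N := by
    intro ds cs xs
    induction ds with
    | nil => intro N hN; exact hc cs xs N fun cs' xs' hl hl' => hN [] cs' xs' rfl hl hl'
    | cons d ds ih =>
      intro N hN
      rw [← y1_smul_mon]
      refine el_smul_mem_of_basis b (fun i => ?_) d
      refine ih (preim (el y1 (b i)) N) fun ds' cs' xs' hl hl' hl'' => ?_
      rw [mem_preim, y1_smul_mon]
      exact hN (i :: ds') cs' xs' (by simpa using hl) hl' hl''
  exact hd ds cs xs N fun ds' cs' xs' hl1 hl2 hl3 => h _ _ _ (by omega)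

theorem IsWeylVector.mon_append_one (hw : IsWeylVector (A := A) m w) (ds cs xs : List A) :
    mon w ds (cs ++ [1]) xs = ((m : ℂ) - xs.length) • mon w ds cs xs := by
  have h := hw.h1_smul_mon_y3 xs
  simp only [mon, List.map_nil, List.prod_nil, one_smul] at h ⊢
  rw [List.map_append, List.prod_append, mul_smul]
  simp only [List.map_cons, List.map_nil, List.prod_cons, List.prod_nil, mul_one]
  rw [h, smul_comm _ (_ - _ : ℂ), smul_comm _ (_ - _ : ℂ)]

/-- Among monomials with basis labels, an h_1 ⊗ 1 becomes a scalar, a repeated x_{-3} label gives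
zero, and sorting costs a scalar. The remaining ones are leading terms of p-vectors, so induction on
length applies. -/
theorem IsWeylVector.filt_le_span (hw : IsWeylVector (A := A) m w) {I : Type*} [LinearOrder I]
    (b : Module.Basis I ℂ A) {i₀ : I} (hi : b i₀ = 1) (k : ℕ) :
    filt A w k ≤ Submodule.span ℂ (pvec b w '' {x | x.1 i₀ = 0 ∧ size x ≤ k}) := by
  classical
  induction k using Nat.strong_induction_on with
  | _ k ih =>
  have hlow : ∀ l ≤ k, lower A w l ≤ Submodule.span ℂ (pvec b w '' {x | x.1 i₀ = 0 ∧ size x ≤ k}) := by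
    intro l hl
    cases l with
    | zero => exact bot_le
    | succ l =>
      refine (ih l (by omega)).trans (Submodule.span_mono (Set.image_mono ?_))
      exact fun x hx => ⟨hx.1, hx.2.trans (by omega)⟩
  refine mon_mem_of_basis b fun ds cs xs hl => ?_
  by_cases hc : i₀ ∈ cs
  · have hp : (cs.map b).Perm ((cs.erase i₀).map b ++ [1]) := by
      refine ((List.perm_cons_erase hc).map b).trans ?_
      rw [List.map_cons, hi]
      exact (List.perm_append_singleton _ _).symm
    have hpos := List.length_pos_of_mem hc
    rw [mon_perm (List.Perm.refl _) hp, hw.mon_append_one]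
    -- Removing the factor h_1 ⊗ 1 leaves a monomial of length at most k - 1.
    refine Submodule.smul_mem _ _ (hlow k le_rfl (filt_le_lower (k := k - 1) (by omega)
      (mon_mem_filt ?_)))
    simp only [List.length_map, List.length_erase_of_mem hc]
    omega
  by_cases hx : xs.Nodup
  swap
  · have h0 : mon w (ds.map b) (cs.map b) (xs.map b) = 0 := by
      have := y3_prod_eq_zero (xs := xs.map b) fun h => hx (List.Nodup.of_map _ h)
      rw [mon, this]; simp
    rw [h0]; exact zero_mem _
  have hperm : xs.Perm xs.toFinset.sort := by
    rw [List.perm_ext_iff_of_nodup hx (Finset.sort_nodup _ _)]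
    intro a; simp
  obtain ⟨c, hc'⟩ := y3_prod_perm (hperm.map b)
  have hmon : mon w (ds.map b) (cs.map b) (xs.map b) =
      c • mon w (ds.map b) (cs.map b) (xs.toFinset.sort.map b) := by
    unfold mon
    rw [hc', smul_assoc, smul_comm _ c, smul_comm _ c]
  have hlen : xs.toFinset.sort.length = xs.length := hperm.length_eq.symm
  rw [hmon]
  refine Submodule.smul_mem _ _ ?_
  have h := p1_smul_mon (w := w) _ (ds.map b) (cs.map b) (xs.toFinset.sort.map b) rfl
  simp only [List.length_map, hlen] at h
  have h1 := hlow _ hl h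
  have h2 : p1 (mult (ds.map b)) (mult (cs.map b)) • mon w [] [] (xs.toFinset.sort.map b) ∈
      Submodule.span ℂ (pvec b w '' {x | x.1 i₀ = 0 ∧ size x ≤ k}) := by
    refine Submodule.subset_span ⟨(mult cs, mult ds, xs.toFinset), ⟨?_, ?_⟩, ?_⟩
    · change mult cs i₀ = 0
      rw [← Finsupp.notMem_support_iff, ← Finsupp.mem_toMultiset, toMultiset_mult]
      simpa using hc
    · have := Finset.length_sort (s := xs.toFinset) (· ≤ ·)
      simp only [size, degree_mult]
      omega
    · rw [pvec_eq, mapDomain_mult, mapDomain_mult]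
  have h3 := (Submodule.sub_mem_iff_right _ h2).1 h1
  exact (Submodule.smul_mem_iff _ (mul_ne_zero (lead_ne_zero _) (lead_ne_zero _))).1 h3

end
end SuperWeyl
end

open scoped TensorProduct
noncomputable section
namespace SuperWeyl

/-! ### The action of `p_1(φ, χ)` on tensors -/

section
set_option linter.unusedSectionVars false
open Finset

/-- Lets the pair (φ, χ) be a single degree, so that one comultiplication lemma serves both
recursions. -/
instance prodHasAntidiagonal {G H : Type*} [AddMonoid G] [AddMonoid H] [HasAntidiagonal G]
    [HasAntidiagonal H] : HasAntidiagonal (G × H) where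
  antidiagonal x := (HasAntidiagonal.antidiagonal x.1 ×ˢ HasAntidiagonal.antidiagonal x.2).map
    (Equiv.prodProdProdComm G G H H).toEmbedding
  mem_antidiagonal := by
    rintro ⟨a, b⟩ ⟨⟨c, d⟩, ⟨e, f⟩⟩
    simp only [mem_map_equiv, mem_product, HasAntidiagonal.mem_antidiagonal]
    simp [Equiv.prodProdProdComm, Prod.ext_iff]

theorem sum_antidiagonal_prod {G H N : Type*} [AddMonoid G] [AddMonoid H] [HasAntidiagonal G]
    [HasAntidiagonal H] [AddCommMonoid N] (x : G × H) (F : G × H → G × H → N) :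
    ∑ q ∈ HasAntidiagonal.antidiagonal x, F q.1 q.2 =
      ∑ q ∈ HasAntidiagonal.antidiagonal x.1, ∑ r ∈ HasAntidiagonal.antidiagonal x.2,
        F (q.1, r.1) (q.2, r.2) := by
  change ∑ q ∈ (HasAntidiagonal.antidiagonal x.1 ×ˢ HasAntidiagonal.antidiagonal x.2).map _, _ = _
  rw [sum_map, sum_product]
  rfl

/-- Splitting off δ and distributing the rest with δ destined for slot j is the same as distributing
everything and then splitting the share of slot j. -/
theorem sum_piAntidiag_update {ι G N : Type*} [Fintype ι] [DecidableEq ι] [AddCommMonoid G]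
    [DecidableEq G] [HasAntidiagonal G] [AddCommMonoid N] (j : ι) (γ : G) (F : G → (ι → G) → N) :
    ∑ q ∈ HasAntidiagonal.antidiagonal γ, ∑ g ∈ piAntidiag univ q.2, F q.1 g =
      ∑ g ∈ piAntidiag univ γ, ∑ q ∈ HasAntidiagonal.antidiagonal (g j),
        F q.1 (Function.update g j q.2) := by
  rw [sum_sigma', sum_sigma']
  refine sum_bij'
    (fun (s : Σ _ : G × G, ι → G) _ =>
      (⟨Function.update s.2 j (s.1.1 + s.2 j), (s.1.1, s.2 j)⟩ : Σ _ : ι → G, G × G))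
    (fun (s : Σ _ : ι → G, G × G) _ =>
      (⟨(s.2.1, ∑ i, Function.update s.1 j s.2.2 i), Function.update s.1 j s.2.2⟩ :
        Σ _ : G × G, ι → G)) ?_ ?_ ?_ ?_ ?_
  · rintro ⟨q, g⟩ h
    simp only [mem_sigma, HasAntidiagonal.mem_antidiagonal, mem_piAntidiag] at h ⊢
    refine ⟨⟨?_, by simp⟩, by simp⟩
    rw [← h.1, ← h.2.1, sum_update_of_mem (mem_univ j), add_assoc,
      ← add_sum_erase univ g (mem_univ j), sdiff_singleton_eq_erase]
  · rintro ⟨g, q⟩ h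
    simp only [mem_sigma, HasAntidiagonal.mem_antidiagonal, mem_piAntidiag] at h ⊢
    refine ⟨?_, by simp⟩
    rw [← h.1.1, sum_update_of_mem (mem_univ j), ← add_assoc, h.2,
      ← add_sum_erase univ g (mem_univ j), sdiff_singleton_eq_erase]
  · rintro ⟨q, g⟩ h
    simp only [mem_sigma, mem_piAntidiag] at h
    simp [h.2.1]
  · rintro ⟨g, q⟩ h
    simp only [mem_sigma, HasAntidiagonal.mem_antidiagonal] at h
    simp [h.2]
  · rintro ⟨q, g⟩ h
    simp

variable (A : Type*) [CommRing A] [Algebra ℂ A]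

/-- The action of `U(sl(2,1) ⊗ A)` on `V ⊗ A`. -/
def natRep : U A →ₐ[ℂ] Module.End ℂ (VA A) :=
  RingQuot.liftAlgHom ℂ ⟨TensorAlgebra.lift ℂ (natAct A), by
    rintro _ _ ⟨e, f, x, y, hx, hy⟩
    simp only [map_mul, map_add, map_smul, TensorAlgebra.lift_ι_apply]
    exact natAct_bracket A hx hy⟩

theorem natRep_iota (x : MapAlg A) : natRep A (iota A x) = natAct A x := by
  simp [natRep, iota]

variable {A} {m : ℕ}

theorem slot_zero_tens (j : Fin m) (g : Module.End ℂ (VA A)) (w : Fin m → VA A) :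
    slot A m j 0 g (tens w) = tens (Function.update w j (g (w j))) := by
  rw [slot_eq, tmap_tens]
  congr 1
  funext i
  unfold slotFun
  by_cases hi : i = j
  · subst hi; simp
  · simp [Function.update_of_ne hi, signOp_zero]

theorem tensAct_even_tens {x : MapAlg A} (hx : x ∈ gr A 0) (w : Fin m → VA A) :
    tensAct A m x (tens w) = ∑ j, tens (Function.update w j (natAct A x (w j))) := by
  rw [tensAct_of_mem A m hx, LinearMap.sum_apply]
  exact sum_congr rfl fun j _ => slot_zero_tens j _ w

/-- The comultiplication formula for a family of elements of the enveloping algebra. -/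
def Comult {G : Type*} [AddCommMonoid G] [DecidableEq G] [HasAntidiagonal G] (m : ℕ) (Q : G → U A)
    (γ : G) : Prop :=
  ∀ w : Fin m → VA A, rep A m (Q γ) (tens w) =
    ∑ g ∈ piAntidiag univ γ, tens fun j => natRep A (Q (g j)) (w j)

/-- A derivation argument: the X(δ) are even Lie elements, hence act by the Leibniz rule without
signs, while L is additive over the shares of the slots. Both sides thus satisfy the same recursion,
and L(γ) can be cancelled when nonzero. The predicate `D` restricts to degrees closed under taking
summands. -/
theorem comult_of_recursion {G : Type*} [AddCommMonoid G] [DecidableEq G] [HasAntidiagonal G]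
    {Q : G → U A} (L : G →+ ℕ) (X : G → MapAlg A) (hX : ∀ δ, X δ ∈ gr A 0)
    (hX0 : ∀ δ, L δ = 0 → X δ = 0) (D : G → Prop) (hD : ∀ δ ε, D (δ + ε) → D δ ∧ D ε)
    (hQ : ∀ γ, D γ → (L γ : ℂ) • Q γ =
      ∑ q ∈ HasAntidiagonal.antidiagonal γ, iota A (X q.1) * Q q.2)
    (h0 : ∀ γ, D γ → L γ = 0 → Comult m Q γ) (γ : G) (hγ : D γ) : Comult m Q γ := by
  have main : ∀ n, ∀ γ, D γ → L γ = n → Comult m Q γ := by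
    intro n
    induction n using Nat.strong_induction_on with
    | _ n ih =>
    intro γ hγ hn w
    by_cases hn0 : n = 0
    · exact h0 γ hγ (hn.trans hn0) w
    have hL : (L γ : ℂ) ≠ 0 := by rw [hn]; exact Nat.cast_ne_zero.2 hn0
    refine smul_right_injective _ hL ?_
    dsimp only
    rw [← LinearMap.smul_apply, ← map_smul, hQ γ hγ, map_sum, LinearMap.sum_apply]
    have h1 : ∀ q ∈ HasAntidiagonal.antidiagonal γ, rep A m (iota A (X q.1) * Q q.2) (tens w) =
        ∑ j, ∑ g ∈ piAntidiag univ q.2, tens (Function.update (fun j => natRep A (Q (g j)) (w j)) j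
          (natAct A (X q.1) (natRep A (Q (g j)) (w j)))) := by
      intro q hq
      rw [HasAntidiagonal.mem_antidiagonal] at hq
      rw [map_mul, rep_iota, Module.End.mul_apply]
      by_cases hq0 : L q.1 = 0
      · rw [hX0 _ hq0, map_zero, map_zero, LinearMap.zero_apply]
        symm
        refine sum_eq_zero fun j _ => sum_eq_zero fun g _ => ?_
        rw [LinearMap.zero_apply, MultilinearMap.map_update_zero]
      · have hlt : L q.2 < n := by
          have := congrArg L hq
          rw [map_add] at this
          omega
        rw [ih _ hlt q.2 (hD q.1 q.2 (hq ▸ hγ)).2 rfl w, map_sum, sum_comm]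
        exact sum_congr rfl fun g _ => tensAct_even_tens (hX _) _
    rw [sum_congr rfl h1, sum_comm, smul_sum]
    have h2 : ∀ j : Fin m, ∑ q ∈ HasAntidiagonal.antidiagonal γ, ∑ g ∈ piAntidiag univ q.2,
        tens (Function.update (fun j => natRep A (Q (g j)) (w j)) j
          (natAct A (X q.1) (natRep A (Q (g j)) (w j)))) =
        ∑ g ∈ piAntidiag univ γ, (L (g j) : ℂ) • tens fun j => natRep A (Q (g j)) (w j) := by
      intro j
      rw [sum_piAntidiag_update j γ fun δ g =>
        tens (Function.update (fun j => natRep A (Q (g j)) (w j)) j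
          (natAct A (X δ) (natRep A (Q (g j)) (w j))))]
      refine sum_congr rfl fun g hg => ?_
      rw [mem_piAntidiag] at hg
      have hgD : D (g j) := by
        have : γ = g j + ∑ i ∈ univ.erase j, g i := by rw [add_sum_erase _ _ (mem_univ j), hg.1]
        rw [this] at hγ
        exact (hD _ _ hγ).1
      have h3 : ∀ q : G × G, (Function.update (fun k => natRep A (Q (Function.update g j q.2 k)) (w k)) j
          (natAct A (X q.1) (natRep A (Q (Function.update g j q.2 j)) (w j)))) =
          Function.update (fun k => natRep A (Q (g k)) (w k)) j
            (natRep A (iota A (X q.1) * Q q.2) (w j)) := by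
        intro q
        funext k
        by_cases hk : k = j
        · subst hk
          simp [natRep_iota]
        · simp [Function.update_of_ne hk]
      simp only [h3]
      rw [← MultilinearMap.map_update_sum, ← LinearMap.sum_apply, ← map_sum, ← hQ _ hgD, map_smul,
        LinearMap.smul_apply, MultilinearMap.map_update_smul]
      congr 2
      exact Function.update_eq_self j _
    rw [sum_congr rfl fun j _ => h2 j, sum_comm]
    refine sum_congr rfl fun g hg => ?_
    rw [← sum_smul, ← Nat.cast_sum, ← map_sum, (mem_piAntidiag.1 hg).1]
  exact main _ γ hγ rfl

theorem cartanGen_mem (ψ : A →₀ ℕ) : cartanGen ψ ∈ gr A 0 := by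
  unfold cartanGen
  split_ifs
  · exact zero_mem _
  · exact Submodule.smul_mem _ _ (isPar_h1.tmul_mem _)

theorem lowerGen_mem (δ ψ : A →₀ ℕ) : lowerGen δ ψ ∈ gr A 0 := by
  unfold lowerGen
  split_ifs
  · exact Submodule.smul_mem _ _ (isPar_y1.tmul_mem _)
  · exact zero_mem _

/-- The recursion lemma is used twice: on φ = 0 with L = |χ|, and then in general with L = |φ|, the
first result being the base case. -/
theorem rep_p1_tens [DecidableEq A] (φ χ : A →₀ ℕ) (w : Fin m → VA A) :
    rep A m (p1 φ χ) (tens w) = ∑ g ∈ piAntidiag univ (φ, χ),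
      tens fun j => natRep A (p1 (g j).1 (g j).2) (w j) := by
  let Q : (A →₀ ℕ) × (A →₀ ℕ) → U A := fun γ => p1 γ.1 γ.2
  have hzero : ∀ γ : (A →₀ ℕ) × (A →₀ ℕ), γ.1 = 0 → γ.2.degree = 0 → Comult m Q γ := by
    intro γ h1 h2 w
    have h3 : γ = 0 := Prod.ext h1 ((Finsupp.degree_eq_zero_iff _).1 h2)
    rw [h3]
    simp only [piAntidiag_zero, sum_singleton, Q, Prod.fst_zero, Prod.snd_zero, Pi.zero_apply,
      p1_zero_zero, map_one, Module.End.one_apply]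
  have hcartan : ∀ γ : (A →₀ ℕ) × (A →₀ ℕ), γ.1 = 0 → Comult m Q γ := by
    intro γ hγ
    refine comult_of_recursion (Finsupp.degree.comp (AddMonoidHom.snd _ _))
      (fun δ => cartanGen δ.2) (fun δ => cartanGen_mem _) ?_ (fun γ => γ.1 = 0)
      (fun δ ε h => add_eq_zero.1 h) ?_ hzero γ hγ
    · intro δ h; exact if_pos h
    rintro ⟨φ, χ⟩ rfl
    rw [sum_antidiagonal_prod (0, χ) fun δ ε => iota A (cartanGen δ.2) * Q ε]
    simpa using degree_smul_p1_zero χ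
  refine comult_of_recursion (Q := Q) (Finsupp.degree.comp (AddMonoidHom.fst _ _))
      (fun δ => lowerGen δ.1 δ.2) (fun δ => lowerGen_mem _ _)
      (fun δ h => if_neg (by change δ.1.degree = 0 at h; omega)) (fun _ => True)
      (fun δ ε _ => ⟨trivial, trivial⟩) ?_
      (fun γ _ h => hcartan γ ((Finsupp.degree_eq_zero_iff _).1 h)) (φ, χ) trivial w
  rintro ⟨φ, χ⟩ -
  rw [sum_antidiagonal_prod (φ, χ) fun δ ε => iota A (lowerGen δ.1 δ.2) * Q ε]
  exact degree_smul_p1 φ χ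

end
end SuperWeyl
end

open scoped TensorProduct
noncomputable section
namespace SuperWeyl

/-! ### The action of `p_1(φ, χ)` on `V ⊗ A` -/

section
set_option linter.unusedSectionVars false
open Finset
variable {A : Type*} [CommRing A] [Algebra ℂ A]

/-- The vector `v_{i+1} ⊗ a` of `V ⊗ A`. -/
def ev (i : Fin 3) : A →ₗ[ℂ] VA A := TensorProduct.mk ℂ (Fin 3 → ℂ) A (Pi.single i 1)

theorem ev_apply (i : Fin 3) (a : A) : ev i a = Pi.single i 1 ⊗ₜ[ℂ] a := rfl

theorem natAct_ev (X : sl21) (a : A) (i : Fin 3) (b : A) :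
    natAct A (X ⊗ₜ a) (ev i b) = ((X : Mat).col i) ⊗ₜ (a * b) := by
  rw [ev_apply, natAct_tmul, Matrix.mulVec_single_one]

theorem natAct_y1_zero (a b : A) : natAct A (y1 ⊗ₜ a) (ev 0 b) = ev 1 (a * b) := by
  rw [natAct_ev, ev_apply, coe_y1]; congr 1; ext i; fin_cases i <;> simp

theorem natAct_y1_one (a b : A) : natAct A (y1 ⊗ₜ a) (ev 1 b) = 0 := by
  rw [natAct_ev, coe_y1]
  refine (congrArg (· ⊗ₜ[ℂ] (a * b)) ?_).trans (TensorProduct.zero_tmul _ _)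
  ext i; fin_cases i <;> simp

theorem natAct_y1_two (a b : A) : natAct A (y1 ⊗ₜ a) (ev 2 b) = 0 := by
  rw [natAct_ev, coe_y1]
  refine (congrArg (· ⊗ₜ[ℂ] (a * b)) ?_).trans (TensorProduct.zero_tmul _ _)
  ext i; fin_cases i <;> simp

theorem natAct_h1_zero (a b : A) : natAct A (h1 ⊗ₜ a) (ev 0 b) = ev 0 (a * b) := by
  rw [natAct_ev, ev_apply, coe_h1]; congr 1; ext i; fin_cases i <;> simp

theorem natAct_h1_two (a b : A) : natAct A (h1 ⊗ₜ a) (ev 2 b) = 0 := by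
  rw [natAct_ev, coe_h1]
  refine (congrArg (· ⊗ₜ[ℂ] (a * b)) ?_).trans (TensorProduct.zero_tmul _ _)
  ext i; fin_cases i <;> simp

theorem natAct_y3_zero (a b : A) : natAct A (y3 ⊗ₜ a) (ev 0 b) = ev 2 (a * b) := by
  rw [natAct_ev, ev_apply, coe_y3]; congr 1; ext i; fin_cases i <;> simp

theorem natAct_y3_two (a b : A) : natAct A (y3 ⊗ₜ a) (ev 2 b) = 0 := by
  rw [natAct_ev, coe_y3]
  refine (congrArg (· ⊗ₜ[ℂ] (a * b)) ?_).trans (TensorProduct.zero_tmul _ _)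
  ext i; fin_cases i <;> simp

/-- The coefficients of the inverse `1 - s` of the geometric series `∑ M(ψ) π(ψ)`. -/
def invCoeff (χ : A →₀ ℕ) : A :=
  if χ.degree = 0 then 1 else if χ.degree = 1 then -piMul χ else 0

theorem piMul_add (φ ψ : A →₀ ℕ) : piMul (φ + ψ) = piMul φ * piMul ψ := by
  classical
  exact Finsupp.prod_add_index' (fun _ => pow_zero _) fun _ _ _ => pow_add _ _ _

/-- With s = ∑ a t_a, the multinomial theorem reads ∑ M(ψ) π(ψ) t^ψ = (1 - s)⁻¹; this is the
identity (1 - s)⁻¹ (1 - s) = 1 by coefficients. -/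
theorem sum_multinomial_mul_invCoeff [DecidableEq A] (χ : A →₀ ℕ) :
    ∑ q ∈ HasAntidiagonal.antidiagonal χ,
      (q.1.multinomial : ℂ) • (piMul q.1 * invCoeff q.2) = if χ = 0 then 1 else 0 := by
  by_cases h : χ = 0
  · subst h; simp [Finsupp.multinomial_eq, piMul, invCoeff]
  rw [if_neg h]
  -- Only second components of degree 0 or 1 contribute; Pascal's rule then makes the two
  -- contributions cancel.
  have h1 : ∀ q ∈ HasAntidiagonal.antidiagonal χ,
      (q.1.multinomial : ℂ) • (piMul q.1 * invCoeff q.2) =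
        (if q = (χ, 0) then (χ.multinomial : ℂ) • piMul χ else 0) +
          (if q.2.degree = 1 then -((q.1.multinomial : ℂ) • piMul χ) else 0) := by
    rintro ⟨a, c⟩ hq
    rw [HasAntidiagonal.mem_antidiagonal] at hq
    dsimp only at hq ⊢
    unfold invCoeff
    by_cases h0 : c.degree = 0
    · obtain rfl := (Finsupp.degree_eq_zero_iff c).1 h0
      rw [add_zero] at hq
      subst hq
      simp
    · have hc : (a, c) ≠ (χ, 0) := fun h' => h0 (by rw [show c = 0 from congrArg Prod.snd h', map_zero])
      rw [if_neg h0, if_neg hc, zero_add]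
      split_ifs
      · rw [mul_neg, ← piMul_add, hq, smul_neg]
      · rw [mul_zero, smul_zero]
  rw [sum_congr rfl h1, sum_add_distrib, sum_ite_eq' _ _ fun _ => (χ.multinomial : ℂ) • piMul χ,
    if_pos (by rw [HasAntidiagonal.mem_antidiagonal, add_zero])]
  rw [Finsupp.sum_antidiagonal_swap χ fun a c =>
      if c.degree = 1 then -((a.multinomial : ℂ) • piMul χ) else 0,
    sum_antidiagonal_degree_one χ fun _ ψ => -((ψ.multinomial : ℂ) • piMul χ),
    sum_neg_distrib, ← sum_smul, ← Nat.cast_sum, sum_multinomial_tsub h, add_neg_cancel]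

/-- On v_1 ⊗ A, h_1 ⊗ a multiplies by a, so the generating series F solves E F = (1 - (1 - s)⁻¹) F
with E the Euler operator and constant term 1. The solution is F = 1 - s. -/
theorem natRep_p1_zero_ev_zero (χ : A →₀ ℕ) :
    natRep A (p1 0 χ) (ev 0 1) = ev 0 (invCoeff χ) := by
  classical
  induction hn : χ.degree using Nat.strong_induction_on generalizing χ with
  | _ n ih =>
  by_cases hn0 : n = 0
  · obtain rfl := (Finsupp.degree_eq_zero_iff χ).1 (hn.trans hn0)
    simp [p1_zero_zero, invCoeff]
  refine smul_right_injective _ (Nat.cast_ne_zero.2 (hn ▸ hn0) : (χ.degree : ℂ) ≠ 0) ?_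
  dsimp only
  rw [← LinearMap.smul_apply, ← map_smul, degree_smul_p1_zero, map_sum, LinearMap.sum_apply]
  -- The full convolution with the geometric series also contains ψ = 0, absent from the recursion;
  -- the correction at q = (0, χ) compensates for it.
  have h1 : ∀ q ∈ HasAntidiagonal.antidiagonal χ,
      natRep A (iota A (cartanGen q.1) * p1 0 q.2) (ev 0 1) =
        ev 0 ((if q = (0, χ) then invCoeff χ else 0) -
          (q.1.multinomial : ℂ) • (piMul q.1 * invCoeff q.2)) := by
    rintro ⟨a, c⟩ hq
    rw [HasAntidiagonal.mem_antidiagonal] at hq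
    dsimp only at hq ⊢
    rw [map_mul, natRep_iota, Module.End.mul_apply]
    by_cases ha : a.degree = 0
    · obtain rfl := (Finsupp.degree_eq_zero_iff a).1 ha
      rw [zero_add] at hq
      subst hq
      simp [cartanGen, piMul_zero, Finsupp.multinomial_eq]
    · have hlt : c.degree < n := by
        rw [← hn, ← hq, map_add]; omega
      have hne : (a, c) ≠ (0, χ) := fun h' => ha (by rw [show a = 0 from congrArg Prod.fst h', map_zero])
      rw [ih _ hlt c rfl, cartanGen, if_neg ha, if_neg hne, map_smul, LinearMap.smul_apply,
        natAct_h1_zero, zero_sub, map_neg, map_smul, neg_smul]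
  rw [sum_congr rfl h1, ← map_sum, sum_sub_distrib, sum_multinomial_mul_invCoeff,
    sum_ite_eq' _ _ fun _ => invCoeff χ,
    if_pos (by rw [HasAntidiagonal.mem_antidiagonal, zero_add]),
    if_neg (fun h => hn0 (by rw [← hn, h, map_zero])), sub_zero, ← map_smul]
  congr 1
  unfold invCoeff
  rw [if_neg (by omega)]
  split_ifs with h
  · rw [h, Nat.cast_one, one_smul]
  · rw [smul_zero]

/-- For |φ| = 1 the sum over ψ is the geometric series times its inverse, leaving only χ = 0. For
|φ| ≥ 2 a second x_{-1} meets v_2 and gives zero. -/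
theorem natRep_p1_ev_zero [DecidableEq A] (φ χ : A →₀ ℕ) (hφ : φ ≠ 0) :
    natRep A (p1 φ χ) (ev 0 1) =
      if φ.degree = 1 ∧ χ = 0 then -ev 1 (piMul φ) else 0 := by
  induction hn : φ.degree using Nat.strong_induction_on generalizing φ χ with
  | _ n ih =>
  have hn0 : φ.degree ≠ 0 := fun h => hφ ((Finsupp.degree_eq_zero_iff φ).1 h)
  refine smul_right_injective _ (Nat.cast_ne_zero.2 hn0 : (φ.degree : ℂ) ≠ 0) ?_
  dsimp only
  rw [← LinearMap.smul_apply, ← map_smul, degree_smul_p1, map_sum, LinearMap.sum_apply]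
  by_cases h1 : n = 1
  · subst h1
    have hmem : (φ, (0 : A →₀ ℕ)) ∈ HasAntidiagonal.antidiagonal φ := by
      rw [HasAntidiagonal.mem_antidiagonal, add_zero]
    rw [sum_eq_single_of_mem _ hmem, map_sum, LinearMap.sum_apply]
    · have h2 : ∀ r ∈ HasAntidiagonal.antidiagonal χ,
          natRep A (iota A (lowerGen φ r.1) * p1 0 r.2) (ev 0 1) =
            -ev 1 (piMul φ * (r.1.multinomial : ℂ) • (piMul r.1 * invCoeff r.2)) := by
        intro r _
        rw [map_mul, natRep_iota, Module.End.mul_apply, natRep_p1_zero_ev_zero, lowerGen, if_pos hn,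
          map_smul, LinearMap.smul_apply, natAct_y1_zero, mul_assoc, mul_smul_comm, map_smul,
          neg_smul]
      dsimp only
      rw [sum_congr rfl h2, sum_neg_distrib, ← map_sum, ← mul_sum, sum_multinomial_mul_invCoeff,
        hn, Nat.cast_one, one_smul]
      split_ifs with h3 h4 h4
      · rw [mul_one]
      · exact absurd ⟨rfl, h3⟩ h4
      · exact absurd h4.2 h3
      · simp
    · rintro ⟨a, c⟩ hq hne
      rw [HasAntidiagonal.mem_antidiagonal] at hq
      dsimp only at hq ⊢
      have ha : a.degree ≠ 1 := by
        intro ha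
        refine hne ?_
        have hc : c.degree = 0 := by
          have := congrArg Finsupp.degree hq
          rw [map_add] at this; omega
        obtain rfl := (Finsupp.degree_eq_zero_iff c).1 hc
        rw [add_zero] at hq
        rw [hq]
      simp [lowerGen, ha]
  · rw [if_neg (fun h => h1 h.1), smul_zero]
    refine sum_eq_zero fun q hq => ?_
    rw [map_sum, LinearMap.sum_apply]
    refine sum_eq_zero fun r _ => ?_
    rw [HasAntidiagonal.mem_antidiagonal] at hq
    rw [map_mul, natRep_iota, Module.End.mul_apply, lowerGen]
    split_ifs with h2
    · have hq' : q.1.degree + q.2.degree = n := by rw [← hn, ← hq, map_add]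
      have hq2 : q.2 ≠ 0 := fun h => h1 (by rw [← hq', h, map_zero, h2, add_zero])
      rw [ih q.2.degree (by omega) q.2 r.2 hq2 rfl, map_smul, LinearMap.smul_apply]
      split_ifs
      · rw [map_neg, natAct_y1_one, neg_zero, smul_zero]
      · rw [map_zero, smul_zero]
    · rw [map_zero, LinearMap.zero_apply]

/-- Both h_1 and x_{-1} annihilate v_3. -/
theorem natRep_p1_ev_two [DecidableEq A] (φ χ : A →₀ ℕ) (a : A) :
    natRep A (p1 φ χ) (ev 2 a) = if φ = 0 ∧ χ = 0 then ev 2 a else 0 := by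
  induction hn : φ.degree + χ.degree using Nat.strong_induction_on generalizing φ χ with
  | _ n ih =>
  by_cases hφ : φ = 0
  · subst hφ
    by_cases hχ : χ = 0
    · subst hχ
      simp [p1_zero_zero]
    have hn0 : χ.degree ≠ 0 := fun h => hχ ((Finsupp.degree_eq_zero_iff χ).1 h)
    refine smul_right_injective _ (Nat.cast_ne_zero.2 hn0 : (χ.degree : ℂ) ≠ 0) ?_
    dsimp only
    rw [← LinearMap.smul_apply, ← map_smul, degree_smul_p1_zero, map_sum, LinearMap.sum_apply,
      if_neg (fun h => hχ h.2), smul_zero]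
    refine sum_eq_zero fun q hq => ?_
    rw [HasAntidiagonal.mem_antidiagonal] at hq
    rw [map_mul, natRep_iota, Module.End.mul_apply, cartanGen]
    split_ifs with h2
    · rw [map_zero, LinearMap.zero_apply]
    · have hq' : q.1.degree + q.2.degree = χ.degree := by rw [← hq, map_add]
      rw [map_zero, zero_add] at hn
      rw [ih q.2.degree (by omega) 0 q.2 (by simp), map_smul, LinearMap.smul_apply]
      split_ifs
      · rw [natAct_h1_two, smul_zero]
      · rw [map_zero, smul_zero]
  · have hn0 : φ.degree ≠ 0 := fun h => hφ ((Finsupp.degree_eq_zero_iff φ).1 h)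
    refine smul_right_injective _ (Nat.cast_ne_zero.2 hn0 : (φ.degree : ℂ) ≠ 0) ?_
    dsimp only
    rw [← LinearMap.smul_apply, ← map_smul, degree_smul_p1, map_sum, LinearMap.sum_apply,
      if_neg (fun h => hφ h.1), smul_zero]
    refine sum_eq_zero fun q hq => ?_
    rw [map_sum, LinearMap.sum_apply]
    refine sum_eq_zero fun r hr => ?_
    rw [HasAntidiagonal.mem_antidiagonal] at hq hr
    rw [map_mul, natRep_iota, Module.End.mul_apply, lowerGen]
    split_ifs with h2
    · have hq' : q.1.degree + q.2.degree = φ.degree := by rw [← hq, map_add]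
      have hr' : r.1.degree + r.2.degree = χ.degree := by rw [← hr, map_add]
      rw [ih _ (by omega) q.2 r.2 rfl, map_smul, LinearMap.smul_apply]
      split_ifs
      · rw [natAct_y1_two, smul_zero]
      · rw [map_zero, smul_zero]
    · rw [map_zero, LinearMap.zero_apply]

end
end SuperWeyl
end

open scoped TensorProduct
noncomputable section
namespace SuperWeyl

/-! ### The vectors `X_{-3}(ξ) v` -/

section
set_option linter.unusedSectionVars false
open Finset
variable {A : Type*} [CommRing A] [Algebra ℂ A] {m n : ℕ}

open Classical in
/-- The word with letter `v_3 ⊗ ξ(k)` at the position `J k` and letters `v_1 ⊗ 1` elsewhere. -/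
def word (ξ : Fin n → A) (J : Fin n ↪ Fin m) (j : Fin m) : VA A :=
  if h : ∃ k, J k = j then ev 2 (ξ h.choose) else ev 0 1

theorem word_apply (ξ : Fin n → A) (J : Fin n ↪ Fin m) (k : Fin n) :
    word ξ J (J k) = ev 2 (ξ k) := by
  have h : ∃ k', J k' = J k := ⟨k, rfl⟩
  rw [word, dif_pos h, J.injective h.choose_spec]

theorem word_of_notMem (ξ : Fin n → A) (J : Fin n ↪ Fin m) {j : Fin m} (h : j ∉ Set.range J) :
    word ξ J j = ev 0 1 := dif_neg h

theorem proj_ev (i : Fin 3) (a : A) : proj A (par i) (ev i a) = ev i a := by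
  rw [ev_apply, proj_tmul]
  congr 1
  ext j
  rw [vpart_apply]
  by_cases h : j = i
  · subst h; simp
  · simp [h]

open Classical in
theorem homog_word (ξ : Fin n → A) (J : Fin n ↪ Fin m) :
    Homog A (fun j => if j ∈ Set.range J then 1 else 0) (word ξ J) := by
  intro j
  dsimp only
  split_ifs with h
  · obtain ⟨k, rfl⟩ := h
    rw [word_apply]; exact proj_ev 2 _
  · rw [word_of_notMem ξ J h]; exact proj_ev 0 _

theorem sgn_ne_zero (e : ZMod 2) : sgn e ≠ 0 := by unfold sgn; split_ifs <;> simp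

/-- x_{-3} sends v_1 to v_3 and kills v_3, so it fills one free position. The Koszul signs enter
later only through their being nonzero. -/
theorem y3_smul_word (a : A) (ξ : Fin n → A) (J : Fin n ↪ Fin m) :
    ∃ c : Fin m → ℂ, (∀ j, c j ≠ 0) ∧ tensAct A m (y3 ⊗ₜ a) (tens (word ξ J)) =
      ∑ j : {j // j ∉ Set.range J}, c j • tens (Function.update (word ξ J) j (ev 2 a)) := by
  classical
  refine ⟨fun j => ∏ i, if i < j then sgn (1 * if i ∈ Set.range J then 1 else 0) else 1,
    fun j => prod_ne_zero_iff.2 fun i _ => ?_, ?_⟩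
  · split_ifs <;> first | exact sgn_ne_zero _ | exact one_ne_zero
  · rw [tensAct_of_mem A m (isPar_y3.tmul_mem a), LinearMap.sum_apply,
      ← Fintype.sum_subtype_add_sum_subtype (fun j => j ∈ Set.range J)]
    rw [sum_eq_zero, zero_add]
    · refine sum_congr rfl fun j _ => ?_
      rw [slot_tens A _ _ _ (homog_word ξ J), word_of_notMem ξ J j.2, natAct_y3_zero, mul_one]
    · rintro ⟨_, ⟨k, rfl⟩⟩ _
      rw [slot_tens A _ _ _ (homog_word ξ J), word_apply, natAct_y3_two,
        MultilinearMap.map_update_zero, smul_zero]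

theorem update_word (ξ : Fin (n + 1) → A) (J : Fin (n + 1) ↪ Fin m) :
    Function.update (word (fun k => ξ k.succ) (Equiv.embeddingFinSucc n (Fin m) J).1) (J 0)
      (ev 2 (ξ 0)) = word ξ J := by
  have hJ : ∀ k, (Equiv.embeddingFinSucc n (Fin m) J).1 k = J k.succ := fun k =>
    congrFun (Equiv.embeddingFinSucc_fst J) k
  funext j
  by_cases h0 : j = J 0
  · subst h0; rw [Function.update_self, word_apply]
  rw [Function.update_of_ne h0]
  by_cases h : j ∈ Set.range (Equiv.embeddingFinSucc n (Fin m) J).1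
  · obtain ⟨k, rfl⟩ := h
    rw [word_apply, hJ, word_apply]
  · rw [word_of_notMem _ _ h, word_of_notMem]
    rintro ⟨k, hk⟩
    cases k using Fin.cases with
    | zero => exact h0 hk.symm
    | succ k => exact h ⟨k, (hJ k).trans hk⟩

/-- Each successive x_{-3} picks a fresh position, so the terms are indexed by injections of the
factors into the slots. -/
theorem rep_Y3 (ξ : Fin n → A) : ∃ c : (Fin n ↪ Fin m) → ℂ, (∀ J, c J ≠ 0) ∧
    rep A m (Y3 ξ) (tens fun _ => ev 0 1) = ∑ J, c J • tens (word ξ J) := by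
  classical
  induction n with
  | zero =>
    refine ⟨fun _ => 1, fun _ => one_ne_zero, ?_⟩
    have h : ∀ J : Fin 0 ↪ Fin m, word ξ J = fun _ => ev 0 1 := fun J => by
      funext j; exact word_of_notMem ξ J (by rintro ⟨k, _⟩; exact k.elim0)
    rw [Fintype.sum_unique, h]
    simp [Y3]
  | succ n ih =>
    obtain ⟨c, hc, h⟩ := ih fun k => ξ k.succ
    choose d hd hd' using fun J : Fin n ↪ Fin m => y3_smul_word (ξ 0) (fun k => ξ k.succ) J
    refine ⟨fun J => c (Equiv.embeddingFinSucc n (Fin m) J).1 *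
      d (Equiv.embeddingFinSucc n (Fin m) J).1 (J 0), fun J => mul_ne_zero (hc _) (hd _ _), ?_⟩
    have hY : Y3 ξ = el y3 (ξ 0) * Y3 fun k => ξ k.succ := by
      simp [Y3, List.ofFn_succ]
    rw [hY, map_mul, Module.End.mul_apply, h, map_sum, el, rep_iota]
    simp only [map_smul, hd', smul_sum, smul_smul]
    -- An injection of n + 1 factors is an injection of the last n together with a position outside
    -- its range for the first.
    rw [← Fintype.sum_sigma', ← Equiv.sum_comp (Equiv.embeddingFinSucc n (Fin m))]
    refine sum_congr rfl fun J _ => ?_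
    rw [Equiv.embeddingFinSucc_snd, update_word]

/-! ### Coordinates of the vectors `p(φ₁, φ₂, ξ) v` -/

instance : IsScalarTower ℂ (U A) (T A m) :=
  ⟨fun c u t => by rw [smul_def, smul_def, map_smul]; rfl⟩

variable {I : Type*} (b : Module.Basis I ℂ A)

/-- The basis of `V ⊗ A`. -/
def basisVA : Module.Basis (Fin 3 × I) ℂ (VA A) := (Pi.basisFun ℂ (Fin 3)).tensorProduct b

theorem basisVA_apply (k : Fin 3 × I) : basisVA b k = ev k.1 (b k.2) := by
  rw [basisVA, Module.Basis.tensorProduct_apply, Pi.basisFun_apply]; rfl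

theorem basisVA_repr_ev (i : Fin 3) (a : A) (k : Fin 3 × I) :
    (basisVA b).repr (ev i a) k = if k.1 = i then b.repr a k.2 else 0 := by
  rw [basisVA, ev_apply, Module.Basis.tensorProduct_repr_tmul_apply, Pi.basisFun_repr,
    Pi.single_apply]
  split_ifs <;> simp

/-- The basis of `T^m(V ⊗ A)`. -/
def basisT (m : ℕ) : Module.Basis (Fin m → Fin 3 × I) ℂ (T A m) :=
  Basis.piTensorProduct fun _ => basisVA b

theorem basisT_apply (f : Fin m → Fin 3 × I) :
    basisT b m f = tens fun j => ev (f j).1 (b (f j).2) := by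
  simp only [← basisVA_apply]
  exact Basis.piTensorProduct_apply _ _

theorem basisT_repr_tens (w : Fin m → VA A) (f : Fin m → Fin 3 × I) :
    (basisT b m).repr (tens w) f = ∏ j, (basisVA b).repr (w j) (f j) :=
  Basis.piTensorProduct_repr_tprod_apply _ _ _

/-- The coordinate of the vector `p_1(γ) u`. -/
def slotCoord (γ : (A →₀ ℕ) × (A →₀ ℕ)) (u : VA A) (k : Fin 3 × I) : ℂ :=
  (basisVA b).repr (natRep A (p1 γ.1 γ.2) u) k

/-- This and the next three lemmas record which letters a slot can show, given the share of (φ₂, φ₁)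
that it received. -/
theorem slotCoord_two {γ : (A →₀ ℕ) × (A →₀ ℕ)} {i : I} {k : Fin 3 × I} :
    slotCoord b γ (ev 2 (b i)) k ≠ 0 ↔ γ = 0 ∧ k = (2, i) := by
  classical
  obtain ⟨φ, χ⟩ := γ
  obtain ⟨k, l⟩ := k
  rw [slotCoord, natRep_p1_ev_two]
  by_cases h : φ = 0 ∧ χ = 0
  · rw [if_pos h, basisVA_repr_ev, Module.Basis.repr_self, Finsupp.single_apply]
    obtain ⟨rfl, rfl⟩ := h
    simp [eq_comm, Prod.ext_iff]
  · rw [if_neg h]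
    simp only [map_zero, Finsupp.coe_zero, Pi.zero_apply, ne_eq, not_true_eq_false, false_iff]
    exact fun h' => h (Prod.ext_iff.1 h'.1)

theorem slotCoord_cartan {i : I} {k : Fin 3 × I} :
    slotCoord b (0, Finsupp.single (b i) 1) (ev 0 1) k ≠ 0 ↔ k = (0, i) := by
  classical
  obtain ⟨k, l⟩ := k
  simp only [slotCoord]
  rw [natRep_p1_zero_ev_zero, invCoeff, Finsupp.degree_single, if_neg one_ne_zero, if_pos rfl,
    piMul_single, basisVA_repr_ev, map_neg, Module.Basis.repr_self, Finsupp.neg_apply,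
    Finsupp.single_apply]
  simp [eq_comm]

theorem slotCoord_lower {i : I} {k : Fin 3 × I} :
    slotCoord b (Finsupp.single (b i) 1, 0) (ev 0 1) k ≠ 0 ↔ k = (1, i) := by
  classical
  obtain ⟨k, l⟩ := k
  simp only [slotCoord]
  rw [natRep_p1_ev_zero _ _ (by simp), Finsupp.degree_single, if_pos ⟨rfl, rfl⟩,
    piMul_single, map_neg, Finsupp.neg_apply, basisVA_repr_ev, Module.Basis.repr_self,
    Finsupp.single_apply]
  simp [eq_comm]

theorem slotCoord_zero {k : Fin 3 × I} :
    slotCoord b 0 (ev 0 1) k = if k.1 = 0 then b.repr 1 k.2 else 0 := by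
  rw [slotCoord]
  simp only [Prod.fst_zero, Prod.snd_zero]
  rw [natRep_p1_zero_ev_zero, invCoeff, map_zero, if_pos rfl, basisVA_repr_ev]

/-- A slot holding v_1 ⊗ 1 can absorb at most one element of the two multisets. -/
theorem degree_of_slotCoord_ne_zero {γ : (A →₀ ℕ) × (A →₀ ℕ)} {k : Fin 3 × I}
    (h : slotCoord b γ (ev 0 1) k ≠ 0) :
    γ = 0 ∨ (∃ a, γ = (0, Finsupp.single a 1)) ∨ ∃ a, γ = (Finsupp.single a 1, 0) := by
  classical
  obtain ⟨φ, χ⟩ := γ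
  simp only [slotCoord] at h
  by_cases hφ : φ = 0
  · subst hφ
    rw [natRep_p1_zero_ev_zero, invCoeff] at h
    split_ifs at h with h0 h1
    · left; rw [(Finsupp.degree_eq_zero_iff χ).1 h0]; rfl
    · obtain ⟨a, rfl⟩ := degree_eq_one_iff.1 h1
      exact Or.inr (Or.inl ⟨a, rfl⟩)
    · simp at h
  · rw [natRep_p1_ev_zero _ _ hφ] at h
    split_ifs at h with h0
    · obtain ⟨a, rfl⟩ := degree_eq_one_iff.1 h0.1
      exact Or.inr (Or.inr ⟨a, by rw [h0.2]⟩)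
    · simp at h

end
end SuperWeyl
end

open scoped TensorProduct
noncomputable section
namespace SuperWeyl

/-! ### The support of the vectors `p(φ₁, φ₂, ξ) v` -/

section
set_option linter.unusedSectionVars false
open Finset
variable {A : Type*} [CommRing A] [Algebra ℂ A] {m n : ℕ}
variable {I : Type*} [LinearOrder I] (b : Module.Basis I ℂ A)

variable (A) in
/-- The tensor `v_1 ⊗ ⋯ ⊗ v_1`. -/
def vtens (m : ℕ) : T A m := tens fun _ => ev 0 1

theorem repr_pvec [DecidableEq A] (x : (I →₀ ℕ) × (I →₀ ℕ) × Finset I) :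
    ∃ c : (Fin x.2.2.card ↪ Fin m) → ℂ, (∀ J, c J ≠ 0) ∧ ∀ f,
      (basisT b m).repr (pvec b (vtens A m) x) f = ∑ J, c J *
        ∑ g ∈ piAntidiag univ (x.2.1.mapDomain b, x.1.mapDomain b), ∏ j,
          slotCoord b (g j) (word (fun k => b (x.2.2.orderEmbOfFin rfl k)) J j) (f j) := by
  obtain ⟨c, hc, h⟩ := rep_Y3 (m := m) fun k => b (x.2.2.orderEmbOfFin rfl k)
  refine ⟨c, hc, fun f => ?_⟩
  rw [pvec, p, smul_def, map_mul, Module.End.mul_apply, vtens, h, map_sum, map_sum,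
    Finsupp.finsetSum_apply]
  refine sum_congr rfl fun J _ => ?_
  rw [map_smul, map_smul, Finsupp.smul_apply, smul_eq_mul, rep_p1_tens, map_sum,
    Finsupp.finsetSum_apply]
  simp only [basisT_repr_tens, slotCoord]

/-- A set `z` of indices of basis vectors to be disregarded, together with a triple: either `z` is
empty and the size is `m`, or `z` consists of the index of `1`. -/
def Adm (m : ℕ) (z : I → Prop) (x : (I →₀ ℕ) × (I →₀ ℕ) × Finset I) : Prop :=
  ((∀ i, ¬z i) ∧ size x = m) ∨ ∃ i₀, (∀ i, z i ↔ i = i₀) ∧ b i₀ = 1 ∧ x.1 i₀ = 0 ∧ size x ≤ m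

open Classical in
/-- The content of a basis vector of `V ⊗ A`. -/
def expected (z : I → Prop) (k : Fin 3 × I) : (A →₀ ℕ) × (A →₀ ℕ) :=
  if k.1 = 0 then (if z k.2 then 0 else (0, Finsupp.single (b k.2) 1))
  else if k.1 = 1 then (Finsupp.single (b k.2) 1, 0) else 0

open Classical in
/-- The content of a basis vector of `T^m(V ⊗ A)`. -/
def cont (z : I → Prop) (f : Fin m → Fin 3 × I) : (I →₀ ℕ) × (I →₀ ℕ) × Finset I :=
  (∑ j, if (f j).1 = 0 ∧ ¬z (f j).2 then Finsupp.single (f j).2 1 else 0,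
    ∑ j, if (f j).1 = 1 then Finsupp.single (f j).2 1 else 0,
    (univ.filter fun j => (f j).1 = 2).image fun j => (f j).2)

/-- No odd basis vector is repeated. -/
def OddInj (f : Fin m → Fin 3 × I) : Prop := ∀ j j', (f j).1 = 2 → f j = f j' → j = j'

theorem sum_expected (z : I → Prop) (f : Fin m → Fin 3 × I) :
    ∑ j, expected b z (f j) =
      ((cont z f).2.1.mapDomain b, (cont z f).1.mapDomain b) := by
  classical
  refine Prod.ext ?_ ?_
  · rw [Prod.fst_sum]
    simp only [cont, Finsupp.mapDomain_finsetSum]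
    refine sum_congr rfl fun j _ => ?_
    unfold expected
    by_cases h0 : (f j).1 = 0
    · simp only [h0, if_true, zero_ne_one, if_false]; split_ifs <;> simp
    · simp only [h0, if_false]; split_ifs <;> simp [Finsupp.mapDomain_single]
  · rw [Prod.snd_sum]
    simp only [cont, Finsupp.mapDomain_finsetSum]
    refine sum_congr rfl fun j _ => ?_
    unfold expected
    by_cases h0 : (f j).1 = 0
    · by_cases hz : z (f j).2 <;> simp [h0, hz, Finsupp.mapDomain_single]
    · simp only [h0, if_false, false_and]; split_ifs <;> simp

theorem exists_of_mapDomain_ne_zero {φ : I →₀ ℕ} {a : A} (h : φ.mapDomain b a ≠ 0) :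
    ∃ i, b i = a ∧ φ i ≠ 0 := by
  classical
  have h1 := Finsupp.mapDomain_support (Finsupp.mem_support_iff.2 h)
  obtain ⟨i, hi, rfl⟩ := mem_image.1 h1
  exact ⟨i, rfl, Finsupp.mem_support_iff.1 hi⟩

/-- A nonvanishing term is rigid: the letter shown in each slot determines the share which that slot
received, and the odd letters locate the positions `J`. -/
theorem term_support {z : I → Prop} {x : (I →₀ ℕ) × (I →₀ ℕ) × Finset I}
    (hx : Adm b m z x) {J : Fin x.2.2.card ↪ Fin m} {g : Fin m → (A →₀ ℕ) × (A →₀ ℕ)}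
    {f : Fin m → Fin 3 × I} (hg : ∑ j, g j = (x.2.1.mapDomain b, x.1.mapDomain b))
    (h : ∀ j, slotCoord b (g j) (word (fun k => b (x.2.2.orderEmbOfFin rfl k)) J j) (f j) ≠ 0) :
    (∀ k, f (J k) = (2, x.2.2.orderEmbOfFin rfl k)) ∧ (∀ j, j ∉ Set.range J → (f j).1 ≠ 2) ∧
      ∀ j, g j = expected b z (f j) := by
  classical
  have hJ : ∀ k, g (J k) = 0 ∧ f (J k) = (2, x.2.2.orderEmbOfFin rfl k) := fun k => by
    have := h (J k)
    rwa [word_apply, slotCoord_two] at this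
  have hN : ∀ j, j ∉ Set.range J → slotCoord b (g j) (ev 0 1) (f j) ≠ 0 := fun j hj => by
    have := h j
    rwa [word_of_notMem _ _ hj] at this
  have hle1 : ∀ j a, (g j).1 a ≤ x.2.1.mapDomain b a := fun j a => by
    have h1 := congrArg (fun q : (A →₀ ℕ) × (A →₀ ℕ) => q.1 a) hg
    simp only [Prod.fst_sum, Finsupp.finsetSum_apply] at h1
    rw [← h1]
    exact single_le_sum (f := fun j => (g j).1 a) (fun _ _ => Nat.zero_le _) (mem_univ j)
  have hle2 : ∀ j a, (g j).2 a ≤ x.1.mapDomain b a := fun j a => by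
    have h1 := congrArg (fun q : (A →₀ ℕ) × (A →₀ ℕ) => q.2 a) hg
    simp only [Prod.snd_sum, Finsupp.finsetSum_apply] at h1
    rw [← h1]
    exact single_le_sum (f := fun j => (g j).2 a) (fun _ _ => Nat.zero_le _) (mem_univ j)
  -- Every slot takes at most one unit, counting an x_{-3} as a unit. If the total is m, every slot
  -- takes exactly one, so no slot is left showing v_1 ⊗ 1 and it does not matter how 1 expands in
  -- the basis.
  have hfull : size x = m → ∀ j, j ∉ Set.range J → g j ≠ 0 := by
    intro hs j hj hgj
    let d : (A →₀ ℕ) × (A →₀ ℕ) → ℕ := fun γ => γ.1.degree + γ.2.degree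
    have hd1 : ∀ j, d (g j) + (if j ∈ Set.range J then 1 else 0) ≤ 1 := by
      intro j
      by_cases hj : j ∈ Set.range J
      · obtain ⟨k, rfl⟩ := hj
        rw [(hJ k).1]; simp [d]
      · rw [if_neg hj]
        rcases degree_of_slotCoord_ne_zero b (hN j hj) with h | ⟨a, h⟩ | ⟨a, h⟩ <;> simp [d, h]
    have hd2 : ∑ j, d (g j) = x.2.1.degree + x.1.degree := by
      have h1 : ∑ j, d (g j) = d (∑ j, g j) := by
        simp only [d, sum_add_distrib, Prod.fst_sum, Prod.snd_sum, map_sum]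
      rw [h1, hg]
      simp only [d, Finsupp.degree_mapDomain]
    have hd3 : ∑ j : Fin m, (if j ∈ Set.range J then 1 else 0) = x.2.2.card := by
      rw [← sum_filter, ← card_eq_sum_ones]
      have : univ.filter (fun j => j ∈ Set.range J) = univ.map J := by ext; simp
      rw [this, card_map, card_univ, Fintype.card_fin]
    have hd4 : ∑ j, (d (g j) + (if j ∈ Set.range J then 1 else 0)) = ∑ _j : Fin m, 1 := by
      rw [sum_add_distrib, hd2, hd3, sum_const, card_univ, Fintype.card_fin, smul_eq_mul, mul_one,
        ← hs, size]
      ring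
    have h5 := (sum_eq_sum_iff_of_le fun j _ => hd1 j).1 hd4 j (mem_univ j)
    rw [if_neg hj, hgj] at h5
    simp [d] at h5
  refine ⟨fun k => (hJ k).2, ?_, ?_⟩
  all_goals
    intro j
    try intro hj
  · rcases degree_of_slotCoord_ne_zero b (hN j hj) with h0 | ⟨a, h0⟩ | ⟨a, h0⟩
    · have h1 := hN j hj
      rw [h0, slotCoord_zero] at h1
      intro h2
      rw [if_neg (by rw [h2]; decide)] at h1
      exact h1 rfl
    · have h1 := hle2 j a
      rw [h0] at h1
      obtain ⟨i, rfl, hi⟩ := exists_of_mapDomain_ne_zero b (φ := x.1) (a := a) (by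
        simp at h1; omega)
      have h2 := hN j hj
      rw [h0, slotCoord_cartan] at h2
      rw [h2]; simp
    · have h1 := hle1 j a
      rw [h0] at h1
      obtain ⟨i, rfl, hi⟩ := exists_of_mapDomain_ne_zero b (φ := x.2.1) (a := a) (by
        simp at h1; omega)
      have h2 := hN j hj
      rw [h0, slotCoord_lower] at h2
      rw [h2]; simp
  by_cases hj : j ∈ Set.range J
  · obtain ⟨k, rfl⟩ := hj
    rw [(hJ k).1, (hJ k).2]
    simp [expected]
  rcases degree_of_slotCoord_ne_zero b (hN j hj) with h0 | ⟨a, h0⟩ | ⟨a, h0⟩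
  · have h1 := hN j hj
    rw [h0, slotCoord_zero] at h1
    rcases hx with ⟨_, hs⟩ | ⟨i₀, hz, hi, _, _⟩
    · exact absurd h0 (hfull hs j hj)
    -- A slot with no share still holds v_1 ⊗ 1 = v_1 ⊗ `b i₀`, whose only coordinate is at `i₀`.
    · split_ifs at h1 with h2
      · rw [← hi, Module.Basis.repr_self, Finsupp.single_apply] at h1
        have h3 : i₀ = (f j).2 := by
          by_contra h3
          rw [if_neg h3] at h1
          exact h1 rfl
        rw [h0, expected, if_pos h2, if_pos ((hz _).2 h3.symm)]
      · exact absurd rfl h1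
  · have h1 := hle2 j a
    rw [h0] at h1
    obtain ⟨i, rfl, hi⟩ := exists_of_mapDomain_ne_zero b (φ := x.1) (a := a) (by
      simp at h1; omega)
    have h2 := hN j hj
    rw [h0, slotCoord_cartan] at h2
    rw [h0, h2, expected, if_pos rfl, if_neg]
    -- A share labelled by `i₀` would show the same letter as an empty slot; admissibility excludes
    -- it by requiring `x.1 i₀ = 0`.
    intro hzi
    rcases hx with ⟨hz, _⟩ | ⟨i₀, hz, _, h3, _⟩
    · exact hz _ hzi
    · have h4 := (hz _).1 hzi
      exact hi (by rw [show i = i₀ from h4]; exact h3)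
  · have h1 := hle1 j a
    rw [h0] at h1
    obtain ⟨i, rfl, hi⟩ := exists_of_mapDomain_ne_zero b (φ := x.2.1) (a := a) (by
      simp at h1; omega)
    have h2 := hN j hj
    rw [h0, slotCoord_lower] at h2
    rw [h0, h2, expected, if_neg (by simp), if_pos rfl]

/-- For a word of the right content exactly one pair (`J`, `g`) contributes to the coordinate, so it
is a product of nonzero numbers and nothing can cancel. -/
theorem repr_pvec_ne_zero_iff {z : I → Prop}
    {x : (I →₀ ℕ) × (I →₀ ℕ) × Finset I} (hx : Adm b m z x) (f : Fin m → Fin 3 × I) :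
    (basisT b m).repr (pvec b (vtens A m) x) f ≠ 0 ↔ cont z f = x ∧ OddInj f := by
  classical
  obtain ⟨c, hc, h⟩ := repr_pvec (m := m) b x
  rw [h]
  have hbi : Function.Injective b := b.injective
  constructor
  · intro h0
    obtain ⟨J, _, hJ⟩ := exists_ne_zero_of_sum_ne_zero h0
    obtain ⟨g, hg, hJg⟩ := exists_ne_zero_of_sum_ne_zero (right_ne_zero_of_mul hJ)
    rw [mem_piAntidiag] at hg
    obtain ⟨h1, h2, h3⟩ := term_support b hx hg.1 fun j => prod_ne_zero_iff.1 hJg j (mem_univ j)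
    have hodd : ∀ j, (f j).1 = 2 → ∃ k, J k = j := fun j hj => by
      by_contra h4; exact h2 j h4 hj
    have h4 := sum_expected b z f
    rw [← sum_congr rfl fun j _ => h3 j, hg.1, Prod.ext_iff] at h4
    refine ⟨Prod.ext ?_ (Prod.ext ?_ ?_), ?_⟩
    · exact (Finsupp.mapDomain_injective hbi h4.2).symm
    · exact (Finsupp.mapDomain_injective hbi h4.1).symm
    · ext i
      simp only [cont, mem_image, mem_filter, mem_univ, true_and]
      constructor
      · rintro ⟨j, hj, rfl⟩
        obtain ⟨k, rfl⟩ := hodd j hj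
        rw [h1]; exact orderEmbOfFin_mem _ _ _
      · intro hi
        rw [← image_orderEmbOfFin_univ x.2.2 rfl, mem_image] at hi
        obtain ⟨k, _, rfl⟩ := hi
        exact ⟨J k, by rw [h1], by rw [h1]⟩
    · intro j j' hj hjj
      obtain ⟨k, rfl⟩ := hodd j hj
      obtain ⟨k', rfl⟩ := hodd j' (hjj ▸ hj)
      rw [h1, h1] at hjj
      rw [(x.2.2.orderEmbOfFin rfl).injective (congrArg Prod.snd hjj)]
  · rintro ⟨hcx, hodd⟩
    -- The positions of the odd letters of `f` reconstruct `J`, and `expected` reconstructs `g`.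
    have hex : ∀ k, ∃ j, f j = (2, x.2.2.orderEmbOfFin rfl k) := by
      intro k
      have h1 : x.2.2.orderEmbOfFin rfl k ∈ (cont z f).2.2 := by
        rw [hcx]; exact orderEmbOfFin_mem _ _ _
      simp only [cont, mem_image, mem_filter, mem_univ, true_and] at h1
      obtain ⟨j, hj, hj'⟩ := h1
      exact ⟨j, Prod.ext hj hj'⟩
    choose J₀ hJ₀ using hex
    have hJinj : Function.Injective J₀ := fun k k' hk => by
      have := hJ₀ k
      rw [hk, hJ₀] at this
      exact ((x.2.2.orderEmbOfFin rfl).injective (congrArg Prod.snd this)).symm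
    have hJ2 : ∀ j, (f j).1 = 2 → ∃ k, J₀ k = j := by
      intro j hj
      have h1 : (f j).2 ∈ x.2.2 := by
        rw [← hcx]
        simp only [cont, mem_image, mem_filter, mem_univ, true_and]
        exact ⟨j, hj, rfl⟩
      rw [← image_orderEmbOfFin_univ x.2.2 rfl, mem_image] at h1
      obtain ⟨k, _, hk⟩ := h1
      exact ⟨k, (hodd j _ hj (by rw [hJ₀, hk, ← hj])).symm⟩
    let J : Fin x.2.2.card ↪ Fin m := ⟨J₀, hJinj⟩
    let g : Fin m → (A →₀ ℕ) × (A →₀ ℕ) := fun j => expected b z (f j)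
    have hg : g ∈ piAntidiag univ (x.2.1.mapDomain b, x.1.mapDomain b) := by
      rw [mem_piAntidiag]
      refine ⟨?_, fun _ _ => mem_univ _⟩
      change ∑ j, expected b z (f j) = _
      rw [sum_expected, hcx]
    rw [sum_eq_single J, sum_eq_single g]
    · refine mul_ne_zero (hc J) (prod_ne_zero_iff.2 fun j _ => ?_)
      by_cases hj : j ∈ Set.range J
      · obtain ⟨k, rfl⟩ := hj
        have hk : f (J k) = (2, x.2.2.orderEmbOfFin rfl k) := hJ₀ k
        rw [word_apply, slotCoord_two]
        refine ⟨?_, hk⟩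
        simp only [g, hk, expected]
        simp
      · rw [word_of_notMem _ _ hj]
        have hj2 : (f j).1 ≠ 2 := fun h2 => hj (hJ2 j h2)
        simp only [g, expected]
        split_ifs with h0 hz h1
        · rw [slotCoord_zero, if_pos h0]
          rcases hx with ⟨hz', _⟩ | ⟨i₀, hz', hi, _, _⟩
          · exact absurd hz (hz' _)
          · rw [(hz' _).1 hz, ← hi, Module.Basis.repr_self]; simp
        · rw [slotCoord_cartan]; exact Prod.ext h0 rfl
        · rw [slotCoord_lower]; exact Prod.ext h1 rfl
        · generalize (f j).1 = k at h0 h1 hj2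
          fin_cases k <;> simp at *
    · intro g' hg' hne
      by_contra h0
      rw [mem_piAntidiag] at hg'
      obtain ⟨_, _, h3⟩ := term_support b hx hg'.1 fun j => prod_ne_zero_iff.1 h0 j (mem_univ j)
      exact hne (funext h3)
    · exact fun h' => absurd hg h'
    · intro J' _ hne
      by_contra h0
      obtain ⟨g', hg', hJg⟩ := exists_ne_zero_of_sum_ne_zero (right_ne_zero_of_mul h0)
      rw [mem_piAntidiag] at hg'
      obtain ⟨h1, _, _⟩ := term_support b hx hg'.1 fun j => prod_ne_zero_iff.1 hJg j (mem_univ j)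
      refine hne (DFunLike.ext _ _ fun k => hodd _ _ (by rw [h1]) ?_)
      rw [h1]; exact (hJ₀ k).symm
    · exact fun h' => absurd (mem_univ J) h'

end
end SuperWeyl
end

open scoped TensorProduct
noncomputable section
namespace SuperWeyl

/-! ### Linear independence of the vectors `p(φ₁, φ₂, ξ) v` -/

section
open Finset
variable {A : Type*} [CommRing A] [Algebra ℂ A] {m : ℕ}
variable {I : Type*} [LinearOrder I] (b : Module.Basis I ℂ A)

omit [LinearOrder I] in
theorem sum_map_eq_zero {α β : Type*} (l : List α) (g : α → β) (F : β → I →₀ ℕ)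
    (hF : ∀ a ∈ l, F (g a) = 0) : ((l.map g).map F).sum = 0 := by
  refine List.sum_eq_zero fun x hx => ?_
  simp only [List.mem_map] at hx
  obtain ⟨_, ⟨a, ha, rfl⟩, rfl⟩ := hx
  exact hF a ha

/-- The witness writes all letters in a row; the list `ps` pads with even letters that the content
disregards. -/
theorem exists_cont_of_lists (z : I → Prop) (s : Finset I) (ds cs ps : List I)
    (hcs : ∀ i ∈ cs, ¬z i) (hps : ∀ i ∈ ps, z i) :
    ∃ f : Fin (s.card + ds.length + cs.length + ps.length) → Fin 3 × I,
      cont z f = (mult cs, mult ds, s) ∧ OddInj f := by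
  classical
  let L : List (Fin 3 × I) := s.sort.map (fun i => ((2 : Fin 3), i)) ++
    (ds.map (fun i => ((1 : Fin 3), i)) ++
      (cs.map (fun i => ((0 : Fin 3), i)) ++ ps.map fun i => ((0 : Fin 3), i)))
  have hL : L.length = s.card + ds.length + cs.length + ps.length := by
    simp [L]; omega
  rw [← hL]
  have hmem : ∀ i, ((2 : Fin 3), i) ∈ L ↔ i ∈ s := by simp [L]
  refine ⟨fun j => L[j.1], Prod.ext ?_ (Prod.ext ?_ ?_), ?_⟩
  · simp only [cont]
    refine (Fin.sum_univ_fun_getElem L fun k => if k.1 = 0 ∧ ¬z k.2 then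
      Finsupp.single k.2 1 else 0).trans ?_
    simp only [L, List.map_append, List.sum_append]
    rw [sum_map_eq_zero, sum_map_eq_zero, sum_map_eq_zero ps]
    · rw [zero_add, zero_add, add_zero]
      simp only [mult, List.map_map, Function.comp_def, true_and]
      congr 1
      exact List.map_congr_left fun i hi => if_pos (hcs i hi)
    · exact fun a ha => if_neg fun h => h.2 (hps a ha)
    · exact fun a _ => if_neg fun h => absurd h.1 (by simp)
    · exact fun a _ => if_neg fun h => absurd h.1 (by simp)
  · simp only [cont]
    refine (Fin.sum_univ_fun_getElem L fun k => if k.1 = 1 then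
      Finsupp.single k.2 1 else 0).trans ?_
    simp only [L, List.map_append, List.sum_append]
    rw [sum_map_eq_zero, sum_map_eq_zero cs, sum_map_eq_zero ps]
    · rw [zero_add, add_zero, add_zero]
      simp [mult, Function.comp_def]
    · exact fun a _ => if_neg (by simp)
    · exact fun a _ => if_neg (by simp)
    · exact fun a _ => if_neg (by simp)
  · ext i
    simp only [cont, mem_image, mem_filter, mem_univ, true_and]
    rw [← hmem, List.mem_iff_get]
    exact ⟨fun ⟨j, h1, h2⟩ => ⟨j, Prod.ext h1 h2⟩, fun ⟨j, h⟩ => ⟨j, by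
      rw [List.get_eq_getElem] at h; rw [h], by rw [List.get_eq_getElem] at h; rw [h]⟩⟩
  · have hp : L.Pairwise fun k k' => k.1 = 2 → k ≠ k' := by
      simp only [L, List.pairwise_append, List.pairwise_map]
      have hs : s.sort.Nodup := s.sort_nodup _
      refine ⟨hs.imp fun h _ => by simpa using h, ⟨?_, ⟨?_, ?_, ?_⟩, ?_⟩, ?_⟩
      · exact List.pairwise_of_forall fun _ _ h => absurd h (by simp)
      · exact List.pairwise_of_forall fun _ _ h => absurd h (by simp)
      · exact List.pairwise_of_forall fun _ _ h => absurd h (by simp)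
      all_goals
        intro k hk k' hk'
        simp only [List.mem_map, List.mem_append] at hk hk'
        try
          obtain ⟨i, hi, rfl⟩ := hk
          simp
      rcases hk' with ⟨i', _, rfl⟩ | ⟨i', _, rfl⟩ | ⟨i', _, rfl⟩ <;> simp
    rw [List.pairwise_iff_get] at hp
    intro j j' h2 hjj
    rcases lt_trichotomy j j' with h | h | h
    · exact absurd hjj (hp j j' h h2)
    · exact h
    · exact absurd hjj.symm (hp j' j h (by
        exact (congrArg Prod.fst hjj).symm.trans h2))

theorem exists_cont {z : I → Prop} {x : (I →₀ ℕ) × (I →₀ ℕ) × Finset I} (hx : Adm b m z x) :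
    ∃ f : Fin m → Fin 3 × I, cont z f = x ∧ OddInj f := by
  obtain ⟨φ, χ, s⟩ := x
  obtain ⟨cs, rfl⟩ := exists_mult φ
  obtain ⟨ds, rfl⟩ := exists_mult χ
  rcases hx with ⟨hz, hs⟩ | ⟨i₀, hz, _, h0, hs⟩
  · obtain ⟨f, hf⟩ := exists_cont_of_lists z s ds cs [] (fun i _ => hz i) (by simp)
    have hm : s.card + ds.length + cs.length + ([] : List I).length = m := by
      rw [← hs]; simp only [size, degree_mult, List.length_nil]; ring
    subst hm
    exact ⟨f, hf⟩
  · have hcs : ∀ i ∈ cs, ¬z i := by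
      intro i hi hzi
      rw [hz] at hzi
      subst hzi
      obtain ⟨l, l', rfl⟩ := List.append_of_mem hi
      simp [mult] at h0
    simp only [size, degree_mult] at hs
    -- The word is padded with the letter v_1 ⊗ 1 up to length m.
    obtain ⟨f, hf⟩ := exists_cont_of_lists z s ds cs
      (List.replicate (m - (cs.length + ds.length + s.card)) i₀) hcs fun i hi => by
        rw [hz]; exact List.eq_of_mem_replicate hi
    have hm : s.card + ds.length + cs.length +
        (List.replicate (m - (cs.length + ds.length + s.card)) i₀).length = m := by
      rw [List.length_replicate]; omega
    generalize List.replicate (m - (cs.length + ds.length + s.card)) i₀ = l at f hf hm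
    subst hm
    exact ⟨f, hf⟩

/-- Different contents have disjoint supports, so a word of content `x i` isolates the i-th
coefficient. -/
theorem linearIndependent_pvec {ι : Type*} {z : I → Prop}
    {x : ι → (I →₀ ℕ) × (I →₀ ℕ) × Finset I} (hinj : Function.Injective x)
    (hx : ∀ i, Adm b m z (x i)) :
    LinearIndependent ℂ fun i => pvec b (vtens A m) (x i) := by
  choose f hf hodd using fun i => exists_cont b (hx i)
  refine linearIndependent_iff'.2 fun s c hc i hi => ?_
  have h1 := congrArg (fun t => (basisT b m).repr t (f i)) hc
  simp only [map_sum, map_smul, Finsupp.finsetSum_apply, Finsupp.smul_apply, map_zero,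
    Finsupp.coe_zero, Pi.zero_apply] at h1
  rw [sum_eq_single i, smul_eq_mul] at h1
  · exact (mul_eq_zero.1 h1).resolve_right
      ((repr_pvec_ne_zero_iff b (hx i) (f i)).2 ⟨hf i, hodd i⟩)
  · intro j _ hj
    by_contra h2
    have h3 := ((repr_pvec_ne_zero_iff b (hx j) (f i)).1 (right_ne_zero_of_mul h2)).1
    exact hj (hinj (h3.symm.trans (hf i)))
  · exact fun h => absurd hi h

end
end SuperWeyl
end

open scoped TensorProduct
noncomputable section
namespace SuperWeyl

/-! ### The supersymmetrizer -/

section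
open Finset Equiv

/-- Passes to unordered pairs, where inversions of a composite permutation can be compared pair by
pair. -/
theorem prod_pairs {m : ℕ} (G : Fin m × Fin m → ℂ) (h : ∀ i, G (i, i) = 1) :
    ∏ p, G p = ∏ p : Fin m × Fin m, if p.1 < p.2 then G p * G p.swap else 1 := by
  have h1 : ∏ p : Fin m × Fin m, (if p.1 < p.2 then G p.swap else 1) =
      ∏ p : Fin m × Fin m, if p.2 < p.1 then G p else 1 :=
    Equiv.prod_comp (Equiv.prodComm (Fin m) (Fin m))
      (fun p : Fin m × Fin m => if p.2 < p.1 then G p else 1)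
  have h2 : ∀ p : Fin m × Fin m, (if p.1 < p.2 then G p * G p.swap else 1) =
      (if p.1 < p.2 then G p else 1) * if p.1 < p.2 then G p.swap else 1 := fun p => by
    split_ifs <;> simp
  simp only [h2]
  rw [prod_mul_distrib, h1, ← prod_mul_distrib]
  refine prod_congr rfl fun p _ => ?_
  rcases lt_trichotomy p.1 p.2 with h' | h' | h'
  · rw [if_pos h', if_neg h'.not_gt, mul_one]
  · obtain ⟨i, j⟩ := p
    dsimp only at h'
    subst h'
    simp [h]
  · rw [if_neg h'.not_gt, if_pos h', one_mul]

/-- The cocycle rule: a pair is inverted by the composite exactly when one, and not both, of the two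
factors inverts it. -/
theorem gam_mul {m : ℕ} (ε : Fin m → ZMod 2) (σ τ : Perm (Fin m)) :
    gam ε (σ * τ) = gam ε σ * gam (ε ∘ σ) τ := by
  have h1 : gam ε σ = ∏ p : Fin m × Fin m,
      if τ p.1 < τ p.2 ∧ σ (τ p.2) < σ (τ p.1) then
        sgn (ε (σ (τ p.1)) * ε (σ (τ p.2))) else 1 := by
    rw [gam, ← Equiv.prod_comp (Equiv.prodCongr τ τ)]; rfl
  rw [h1, prod_pairs _ fun i => if_neg fun h => lt_irrefl _ h.1, gam, gam, ← prod_mul_distrib]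
  refine prod_congr rfl fun p _ => ?_
  obtain ⟨i, j⟩ := p
  simp only [Perm.mul_apply, Function.comp_apply, Prod.swap]
  rw [mul_comm (ε (σ (τ j)))]
  by_cases hij : i < j
  · have hτ : τ i ≠ τ j := τ.injective.ne hij.ne
    have hσ : σ (τ i) ≠ σ (τ j) := σ.injective.ne hτ
    rcases lt_or_gt_of_ne hτ with h | h <;> rcases lt_or_gt_of_ne hσ with h' | h' <;>
      simp [hij, h, h', h.not_gt, h'.not_gt, sgn_mul_self]
  · simp [hij]

theorem gam_one {m : ℕ} (ε : Fin m → ZMod 2) : gam ε 1 = 1 :=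
  prod_eq_one fun p _ => if_neg fun h => lt_asymm h.1 h.2

/-- The exchange of the first two positions has a single inversion; every transposition is conjugate
to it, and the cocycle rule makes the conjugating signs cancel. -/
theorem gam_swap {m : ℕ} (ε : Fin m → ZMod 2) {i j : Fin m} (hij : i ≠ j) (hi : ε i = 1)
    (hj : ε j = 1) : gam ε (swap i j) = -1 := by
  have hm : 2 ≤ m := by
    have h1 := i.2
    have h2 := j.2
    have h3 : i.1 ≠ j.1 := fun h => hij (Fin.ext h)
    omega
  let a : Fin m := ⟨0, by omega⟩
  let c : Fin m := ⟨1, by omega⟩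
  have hac : a ≠ c := fun h => absurd (congrArg Fin.val h) (by simp [a, c])
  have key : ∀ ε : Fin m → ZMod 2, ε a = 1 → ε c = 1 → gam ε (swap a c) = -1 := by
    intro ε ha hc
    rw [gam, prod_eq_single (a, c)]
    · rw [if_pos, swap_apply_left, swap_apply_right, ha, hc]
      · simp [sgn]
      · dsimp only
        rw [swap_apply_left, swap_apply_right]
        exact ⟨by simp [a, c], by simp [a, c]⟩
    · rintro ⟨k, l⟩ _ hne
      refine if_neg ?_
      rintro ⟨h1, h2⟩
      dsimp only at h1 h2
      rw [swap_apply_def, swap_apply_def] at h2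
      have h0 : ¬(k = a ∧ l = c) := fun h => hne (Prod.ext h.1 h.2)
      simp only [Fin.lt_def, Fin.ext_iff, a, c] at h0 h1 h2
      split_ifs at h2 <;> simp at h2 <;> omega
    · exact fun h => absurd (mem_univ _) h
  -- Chosen to send the first two positions `a`, `c` to `i`, `j`.
  let π : Perm (Fin m) := swap a i * swap c (swap a i j)
  have hπa : π a = i := by
    simp only [π, Perm.mul_apply]
    rw [swap_apply_of_ne_of_ne hac, swap_apply_left]
    intro h
    have := congrArg (swap a i) h
    rw [swap_apply_left, swap_apply_self] at this
    exact hij this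
  have hπc : π c = j := by
    simp only [π, Perm.mul_apply]
    rw [swap_apply_left, swap_apply_self]
  have hconj : swap i j = π * (swap a c * π⁻¹) := by
    rw [← hπa, ← hπc, swap_apply_apply, mul_assoc]
  have hε : (ε ∘ π) ∘ swap a c = ε ∘ π := by
    funext k
    simp only [Function.comp_apply]
    by_cases hk : k = a
    · rw [hk, swap_apply_left, hπa, hπc, hi, hj]
    by_cases hk' : k = c
    · rw [hk', swap_apply_right, hπa, hπc, hi, hj]
    rw [swap_apply_of_ne_of_ne hk hk']
  rw [hconj, gam_mul ε π, gam_mul (ε ∘ π), hε, mul_left_comm, ← gam_mul, mul_inv_cancel, gam_one, mul_one]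
  exact key _ (by simp [hπa, hi]) (by simp [hπc, hj])

/-! ### Symmetrization of tensors. -/

variable (A : Type*) [CommRing A] [Algebra ℂ A] {m : ℕ}

/-- The order is reversed because `permInv` is the action of the inverse permutation. -/
theorem permInv_mul (σ τ : Perm (Fin m)) :
    permInv A (σ * τ) = permInv A τ * permInv A σ := by
  refine ext_homog A fun ε w hw => ?_
  rw [Module.End.mul_apply, permInv_tens A _ hw, permInv_tens A σ hw, map_smul,
    permInv_tens A τ (Homog.comp A σ hw), smul_smul, gam_mul]
  rfl

/-- The supersymmetrizer. -/
def symm (m : ℕ) : Module.End ℂ (T A m) := ∑ σ : Perm (Fin m), permInv A σ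

theorem symm_apply (t : T A m) : symm A m t = ∑ σ : Perm (Fin m), permInv A σ t := by
  rw [symm, LinearMap.sum_apply]

theorem symm_permInv (σ : Perm (Fin m)) (t : T A m) : symm A m (permInv A σ t) = symm A m t := by
  rw [symm_apply, symm_apply]
  simp only [← Module.End.mul_apply, ← permInv_mul]
  exact Equiv.sum_comp (Equiv.mulLeft σ) fun τ => permInv A τ t

theorem permInv_symm (σ : Perm (Fin m)) (t : T A m) : permInv A σ (symm A m t) = symm A m t := by
  simp only [symm_apply, map_sum, ← Module.End.mul_apply, ← permInv_mul]
  exact Equiv.sum_comp (Equiv.mulRight σ) fun τ => permInv A τ t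

/-- Supersymmetric tensors are fixed by every permutation, so the sum over the group multiplies them
by its order. -/
theorem symm_of_mem {t : T A m} (ht : t ∈ TSspan A m) : symm A m t = (m.factorial : ℂ) • t := by
  have h : ∀ σ : Perm (Fin m), permInv A σ t = t := by
    intro σ
    induction ht using Submodule.span_induction with
    | mem x hx =>
      obtain ⟨w, rfl⟩ := hx
      dsimp only
      rw [← symm_apply, permInv_symm]
    | zero => simp
    | add x y _ _ hx hy => rw [map_add, hx, hy]
    | smul c x _ hx => rw [map_smul, hx]
  rw [symm_apply]
  simp only [h, sum_const]
  rw [card_univ, Fintype.card_perm, Fintype.card_fin, ← Nat.cast_smul_eq_nsmul ℂ]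

variable {A}

theorem symm_comp (σ : Perm (Fin m)) {ε : Fin m → ZMod 2} {w : Fin m → VA A}
    (hw : Homog A ε w) : symm A m (tens w) = gam ε σ • symm A m (tens fun i => w (σ i)) := by
  rw [← symm_permInv A σ, permInv_tens A σ hw, map_smul]

/-- Exchanging two equal odd letters fixes the tensor but changes the sign of its symmetrization. -/
theorem symm_eq_zero {ε : Fin m → ZMod 2} {w : Fin m → VA A} (hw : Homog A ε w) {i j : Fin m}
    (hij : i ≠ j) (hi : ε i = 1) (hj : ε j = 1) (h : w i = w j) : symm A m (tens w) = 0 := by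
  have h1 := symm_comp (swap i j) hw
  have h2 : (fun k => w (swap i j k)) = w := by
    funext k
    by_cases hk : k = i
    · rw [hk, swap_apply_left, h]
    by_cases hk' : k = j
    · rw [hk', swap_apply_right, h]
    rw [swap_apply_of_ne_of_ne hk hk']
  rw [h2, gam_swap ε hij hi hj, neg_one_smul, eq_neg_iff_add_eq_zero, ← two_smul ℂ] at h1
  exact (smul_eq_zero.1 h1).resolve_left two_ne_zero

/-! ### Words with the same content. -/

variable {I : Type*} [LinearOrder I]

omit [LinearOrder I] in
theorem homog_basisT (b : I → A) (f : Fin m → Fin 3 × I) :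
    Homog A (fun j => par (f j).1) fun j => ev (f j).1 (b (f j).2) := fun _ => proj_ev _ _

theorem cont_fst_apply (f : Fin m → Fin 3 × I) (i : I) :
    (cont (fun _ => False) f).1 i = Fintype.card {j // f j = (0, i)} := by
  classical
  rw [Fintype.card_subtype, card_eq_sum_ones, sum_filter]
  simp only [cont, Finsupp.finsetSum_apply, not_false_iff, and_true]
  refine sum_congr rfl fun j _ => ?_
  by_cases h : (f j).1 = 0 <;> simp [h, Finsupp.single_apply, Prod.ext_iff]

theorem cont_snd_apply (f : Fin m → Fin 3 × I) (i : I) :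
    (cont (fun _ => False) f).2.1 i = Fintype.card {j // f j = (1, i)} := by
  classical
  rw [Fintype.card_subtype, card_eq_sum_ones, sum_filter]
  simp only [cont, Finsupp.finsetSum_apply]
  refine sum_congr rfl fun j _ => ?_
  by_cases h : (f j).1 = 1 <;> simp [h, Finsupp.single_apply, Prod.ext_iff]

theorem OddInj.card_fiber {f : Fin m → Fin 3 × I} (hf : OddInj f) (z : I → Prop) (i : I) :
    Fintype.card {j // f j = (2, i)} = if i ∈ (cont z f).2.2 then 1 else 0 := by
  classical
  have hmem : i ∈ (cont z f).2.2 ↔ ∃ j, f j = (2, i) := by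
    simp [cont, Prod.ext_iff]
  split_ifs with h
  · obtain ⟨j, hj⟩ := hmem.1 h
    rw [Fintype.card_eq_one_iff]
    exact ⟨⟨j, hj⟩, fun ⟨j', hj'⟩ => Subtype.ext (hf j' j (by rw [hj']) (hj'.trans hj.symm))⟩
  · rw [Fintype.card_eq_zero_iff]
    exact ⟨fun ⟨j, hj⟩ => h (hmem.2 ⟨j, hj⟩)⟩

/-- Content records how often each letter occurs, odd letters occurring at most once; equal letter
counts mean that the words are rearrangements of each other. -/
theorem exists_perm {f g : Fin m → Fin 3 × I} (hf : OddInj f) (hg : OddInj g)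
    (h : cont (fun _ => False) g = cont (fun _ => False) f) :
    ∃ σ : Perm (Fin m), ∀ j, f (σ j) = g j := by
  have hcard : ∀ k, Fintype.card {j // g j = k} = Fintype.card {j // f j = k} := by
    rintro ⟨k, i⟩
    fin_cases k
    · exact (cont_fst_apply g i).symm.trans (h ▸ cont_fst_apply f i)
    · exact (cont_snd_apply g i).symm.trans (h ▸ cont_snd_apply f i)
    · exact (hg.card_fiber (fun _ => False) i).trans (h ▸ (hf.card_fiber _ i).symm)
  exact ⟨Equiv.ofFiberEquiv fun k => Fintype.equivOfCardEq (hcard k), fun j =>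
    Equiv.ofFiberEquiv_map _ j⟩

/-- With nothing disregarded each letter is counted once; the finset of odd labels loses no
multiplicity because odd letters are distinct. -/
theorem OddInj.size_cont {f : Fin m → Fin 3 × I} (hf : OddInj f) :
    size (cont (fun _ => False) f) = m := by
  classical
  have h3 : (cont (fun _ => False) f).2.2.card = ∑ j, if (f j).1 = 2 then 1 else 0 := by
    rw [← sum_filter, ← card_eq_sum_ones]
    refine card_image_of_injOn fun j hj j' hj' h => ?_
    have h1 : (f j).1 = 2 := by simpa using hj
    have h2 : (f j').1 = 2 := by simpa using hj'
    exact hf j j' h1 (Prod.ext (h1.trans h2.symm) h)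
  rw [size, h3]
  simp only [cont, map_sum, not_false_iff, and_true]
  rw [← sum_add_distrib, ← sum_add_distrib]
  refine (sum_congr rfl fun j _ => ?_).trans (Fin.sum_const m 1) |>.trans (by simp)
  generalize f j = k
  obtain ⟨k, i⟩ := k
  fin_cases k <;> simp

/-- Let t be the p-vector with the content of a word f without repeated odd letters. Its support
consists of rearrangements of f, so its symmetrization is c times that of f. It also equals m! t,
and t ≠ 0, hence c ≠ 0. -/
theorem TSspan_le (b : Module.Basis I ℂ A) :
    TSspan A m ≤ Submodule.span ℂ (pvec b (vtens A m) '' {x | size x = m}) := by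
  classical
  set N := Submodule.span ℂ (pvec b (vtens A m) '' {x | size x = m})
  have key : ∀ f, symm A m (basisT b m f) ∈ N := by
    intro f
    rw [basisT_apply]
    by_cases hf : OddInj f
    swap
    · simp only [OddInj, not_forall] at hf
      obtain ⟨j, j', hj, hjj, hne⟩ := hf
      rw [symm_eq_zero (homog_basisT b f) hne (by simp [hj, par])
        (by simp [← hjj, hj, par]) (by rw [hjj])]
      exact zero_mem _
    have hx : Adm b m (fun _ => False) (cont (fun _ => False) f) :=
      Or.inl ⟨fun _ => id, hf.size_cont⟩
    set t := pvec b (vtens A m) (cont (fun _ => False) f) with ht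
    have hft : (basisT b m).repr t f ≠ 0 := (repr_pvec_ne_zero_iff b hx f).2 ⟨rfl, hf⟩
    have htS : t ∈ TSspan A m := (TS A m).smul_mem _ (v1_pow_mem A m)
    -- Every basis tensor occurring in t is a rearrangement of f, so its symmetrization is that of f
    -- up to sign.
    have h1 : ∃ c : ℂ, c • symm A m (tens fun j => ev (f j).1 (b (f j).2)) = symm A m t := by
      rw [← Submodule.mem_span_singleton, ← Module.Basis.linearCombination_repr (basisT b m) t,
        Finsupp.linearCombination_apply, Finsupp.sum, map_sum]
      refine sum_mem fun g hg => ?_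
      rw [map_smul]
      refine Submodule.smul_mem _ _ ?_
      obtain ⟨hg1, hg2⟩ := (repr_pvec_ne_zero_iff b hx g).1 (Finsupp.mem_support_iff.1 hg)
      obtain ⟨σ, hσ⟩ := exists_perm hf hg2 hg1
      have h2 := symm_comp σ (homog_basisT b f)
      simp only [hσ] at h2
      rw [basisT_apply, h2]
      refine (Submodule.smul_mem_iff _ (s := gam (fun j => par (f j).1) σ) ?_).1
        (Submodule.mem_span_singleton_self _)
      refine prod_ne_zero_iff.2 fun p _ => ?_
      split_ifs
      · exact sgn_ne_zero _
      · exact one_ne_zero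
    obtain ⟨c, hc⟩ := h1
    rw [symm_of_mem A htS] at hc
    have hm : (m.factorial : ℂ) ≠ 0 := Nat.cast_ne_zero.2 (Nat.factorial_ne_zero m)
    have hc0 : c ≠ 0 := by
      rintro rfl
      rw [zero_smul] at hc
      have ht0 := (smul_eq_zero.1 hc.symm).resolve_left hm
      rw [ht0] at hft
      simp at hft
    rw [← Submodule.smul_mem_iff _ hc0, hc]
    exact Submodule.smul_mem _ _ (Submodule.subset_span ⟨_, hf.size_cont, rfl⟩)
  refine Submodule.span_le.2 ?_
  rintro _ ⟨w, rfl⟩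
  change ∑ σ : Perm (Fin m), permInv A σ (tens w) ∈ N
  rw [← symm_apply]
  have h : (⊤ : Submodule ℂ (T A m)) ≤ N.comap (symm A m) := by
    rw [← (basisT b m).span_eq, Submodule.span_le]
    rintro _ ⟨f, rfl⟩
    exact key f
  exact h Submodule.mem_top

end
end SuperWeyl
end

open scoped TensorProduct
noncomputable section
namespace SuperWeyl

/-! ### The isomorphism with the supersymmetric tensors -/

section
open Finset
variable {A : Type*} [CommRing A] [Algebra ℂ A] {m : ℕ}

theorem smul_wbar (u : U A) : u • wbar A m 0 = Submodule.Quotient.mk u := by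
  rw [wbar, ← Submodule.Quotient.mk_smul, smul_eq_mul, mul_one]

theorem relator_smul_wbar {u : U A} (hu : IsWeylRelator A m 0 u) : u • wbar A m 0 = 0 := by
  rw [smul_wbar, Submodule.Quotient.mk_eq_zero]
  exact Submodule.subset_span hu

theorem isWeylVector_wbar : IsWeylVector (A := A) m (wbar A m 0) where
  x1_smul a := relator_smul_wbar (.pos x1 (Submodule.subset_span (by simp)) a)
  x2_smul a := relator_smul_wbar (.pos x2 (Submodule.subset_span (by simp)) a)
  x3_smul a := relator_smul_wbar (.pos x3 (Submodule.subset_span (by simp)) a)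
  y2_smul a := by
    -- For l = 0 the product of l + 1 odd lowering elements is a single factor.
    have h := relator_smul_wbar (A := A) (m := m) (.odd fun _ => a)
    simpa [Y2] using h
  h1_smul := by
    have h := relator_smul_wbar (A := A) (m := m) (.cartan 1 0)
    rw [sub_smul, sub_eq_zero, algebraMap_smul] at h
    simpa using h
  y1_pow := relator_smul_wbar .neg

theorem IsWeylVector.relator_smul {M : Type*} [AddCommGroup M] [Module ℂ M] [Module (U A) M]
    [IsScalarTower ℂ (U A) M] {w : M} (hw : IsWeylVector (A := A) m w) {u : U A}
    (hu : IsWeylRelator A m 0 u) : u • w = 0 := by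
  cases hu with
  | pos x hx a =>
    induction hx using Submodule.span_induction with
    | mem x hx =>
      rcases hx with rfl | rfl | rfl
      · exact hw.x1_smul a
      · exact hw.x2_smul a
      · exact hw.x3_smul a
    | zero => rw [el_zero_left, zero_smul]
    | add x y _ _ hx hy => rw [el_add_left, add_smul, hx, hy, add_zero]
    | smul c x _ hx => rw [el_smul_left, smul_assoc, hx, smul_zero]
  | cartan c₁ c₂ =>
    rw [sub_smul, sub_eq_zero, algebraMap_smul, el_add_left, el_smul_left, el_smul_left, add_smul,
      smul_assoc, smul_assoc, hw.h1_smul, hw.h2_smul, smul_zero, add_zero, smul_smul]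
    simp
  | neg => exact hw.y1_pow
  | odd ξ => simpa [Y2] using hw.y2_smul (ξ 0)

theorem el_smul_vtens_eq_zero {g : sl21} {e : ZMod 2} {a : A} (hg : g ⊗ₜ[ℂ] a ∈ gr A e)
    (h : natAct A (g ⊗ₜ a) (ev 0 1) = 0) : el g a • vtens A m = 0 := by
  rw [smul_def, el, rep_iota, tensAct_of_mem A m hg, LinearMap.sum_apply]
  refine sum_eq_zero fun j _ => ?_
  have hw : Homog A (fun _ : Fin m => par 0) fun _ => ev 0 1 := fun _ => proj_ev 0 _
  rw [vtens, slot_tens A j e _ hw, h, MultilinearMap.map_update_zero, smul_zero]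

/-- Each x_{-1} ⊗ 1 turns one v_1 into v_2 and kills v_2; `s` is the set of positions already used,
and m positions cannot supply more than m steps. -/
theorem y1_pow_smul_tens [DecidableEq (Fin m)] (k : ℕ) (s : Finset (Fin m)) (h : m < k + s.card) :
    el y1 (1 : A) ^ k • (tens fun j => if j ∈ s then ev 1 1 else ev 0 1 : T A m) = 0 := by
  induction k generalizing s with
  | zero =>
    have := s.card_le_univ
    rw [Fintype.card_fin] at this
    omega
  | succ k ih =>
    rw [pow_succ, mul_smul, smul_def (u := el y1 1), el, rep_iota,
      tensAct_even_tens (isPar_y1.tmul_mem _), smul_sum]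
    refine sum_eq_zero fun j _ => ?_
    by_cases hj : j ∈ s
    · rw [if_pos hj, natAct_y1_one, MultilinearMap.map_update_zero, smul_zero]
    · rw [if_neg hj, natAct_y1_zero, mul_one, ← ih (insert j s) (by
        rw [card_insert_of_notMem hj]; omega)]
      congr 2
      funext i
      by_cases hi : i = j
      · subst hi; simp
      · simp [hi]

theorem isWeylVector_vtens : IsWeylVector (A := A) m (vtens A m) where
  x1_smul a := el_smul_vtens_eq_zero (isPar_x1.tmul_mem a) (by
    rw [natAct_ev, show ((x1 : sl21) : Mat).col 0 = 0 by ext i; rw [coe_x1]; fin_cases i <;> simp,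
      TensorProduct.zero_tmul])
  x2_smul a := el_smul_vtens_eq_zero (isPar_x2.tmul_mem a) (by
    rw [natAct_ev, show ((x2 : sl21) : Mat).col 0 = 0 by ext i; rw [coe_x2]; fin_cases i <;> simp,
      TensorProduct.zero_tmul])
  x3_smul a := el_smul_vtens_eq_zero (isPar_x3.tmul_mem a) (by
    rw [natAct_ev, show ((x3 : sl21) : Mat).col 0 = 0 by ext i; rw [coe_x3]; fin_cases i <;> simp,
      TensorProduct.zero_tmul])
  y2_smul a := el_smul_vtens_eq_zero (isPar_y2.tmul_mem a) (by
    rw [natAct_ev, show ((y2 : sl21) : Mat).col 0 = 0 by ext i; rw [coe_y2]; fin_cases i <;> simp,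
      TensorProduct.zero_tmul])
  h1_smul := by
    rw [smul_def, el, rep_iota, vtens, tensAct_even_tens (isPar_h1.tmul_mem _)]
    simp only [natAct_h1_zero, mul_one, Function.update_eq_self, sum_const, card_univ,
      Fintype.card_fin]
    rw [← Nat.cast_smul_eq_nsmul ℂ]
  y1_pow := by
    classical
    have h := y1_pow_smul_tens (A := A) (m + 1) (∅ : Finset (Fin m)) (by simp)
    simpa [vtens] using h

/-- The linear map from a cyclic module given by the image of the generator. -/
def liftCyclic {R M : Type*} [Ring R] [AddCommGroup M] [Module R M] (J : Submodule R R) (x : M)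
    (h : ∀ u ∈ J, u • x = 0) : (R ⧸ J) →ₗ[R] M :=
  J.liftQ (LinearMap.toSpanSingleton R M x) fun u hu => h u hu

theorem liftCyclic_mk_one {R M : Type*} [Ring R] [AddCommGroup M] [Module R M] (J : Submodule R R)
    (x : M) (h : ∀ u ∈ J, u • x = 0) : liftCyclic J x h (Submodule.Quotient.mk 1) = x :=
  one_smul R x

theorem weylIdeal_smul_v {u : U A} (hu : u ∈ weylIdeal A m 0) : u • v A m = 0 := by
  refine Subtype.ext ?_
  change u • vtens A m = 0
  induction hu using Submodule.span_induction with
  | mem x hx => exact isWeylVector_vtens.relator_smul hx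
  | zero => exact zero_smul _ _
  | add x y _ _ hx hy => rw [add_smul, hx, hy, add_zero]
  | smul c x _ hx => rw [smul_eq_mul, mul_smul, hx, smul_zero]

/-- The map from `W̄_A(m ω₁)` to the supersymmetric tensors. -/
def toTS (A : Type*) [CommRing A] [Algebra ℂ A] (m : ℕ) : WeylQuot A m 0 →ₗ[U A] TS A m :=
  liftCyclic (weylIdeal A m 0) (v A m) fun _ => weylIdeal_smul_v

theorem toTS_wbar : toTS A m (wbar A m 0) = v A m :=
  liftCyclic_mk_one (weylIdeal A m 0) (v A m) fun _ => weylIdeal_smul_v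

/-- The map from `W̄_A(m ω₁)` to the tensor power. -/
def toT (A : Type*) [CommRing A] [Algebra ℂ A] (m : ℕ) : WeylQuot A m 0 →ₗ[ℂ] T A m :=
  ((TS A m).subtype ∘ₗ toTS A m).restrictScalars ℂ

theorem toT_apply (y : WeylQuot A m 0) : toT A m y = (toTS A m y : T A m) := rfl

theorem toT_smul_wbar (u : U A) : toT A m (u • wbar A m 0) = u • vtens A m := by
  rw [toT_apply, map_smul, toTS_wbar]; rfl

theorem mem_filt_wbar (y : WeylQuot A m 0) : y ∈ filt A (wbar A m 0) m := by
  obtain ⟨u, rfl⟩ := Submodule.Quotient.mk_surjective _ y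
  rw [← smul_wbar]
  exact isWeylVector_wbar.smul_mem_filt u

/-- A linear map is injective once it carries a spanning family to an independent one. -/
theorem toT_injective_of_span {I : Type*} [LinearOrder I] (b : Module.Basis I ℂ A) (z : I → Prop)
    (X : Set ((I →₀ ℕ) × (I →₀ ℕ) × Finset I)) (hX : ∀ x ∈ X, Adm b m z x)
    (h : ∀ y, y ∈ Submodule.span ℂ (pvec b (wbar A m 0) '' X)) :
    Function.Injective (toT A m) := by
  rw [← LinearMap.ker_eq_bot, LinearMap.ker_eq_bot']
  intro y hy
  have h1 := h y
  rw [Finsupp.mem_span_image_iff_linearCombination] at h1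
  obtain ⟨l, hl, rfl⟩ := h1
  have hli : LinearIndepOn ℂ (pvec b (vtens A m)) X :=
    linearIndependent_pvec b Subtype.val_injective fun x : X => hX x x.2
  have h2 : Finsupp.linearCombination ℂ (pvec b (vtens A m)) l = 0 := by
    rw [← hy, Finsupp.linearCombination_apply, Finsupp.linearCombination_apply, Finsupp.sum,
      Finsupp.sum, map_sum]
    refine sum_congr rfl fun x _ => ?_
    rw [map_smul, pvec, pvec, toT_smul_wbar]
  rw [linearIndepOn_iff.1 hli l hl h2, map_zero]

/-- A basis through 1 is what allows h_1 ⊗ 1 to be eliminated; it need not be the basis of the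
theorem. -/
theorem exists_basis_one (A : Type*) [CommRing A] [Algebra ℂ A] [Nontrivial A] :
    ∃ (s : Set A) (b : Module.Basis s ℂ A) (i : s), b i = 1 := by
  have h : LinearIndepOn ℂ id ({1} : Set A) := by
    simp
  exact ⟨_, Module.Basis.extend h, ⟨1, Module.Basis.subset_extend h rfl⟩,
    Module.Basis.extend_apply_self h _⟩

/-- For nonzero A, an auxiliary basis containing 1 gives a spanning family of triples of size at
most m whose images are independent. -/
theorem toT_injective {I : Type*} [LinearOrder I] (b : Module.Basis I ℂ A) :
    Function.Injective (toT A m) := by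
  classical
  rcases subsingleton_or_nontrivial A with hA | hA
  -- In the zero algebra 1 = 0 lies in no basis. For m = 0 the module is spanned by its generator;
  -- for m > 0 the generator vanishes, since h_1 ⊗ 1 = 0 acts on it by m.
  · rcases Nat.eq_zero_or_pos m with rfl | hm
    · refine toT_injective_of_span b (fun _ => False) {x | size x = 0}
        (fun x hx => Or.inl ⟨fun _ => id, hx⟩) fun y => ?_
      refine (Submodule.span_le.2 ?_ : filt A (wbar A 0 0) 0 ≤ _) (mem_filt_wbar y)
      rintro _ ⟨ds, cs, xs, hl, rfl⟩
      obtain rfl : ds = [] := List.length_eq_zero_iff.1 (by omega)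
      obtain rfl : cs = [] := List.length_eq_zero_iff.1 (by omega)
      obtain rfl : xs = [] := List.length_eq_zero_iff.1 (by omega)
      refine Submodule.subset_span ⟨(0, 0, ∅), by simp [size], ?_⟩
      rw [pvec_eq]
      simp [p1_zero_zero]
    · have h0 : wbar A m 0 = 0 := by
        have h1 := (isWeylVector_wbar (A := A) (m := m)).h1_smul
        rw [el, Subsingleton.elim (1 : A) 0, TensorProduct.tmul_zero, map_zero, zero_smul] at h1
        exact (smul_eq_zero.1 h1.symm).resolve_left (Nat.cast_ne_zero.2 hm.ne')
      have h2 : ∀ y : WeylQuot A m 0, y = 0 := fun y => by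
        obtain ⟨u, rfl⟩ := Submodule.Quotient.mk_surjective _ y
        rw [← smul_wbar, h0, smul_zero]
      exact fun y y' _ => (h2 y).trans (h2 y').symm
  · obtain ⟨s, b', i₀, hi⟩ := exists_basis_one A
    let _ : LinearOrder s := linearOrderOfSTO WellOrderingRel
    exact toT_injective_of_span b' (· = i₀) {x | x.1 i₀ = 0 ∧ size x ≤ m}
      (fun x hx => Or.inr ⟨i₀, fun _ => Iff.rfl, hi, hx.1, hx.2⟩) fun y =>
        isWeylVector_wbar.filt_le_span b' hi m (mem_filt_wbar y)

/-! ### The basis -/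

variable {I : Type*} [LinearOrder I] (b : Module.Basis I ℂ A)

/-- The triple of an index. -/
def Index.triple (t : Index I m) : (I →₀ ℕ) × (I →₀ ℕ) × Finset I :=
  (t.φ₁, t.φ₂, univ.map ⟨t.ξ, t.strictMono.injective⟩)

theorem Index.card_triple (t : Index I m) : t.triple.2.2.card = t.n := by
  simp [Index.triple]

theorem Index.size_triple (t : Index I m) : SuperWeyl.size t.triple = m := by
  rw [SuperWeyl.size, t.card_triple]; exact t.size

theorem Index.orderEmbOfFin_triple (t : Index I m) :
    t.ξ = t.triple.2.2.orderEmbOfFin t.card_triple :=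
  orderEmbOfFin_unique _ (fun k => by simp [Index.triple]) t.strictMono

theorem Index.triple_injective : Function.Injective (Index.triple (I := I) (m := m)) := by
  intro t t' h
  have h1 := t.orderEmbOfFin_triple
  have h2 := t'.orderEmbOfFin_triple
  have hn : t.n = t'.n := by rw [← t.card_triple, h, t'.card_triple]
  obtain ⟨φ₁, φ₂, n, ξ, hξ, hs⟩ := t
  obtain ⟨φ₁', φ₂', n', ξ', hξ', hs'⟩ := t'
  dsimp only at hn
  subst hn
  have e1 : φ₁ = φ₁' := congrArg Prod.fst h
  have e2 : φ₂ = φ₂' := congrArg (fun x => x.2.1) h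
  subst e1 e2
  have e3 : ξ = ξ' := by
    dsimp only at h1 h2
    rw [h1, h2]
    simp only [h]
  subst e3
  rfl

theorem Index.exists_triple {x : (I →₀ ℕ) × (I →₀ ℕ) × Finset I} (hx : SuperWeyl.size x = m) :
    ∃ t : Index I m, t.triple = x := by
  refine ⟨⟨x.1, x.2.1, x.2.2.card, x.2.2.orderEmbOfFin rfl,
    (x.2.2.orderEmbOfFin rfl).strictMono, hx⟩, ?_⟩
  refine Prod.ext rfl (Prod.ext rfl ?_)
  exact map_orderEmbOfFin_univ x.2.2 rfl

theorem basisVec_eq (t : Index I m) : basisVec b m t = pvec b (wbar A m 0) t.triple := by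
  have h : ∀ (s : Finset I) (n : ℕ) (h : s.card = n),
      Y3 (fun k => b (s.orderEmbOfFin h k)) = Y3 fun k => b (s.orderEmbOfFin rfl k) := by
    rintro s _ rfl; rfl
  rw [basisVec, pvec, p, p, ← h _ _ t.card_triple, ← t.orderEmbOfFin_triple]
  rfl

theorem toT_basisVec (t : Index I m) :
    toT A m (basisVec b m t) = pvec b (vtens A m) t.triple := by
  rw [basisVec_eq, pvec, toT_smul_wbar, pvec]

theorem linearIndependent_basisVec : LinearIndependent ℂ (basisVec b m) := by
  refine LinearIndependent.of_comp (toT A m) ?_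
  have h := linearIndependent_pvec b (m := m) (z := fun _ => False)
    (Index.triple_injective (I := I) (m := m)) fun t => Or.inl ⟨fun _ => id, t.size_triple⟩
  convert h using 1
  funext t
  exact toT_basisVec b t

theorem TSspan_le_map : TSspan A m ≤
    (Submodule.span ℂ (Set.range (basisVec b m))).map (toT A m) := by
  refine (TSspan_le b).trans (Submodule.span_le.2 ?_)
  rintro _ ⟨x, hx, rfl⟩
  obtain ⟨t, rfl⟩ := Index.exists_triple hx
  exact ⟨_, Submodule.subset_span ⟨t, rfl⟩, toT_basisVec b t⟩

/-- The images already span the supersymmetric tensors, and the map to tensors is injective, so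
nothing outside the span is left. -/
theorem span_basisVec : Submodule.span ℂ (Set.range (basisVec b m)) = ⊤ := by
  refine eq_top_iff.2 fun y _ => ?_
  obtain ⟨y', hy', h⟩ := TSspan_le_map b (toTS A m y).2
  rwa [← toT_injective b h]

/-- No basis of A appears in the statement, so any basis with any linear order may be chosen. -/
theorem toTS_bijective : Function.Bijective (toTS A m) := by
  let b' := Module.Basis.ofVectorSpace ℂ A
  let _ : LinearOrder (Module.Basis.ofVectorSpaceIndex ℂ A) := by
    classical exact linearOrderOfSTO WellOrderingRel
  refine ⟨fun y y' h => toT_injective b' (congrArg Subtype.val h), fun t => ?_⟩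
  obtain ⟨y, _, h⟩ := TSspan_le_map b' t.2
  exact ⟨y, Subtype.ext h⟩

end
end SuperWeyl
end

theorem theorem3p1 (A : Type*) [CommRing A] [Algebra ℂ A] (I : Type*) [LinearOrder I]
    (b : Module.Basis I ℂ A) (m : ℕ) :
    (∃ Φ : SuperWeyl.WeylQuot A m 0 ≃ₗ[SuperWeyl.U A] SuperWeyl.TS A m,
      Φ (SuperWeyl.wbar A m 0) = SuperWeyl.v A m) ∧
    LinearIndependent ℂ (SuperWeyl.basisVec b m) ∧
    Submodule.span ℂ (Set.range (SuperWeyl.basisVec b m)) = ⊤ :=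
  ⟨⟨LinearEquiv.ofBijective (SuperWeyl.toTS A m) SuperWeyl.toTS_bijective, SuperWeyl.toTS_wbar⟩,
    SuperWeyl.linearIndependent_basisVec b, SuperWeyl.span_basisVec b⟩
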